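/- Let $\mathcal P$ be the space of Dirichlet polynomials $P(s)=\sum_{n=1}^N a_n n^{-s}$ with complex coefficients. The Bohr lift of $P$ is $\mathscr BP(z)=\sum_{n=1}^N a_n z^{\nu(n)}$ for $z$ in the infinite torus $\mathbb T^\infty=\{(z_1,z_2,\dots):|z_j|=1\}$, where $z^{\nu(n)}=\prod_j z_j^{\nu_j(n)}$ if $n=\prod_j p_j^{\nu_j(n)}$ and $p_j$ is the $j$-th prime. Let $m_\infty$ be the normalized Haar measure on $\mathbb T^\infty$, and for $\sigma\ge 0$ write $P_\sigma(s)=P(s+\sigma)$. For $0<p,q<\infty$ and $\alpha>-1$ put $$\|P\|_{\mathcal H^p}=\Big(\int_{\mathbb T^\infty}|\mathscr BP|^p\,dm_\infty\Big)^{1/p},\qquad \|P\|_{\mathcal H^{p,q}_\alpha}=\Big(\int_0^{\infty}\|P_\sigma\|_{\mathcal H^p}^q\,d\mu_\alpha(\sigma)\Big)^{1/q},\qquad d\mu_\alpha(\sigma)=\frac{2^{\alpha+1}}{\Gamma(\alpha+1)}\sigma^\alpha e^{-2\sigma}\,d\sigma .$$ Let $\mathcal H^{p,q}_\alpha$ be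 the completion of $\mathcal P$ with respect to the (quasi-)norm $\|\cdot\|_{\mathcal H^{p,q}_\alpha}$. It is regarded, through the bounded extensions of the point evaluations, as a space of functions (Dirichlet series) on the half-plane $\mathbb C_{1/2}=\{s\in\mathbb C:\operatorname{Re}s>1/2\}$: a function $f$ on $\mathbb C_{1/2}$ belongs to $\mathcal H^{p,q}_\alpha$ if and only if there is a sequence $(P_j)$ in $\mathcal P$ that is Cauchy for $\|\cdot\|_{\mathcal H^{p,q}_\alpha}$ and satisfies $P_j(s)\to f(s)$ for every $s\in\mathbb C_{1/2}$. **Theorem.** Let $0<p,q,u,v<\infty$ and $\alpha,\beta>-1$. Then $\mathcal H^{p,q}_\alpha\subset\mathcal H^{u,v}_\beta$ if and only if one of the following holds: 1. $p\ge u$ and $\frac{\alpha+1}{q}<\frac{\beta+1}{v}$; or 2. $p\ge u$, $\frac{\alpha+1}{q}=\frac{\beta+1}{v}$ and $q\le v$. -/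

import Mathlib

open scoped ENNReal

namespace DirichletMixed

noncomputable section

/-- Dirichlet polynomials `∑ aₙ n⁻ˢ` (finite sums over `n ≥ 1`), given by their coefficients. -/
abbrev DirichletPolynomial : Type := ℕ+ →₀ ℂ

/-- The value `P(s) = ∑ aₙ n⁻ˢ`. -/
def DirichletPolynomial.eval (P : DirichletPolynomial) (s : ℂ) : ℂ :=
  P.sum fun n a => a * ((n : ℕ) : ℂ) ^ (-s)

/-- The horizontal translate `P_σ(s) = P(s + σ)`; its `n`-th coefficient is `aₙ n^(-σ)`. -/
def DirichletPolynomial.translate (P : DirichletPolynomial) (σ : ℝ) : DirichletPolynomial :=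
  Finsupp.onFinset P.support (fun n => P n * ((n : ℕ) : ℂ) ^ (-(σ : ℂ))) (by
    intro n hn
    rw [Finsupp.mem_support_iff]
    exact left_ne_zero_of_mul hn)

/-- The translate is what its name says. -/
theorem DirichletPolynomial.eval_translate (P : DirichletPolynomial) (σ : ℝ) (s : ℂ) :
    (P.translate σ).eval s = P.eval (s + σ) := by
  unfold DirichletPolynomial.eval DirichletPolynomial.translate
  rw [Finsupp.onFinset_sum _ (by simp), Finsupp.sum]
  refine Finset.sum_congr rfl fun n _ => ?_
  have hn : ((n : ℕ) : ℂ) ≠ 0 := Nat.cast_ne_zero.mpr n.ne_zero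
  rw [mul_assoc, ← Complex.cpow_add _ _ hn]
  congr 2
  ring

/-- The infinite-dimensional torus `𝕋^∞`, one circle for each prime. A point is given by its
angles in `ℝ / ℤ`; its coordinates on the unit circle are `torusCoord θ p = exp (2 π i θ_p)`. -/
abbrev Torus : Type := Nat.Primes → UnitAddCircle

/-- The coordinate of a point of the torus at the prime `p`, on the unit circle of `ℂ`. -/
def torusCoord (θ : Torus) (p : Nat.Primes) : ℂ := (AddCircle.toCircle (θ p) : ℂ)

/-- The normalized Haar measure on `𝕋^∞`: the product of the normalized Lebesgue measures. -/
def torusMeasure : MeasureTheory.Measure Torus :=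
  MeasureTheory.Measure.infinitePi fun _ : Nat.Primes => AddCircle.haarAddCircle

/-- The monomial `z^ν(n) = ∏ z_p ^ ν_p(n)`, where `n = ∏ p ^ ν_p(n)`. -/
def bohrMonomial (n : ℕ+) (θ : Torus) : ℂ :=
  ∏ p ∈ Finset.subtype Nat.Prime (n : ℕ).primeFactors,
    torusCoord θ p ^ (n : ℕ).factorization (p : ℕ)

/-- The Bohr lift `∑ aₙ z^ν(n)` of a Dirichlet polynomial, as a function on the torus. -/
def bohrLift (P : DirichletPolynomial) (θ : Torus) : ℂ :=
  P.sum fun n a => a * bohrMonomial n θ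

/-- The Hardy (quasi-)norm `(∫ |𝓑P|^p dm_∞)^(1/p)` of a Dirichlet polynomial. -/
def hardyNorm (p : ℝ) (P : DirichletPolynomial) : ℝ≥0∞ :=
  (∫⁻ θ, ‖bohrLift P θ‖ₑ ^ p ∂torusMeasure) ^ (1 / p)

/-- The measure `dμ_α(σ) = 2^(α+1) / Γ(α+1) σ^α e^(-2σ) dσ` on `(0, ∞)`. -/
def weightMeasure (α : ℝ) : MeasureTheory.Measure ℝ :=
  (MeasureTheory.volume.restrict (Set.Ioi 0)).withDensity fun σ =>
    ENNReal.ofReal (2 ^ (α + 1) / Real.Gamma (α + 1) * σ ^ α * Real.exp (-2 * σ))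

/-- The mixed (quasi-)norm `(∫ ‖P_σ‖_{ℋ^p}^q dμ_α(σ))^(1/q)` of a Dirichlet polynomial. -/
def mixedNorm (p q α : ℝ) (P : DirichletPolynomial) : ℝ≥0∞ :=
  (∫⁻ σ, hardyNorm p (P.translate σ) ^ q ∂weightMeasure α) ^ (1 / q)

/-- The half-plane `ℂ_{1/2} = {s : Re s > 1/2}`. -/
abbrev HalfPlane : Type := {s : ℂ // 1 / 2 < s.re}

/-- A sequence of Dirichlet polynomials that is Cauchy for the mixed (quasi-)norm. -/
def IsMixedCauchy (p q α : ℝ) (P : ℕ → DirichletPolynomial) : Prop :=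
  ∀ ε : ℝ≥0∞, 0 < ε → ∃ N : ℕ, ∀ i ≥ N, ∀ j ≥ N, mixedNorm p q α (P i - P j) < ε

/-- The mixed norm space `ℋ^{p,q}_α`, the completion of the Dirichlet polynomials for the mixed
(quasi-)norm, as a space of functions on `ℂ_{1/2}`: the point evaluations at points of `ℂ_{1/2}`
extend to the completion, so that the element represented by a Cauchy sequence `P_j` is the
function `s ↦ lim P_j(s)`. -/
def mixedSpace (p q α : ℝ) : Set (HalfPlane → ℂ) :=
  {f | ∃ P : ℕ → DirichletPolynomial, IsMixedCauchy p q α P ∧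
    ∀ s : HalfPlane, Filter.Tendsto (fun j => (P j).eval (s : ℂ)) Filter.atTop (nhds (f s))}

end

end DirichletMixed

namespace DirichletMixed

noncomputable section

open MeasureTheory Complex

/-! ### Subharmonicity of `|g| ^ w` in one variable -/

/-! Everything rests on subharmonicity of `|g| ^ w` for arbitrary `w > 0`, transferred from the disc
to the infinite torus by averaging over a family of translations (`hardyInt_le_of_average`). This
yields two facts that hold even when `w < 1`: coordinatewise dilations with factors in `[0, 1)` are
contractions (`hardyInt_dilate_le`), and the projection onto the terms of weighted degree `m` has
norm at most `(m + 1) ^ (1 / w)` (`hardyInt_filter_wdeg_le`).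

Sufficiency. By the first fact `h σ = ‖P_σ‖` is antitone, so comparison with its values on `(τ/2,
τ]` gives `h τ ≲ ‖P‖ τ ^ (-(α+1)/q)` for `τ ≤ 1`. If `(α+1)/q < (β+1)/v`, the `v`-th power of this
bound is integrable for `μ_β` near `0`. In the case of equality with `q ≤ v`, it is applied only to
`h ^ (v-q)`, and the remaining integral is a multiple of `∫ h ^ q dμ_α`. Together with monotonicity
of Hardy norms in the exponent this is `mixedNorm_le_mixedNorm`; the same Cauchy sequences then
serve both spaces.

Necessity. A gliding hump (`not_subset_of_hasTestPolynomials`) turns homogeneous test polynomials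
with norm at most `1` in the source and large norm in the target into a function of the source space
outside the target. The humps live on disjoint blocks of primes, and the degree projections recover
each hump from any sequence representing the sum. Uniqueness of Dirichlet coefficients links the
representations in the two spaces, so neither a closed graph theorem nor a sharp bound for point
evaluations is needed.

There are two families of test polynomials. If the condition on `q, v, α, β` fails, lacunary sums `∑
(log π_k)^γ π_k^{-s}` with `γ = (α+1)/q` behave like sums of bumps at the scales `σ ≈ 1 / log π_k`
(`hasTestPolynomials_of_lacunary`). If `p < u`, the products `∏ (π_0^{-s} + π_j^{-s})` have Hardy
norms that are exact `N`-th powers with a strictly larger base for `u` than for `p`; this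
exponential gain beats the polynomial losses due to the weight and the projection
(`hasTestPolynomials_of_lt`). -/

/-- Averages over the unit circle as integrals over `ℝ / ℤ`. -/
theorem circleAverage_eq_integral_haarAddCircle (f : ℂ → ℝ) :
    Real.circleAverage f 0 1
      = ∫ x : UnitAddCircle, f (AddCircle.toCircle x : ℂ) ∂AddCircle.haarAddCircle := by
  have h1 : ∫ x : UnitAddCircle, f (AddCircle.toCircle x : ℂ) ∂AddCircle.haarAddCircle
      = ∫ x : UnitAddCircle, f (AddCircle.toCircle x : ℂ) := by
    rw [AddCircle.integral_haarAddCircle]; simp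
  rw [h1, ← UnitAddCircle.integral_preimage 0, Real.circleAverage_def,
    ← intervalIntegral.integral_of_le (by norm_num)]
  have h2 : ∀ a : ℝ, f (AddCircle.toCircle (a : UnitAddCircle) : ℂ)
      = f (circleMap 0 1 (2 * Real.pi * a)) := by
    intro a
    rw [AddCircle.toCircle_apply_mk]
    simp [circleMap, Circle.coe_exp]
  simp_rw [h2]
  rw [intervalIntegral.integral_comp_mul_left (fun t => f (circleMap 0 1 t))
    (by positivity : (2 * Real.pi) ≠ 0)]
  simp

/-- The tangent line of the exponential at `1`, with equality when `t ^ w = e`. -/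
theorem exp_one_mul_log_le (t w : ℝ) (hw : 0 < w) (ht : 0 ≤ t) :
    Real.exp 1 * (w * Real.log t) ≤ t ^ w := by
  rcases ht.eq_or_lt with rfl | ht
  · simp [Real.zero_rpow hw.ne']
  · have h := Real.add_one_le_exp (w * Real.log t - 1)
    have h2 : t ^ w = Real.exp 1 * Real.exp (w * Real.log t - 1) := by
      rw [← Real.exp_add, Real.rpow_def_of_pos ht]; ring_nf
    rw [h2]
    gcongr
    linarith

/-- Jensen's formula says that `log |g|` is subharmonic. After scaling `g` so that the tangent
inequality `exp_one_mul_log_le` is an equality at the centre, averaging that inequality over the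
circle passes from the logarithm to the power. -/
theorem rpow_norm_le_circleAverage {g : ℂ → ℂ} {w : ℝ} (hw : 0 < w)
    (hg : AnalyticOnNhd ℂ g (Metric.closedBall 0 1)) :
    ‖g 0‖ ^ w ≤ Real.circleAverage (fun z => ‖g z‖ ^ w) 0 1 := by
  by_cases h0 : g 0 = 0
  · rw [h0, norm_zero, Real.zero_rpow hw.ne']
    exact Real.circleAverage_nonneg_of_nonneg fun x _ => by positivity
  -- Chosen so that `‖M g(0)‖ ^ w = e`, the point of tangency.
  set M : ℝ := Real.exp (1 / w) / ‖g 0‖ with hM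
  have hg0 : 0 < ‖g 0‖ := norm_pos_iff.2 h0
  have hMpos : 0 < M := by positivity
  have hG : AnalyticOnNhd ℂ (fun z => (M : ℂ) * g z) (Metric.closedBall 0 |(1 : ℝ)|) := by
    rw [abs_one]; exact analyticOnNhd_const.mul hg
  have hG0 : (M : ℂ) * g 0 ≠ 0 := mul_ne_zero (by exact_mod_cast hMpos.ne') h0
  have hn : ∀ z, ‖(M : ℂ) * g z‖ = M * ‖g z‖ := fun z => by
    rw [norm_mul, Complex.norm_of_nonneg hMpos.le]
  have hJ := hG.circleAverage_log_norm one_ne_zero hG0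
  -- Zeros in the disc contribute `log (1 / |u|) ≥ 0` in Jensen's formula, so dropping them leaves
  -- an inequality in the right direction.
  have hsum : 0 ≤ ∑ᶠ u, (MeromorphicOn.divisor (fun z => (M : ℂ) * g z)
      (Metric.closedBall 0 |(1 : ℝ)|) u : ℝ) * Real.log (1 * ‖(0 : ℂ) - u‖⁻¹) := by
    refine finsum_nonneg fun u => ?_
    by_cases hu : u ∈ Metric.closedBall (0 : ℂ) |(1 : ℝ)|
    · refine mul_nonneg (mod_cast (MeromorphicOn.AnalyticOnNhd.divisor_nonneg hG) u) ?_
      rcases eq_or_ne u 0 with rfl | hu0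
      · simp
      · apply Real.log_nonneg
        rw [one_mul, zero_sub, norm_neg]
        refine (one_le_inv₀ (norm_pos_iff.2 hu0)).2 ?_
        simpa using hu
    · rw [Function.locallyFinsuppWithin.apply_eq_zero_of_notMem _ hu]; simp
  have hlog : Real.log ‖(M : ℂ) * g 0‖ = 1 / w := by
    rw [hn, hM, div_mul_cancel₀ _ hg0.ne', Real.log_exp]
  have hJ' : 1 / w ≤ Real.circleAverage (fun z => Real.log ‖(M : ℂ) * g z‖) 0 1 := by
    rw [hJ, hlog]; linarith
  have hi1 : CircleIntegrable (fun z => Real.log ‖(M : ℂ) * g z‖) 0 1 :=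
    (hG.mono Metric.sphere_subset_closedBall).meromorphicOn.circleIntegrable_log_norm
  have hcont : ContinuousOn g (Metric.sphere 0 |(1 : ℝ)|) :=
    hg.continuousOn.mono (by rw [abs_one]; exact Metric.sphere_subset_closedBall)
  have hi2 : CircleIntegrable (fun z => ‖g z‖ ^ w) 0 1 := by
    refine ContinuousOn.circleIntegrable' ?_
    exact hcont.norm.rpow_const fun _ _ => Or.inr hw.le
  have hi1' : CircleIntegrable (fun z => Real.exp 1 * (w * Real.log ‖(M : ℂ) * g z‖)) 0 1 := by
    have := (hi1.const_fun_smul (a := Real.exp 1 * w))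
    simpa [smul_eq_mul, mul_assoc] using this
  have hi2' : CircleIntegrable (fun z => M ^ w * ‖g z‖ ^ w) 0 1 := by
    simpa [smul_eq_mul] using hi2.const_fun_smul (a := M ^ w)
  have key := Real.circleAverage_mono hi1' hi2' fun z _ => by
    have := exp_one_mul_log_le ‖(M : ℂ) * g z‖ w hw (norm_nonneg _)
    rwa [hn z, Real.mul_rpow hMpos.le (norm_nonneg _), ← hn z] at this
  have e1 : Real.circleAverage (fun z => Real.exp 1 * (w * Real.log ‖(M : ℂ) * g z‖)) 0 1
      = Real.exp 1 * w * Real.circleAverage (fun z => Real.log ‖(M : ℂ) * g z‖) 0 1 := by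
    rw [← smul_eq_mul (Real.exp 1 * w), ← Real.circleAverage_fun_smul]
    simp [mul_assoc]
  have e2 : Real.circleAverage (fun z => M ^ w * ‖g z‖ ^ w) 0 1
      = M ^ w * Real.circleAverage (fun z => ‖g z‖ ^ w) 0 1 := by
    rw [← smul_eq_mul (M ^ w), ← Real.circleAverage_fun_smul]
    simp
  rw [e1, e2] at key
  have hMw : M ^ w * ‖g 0‖ ^ w = Real.exp 1 := by
    rw [← Real.mul_rpow hMpos.le hg0.le, hM, div_mul_cancel₀ _ hg0.ne', ← Real.exp_mul,
      one_div_mul_cancel hw.ne']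
  have hMw' : 0 < M ^ w := by positivity
  refine le_of_mul_le_mul_left ?_ hMw'
  rw [hMw]
  refine le_trans ?_ key
  calc Real.exp 1 = Real.exp 1 * w * (1 / w) := by field_simp
    _ ≤ _ := by gcongr

theorem enorm_rpow_eq_ofReal (z : ℂ) {w : ℝ} (hw : 0 ≤ w) :
    ‖z‖ₑ ^ w = ENNReal.ofReal (‖z‖ ^ w) := by
  rw [← ofReal_norm, ENNReal.ofReal_rpow_of_nonneg (norm_nonneg _) hw]

/-- Subharmonicity of `|g| ^ w` at the centre of the unit disc. -/
theorem enorm_rpow_le_lintegral_circle {g : ℂ → ℂ} {w : ℝ} (hw : 0 < w)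
    (hg : AnalyticOnNhd ℂ g (Metric.closedBall 0 1)) :
    ‖g 0‖ₑ ^ w ≤ ∫⁻ x : UnitAddCircle, ‖g (AddCircle.toCircle x : ℂ)‖ₑ ^ w
      ∂AddCircle.haarAddCircle := by
  have h := rpow_norm_le_circleAverage hw hg
  rw [circleAverage_eq_integral_haarAddCircle] at h
  have hc : Continuous fun x : UnitAddCircle => ‖g (AddCircle.toCircle x : ℂ)‖ ^ w := by
    refine Continuous.rpow_const (Continuous.norm ?_) fun _ => Or.inr hw.le
    refine hg.continuousOn.comp_continuous (by fun_prop) fun x => by simp [Circle.norm_coe]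
  have hi : Integrable (fun x : UnitAddCircle => ‖g (AddCircle.toCircle x : ℂ)‖ ^ w)
      AddCircle.haarAddCircle :=
    hc.integrable_of_hasCompactSupport (HasCompactSupport.of_compactSpace _)
  simp_rw [enorm_rpow_eq_ofReal _ hw.le]
  rw [← ofReal_integral_eq_lintegral_ofReal hi (Filter.Eventually.of_forall fun x => by positivity)]
  exact ENNReal.ofReal_le_ofReal h

/-! ### Coefficients of a polynomial -/

/-- An average is dominated by its largest term. This replaces the triangle inequality in `L^w` and
works uniformly for `w < 1` and `w ≥ 1`. -/
theorem enorm_sum_rpow_le {ι : Type*} (s : Finset ι) (f : ι → ℂ) {w : ℝ} (hw : 0 < w)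
    {C : ℝ} (hC : 0 < C) (hs : (s.card : ℝ) ≤ C) :
    ‖(C : ℂ)⁻¹ * ∑ i ∈ s, f i‖ₑ ^ w ≤ ∑ i ∈ s, ‖f i‖ₑ ^ w := by
  rcases s.eq_empty_or_nonempty with rfl | hne
  · simp [ENNReal.zero_rpow_of_pos hw]
  obtain ⟨j, hj, hmax⟩ := s.exists_max_image (fun i => ‖f i‖) hne
  refine le_trans (ENNReal.rpow_le_rpow ?_ hw.le)
    (Finset.single_le_sum (f := fun i => ‖f i‖ₑ ^ w) (fun _ _ => zero_le) hj)
  rw [enorm_le_iff_norm_le, norm_mul, norm_inv, Complex.norm_of_nonneg hC.le,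
    inv_mul_le_iff₀ hC]
  calc ‖∑ i ∈ s, f i‖ ≤ ∑ i ∈ s, ‖f i‖ := norm_sum_le _ _
    _ ≤ ∑ i ∈ s, ‖f j‖ := Finset.sum_le_sum hmax
    _ = s.card * ‖f j‖ := by simp
    _ ≤ C * ‖f j‖ := by gcongr

/-- The average over the `M`-th roots of unity keeps the exponents congruent to `m` modulo `M`. -/
theorem sum_pow_rootsOfUnity {ι : Type*} (s : Finset ι) (a : ι → ℂ) (d : ι → ℕ) (m M : ℕ)
    (hM : 0 < M) {ω : ℂ} (hω : IsPrimitiveRoot ω M) (z : ℂ) :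
    (M : ℂ)⁻¹ * ∑ j ∈ Finset.range M, (ω ^ (m * j))⁻¹ * ∑ i ∈ s, a i * (ω ^ j * z) ^ d i
      = ∑ i ∈ s with d i ≡ m [MOD M], a i * z ^ d i := by
  have hω0 : ω ≠ 0 := hω.ne_zero hM.ne'
  have hM' : (M : ℂ) ≠ 0 := by exact_mod_cast hM.ne'
  have key : ∀ i, ∑ j ∈ Finset.range M, (ω ^ (m * j))⁻¹ * (ω ^ j) ^ d i
      = if d i ≡ m [MOD M] then (M : ℂ) else 0 := by
    intro i
    have h1 : ∀ j, (ω ^ (m * j))⁻¹ * (ω ^ j) ^ d i = ((ω ^ m)⁻¹ * ω ^ d i) ^ j := by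
      intro j; rw [mul_pow, inv_pow, ← pow_mul, ← pow_mul, ← pow_mul, mul_comm j]
    simp_rw [h1]
    split_ifs with h
    · have : ω ^ d i = ω ^ m := by
        rw [hω.eq_orderOf] at h
        rw [← pow_mod_orderOf, h, pow_mod_orderOf]
      simp [this, hω0]
    · have hne : (ω ^ m)⁻¹ * ω ^ d i ≠ 1 := by
        intro h'
        rw [inv_mul_eq_one₀ (pow_ne_zero _ hω0)] at h'
        apply h
        have h2 : ω ^ (d i % M) = ω ^ (m % M) := by
          conv_lhs => rw [hω.eq_orderOf, pow_mod_orderOf, ← h', ← pow_mod_orderOf, ← hω.eq_orderOf]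
        exact hω.pow_inj (Nat.mod_lt _ hM) (Nat.mod_lt _ hM) h2
      have hpow : ((ω ^ m)⁻¹ * ω ^ d i) ^ M = 1 := by
        rw [mul_pow, inv_pow, ← pow_mul, ← pow_mul, mul_comm m, mul_comm (d i), pow_mul, pow_mul,
          hω.pow_eq_one]; simp
      rw [geom_sum_eq hne, hpow]; simp
  calc _ = (M : ℂ)⁻¹ * ∑ i ∈ s, a i * z ^ d i *
        ∑ j ∈ Finset.range M, (ω ^ (m * j))⁻¹ * (ω ^ j) ^ d i := by
        congr 1
        simp_rw [Finset.mul_sum]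
        rw [Finset.sum_comm]
        refine Finset.sum_congr rfl fun i _ => Finset.sum_congr rfl fun j _ => ?_
        rw [mul_pow]; ring
    _ = _ := by
        simp_rw [key]
        rw [Finset.sum_filter, Finset.mul_sum]
        refine Finset.sum_congr rfl fun i _ => ?_
        split_ifs
        · field_simp
        · simp

/-- The coefficient of order `m` of a polynomial, in terms of its `w`-th mean on the circle. -/
theorem enorm_coeff_rpow_le_lintegral_circle {ι : Type*} (s : Finset ι) (a : ι → ℂ) (d : ι → ℕ)
    (m : ℕ) {w : ℝ} (hw : 0 < w) :
    ‖∑ i ∈ s with d i = m, a i‖ₑ ^ w ≤ (m + 1 : ℕ) * ∫⁻ x : UnitAddCircle,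
      ‖∑ i ∈ s, a i * (AddCircle.toCircle x : ℂ) ^ d i‖ₑ ^ w ∂AddCircle.haarAddCircle := by
  -- The modulus exceeds `m`, so every exponent congruent to `m` is at least `m`. After filtering,
  -- division by `z ^ m` leaves a polynomial whose value at `0` is the desired coefficient, and
  -- subharmonicity applies.
  set M := m + 1 with hMdef
  have hM : 0 < M := Nat.succ_pos m
  set ω : ℂ := Complex.exp (2 * Real.pi * I / M) with hωdef
  have hω : IsPrimitiveRoot ω M := Complex.isPrimitiveRoot_exp M hM.ne'
  set t : UnitAddCircle := ((1 / M : ℝ) : UnitAddCircle) with ht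
  have hωt : (AddCircle.toCircle t : ℂ) = ω := by
    rw [ht, AddCircle.toCircle_apply_mk, Circle.coe_exp, hωdef]
    congr 1; push_cast; ring
  set g : ℂ → ℂ := fun z => ∑ i ∈ s with d i ≡ m [MOD M], a i * z ^ (d i - m) with hgdef
  have hle : ∀ i, d i ≡ m [MOD M] → m ≤ d i := by
    intro i h
    have h2 : d i % M = m := by rw [h]; exact Nat.mod_eq_of_lt (Nat.lt_succ_self m)
    calc m = d i % M := h2.symm
      _ ≤ d i := Nat.mod_le _ _
  have hg : AnalyticOnNhd ℂ g (Metric.closedBall 0 1) := by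
    intro z _
    apply Finset.analyticAt_fun_sum
    intro i _
    fun_prop
  have hg0 : g 0 = ∑ i ∈ s with d i = m, a i := by
    rw [hgdef]
    simp only
    have : (s.filter fun i => d i = m) = (s.filter fun i => d i ≡ m [MOD M]).filter
        fun i => d i = m := by
      ext i
      simp only [Finset.mem_filter]
      constructor
      · rintro ⟨h1, h2⟩; exact ⟨⟨h1, by rw [h2]⟩, h2⟩
      · rintro ⟨⟨h1, _⟩, h2⟩; exact ⟨h1, h2⟩
    rw [this, Finset.sum_filter (s := s.filter _)]
    refine Finset.sum_congr rfl fun i hi => ?_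
    have := hle i (Finset.mem_filter.1 hi).2
    split_ifs with h
    · simp [h]
    · rw [zero_pow (by omega)]; simp
  have hgn : ∀ x : UnitAddCircle, ‖g (AddCircle.toCircle x : ℂ)‖ₑ ^ w
      ≤ ∑ j ∈ Finset.range M,
        ‖∑ i ∈ s, a i * (AddCircle.toCircle (j • t + x) : ℂ) ^ d i‖ₑ ^ w := by
    intro x
    set z : ℂ := (AddCircle.toCircle x : ℂ) with hz
    have hzn : ‖z‖ₑ = 1 := by
      rw [← ofReal_norm, hz, Circle.norm_coe, ENNReal.ofReal_one]
    have e1 : z ^ m * g z = ∑ i ∈ s with d i ≡ m [MOD M], a i * z ^ d i := by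
      rw [hgdef]; simp only
      rw [Finset.mul_sum]
      refine Finset.sum_congr rfl fun i hi => ?_
      have := hle i (Finset.mem_filter.1 hi).2
      rw [← mul_assoc, mul_comm (z ^ m), mul_assoc, ← pow_add, Nat.add_sub_cancel' this]
    have e2 : ‖g z‖ₑ = ‖z ^ m * g z‖ₑ := by
      rw [enorm_mul, enorm_pow, hzn, one_pow, one_mul]
    rw [e2, e1, ← sum_pow_rootsOfUnity s a d m M hM hω z]
    have := enorm_sum_rpow_le (Finset.range M)
      (fun j => (ω ^ (m * j))⁻¹ * ∑ i ∈ s, a i * (ω ^ j * z) ^ d i) hw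
      (C := M) (by exact_mod_cast hM) (by simp)
    rw [Complex.ofReal_natCast] at this
    refine this.trans (Finset.sum_le_sum fun j _ => le_of_eq ?_)
    have hωn : ‖ω‖ₑ = 1 := by
      rw [← ofReal_norm, ← hωt, Circle.norm_coe, ENNReal.ofReal_one]
    rw [enorm_mul, enorm_inv (pow_ne_zero _ (hω.ne_zero hM.ne')), enorm_pow, hωn]
    simp only [one_pow, inv_one, one_mul, AddCircle.toCircle_add, AddCircle.toCircle_nsmul,
      Circle.coe_mul, Circle.coe_pow, hωt, hz]
  rw [← hg0]
  refine (enorm_rpow_le_lintegral_circle hw hg).trans ((lintegral_mono hgn).trans ?_)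
  rw [lintegral_finsetSum]
  · have : ∀ j ∈ Finset.range M, ∫⁻ x : UnitAddCircle,
        ‖∑ i ∈ s, a i * (AddCircle.toCircle (j • t + x) : ℂ) ^ d i‖ₑ ^ w ∂AddCircle.haarAddCircle
        = ∫⁻ x : UnitAddCircle,
        ‖∑ i ∈ s, a i * (AddCircle.toCircle x : ℂ) ^ d i‖ₑ ^ w ∂AddCircle.haarAddCircle := by
      intro j _
      exact lintegral_add_left_eq_self
        (fun x => ‖∑ i ∈ s, a i * (AddCircle.toCircle x : ℂ) ^ d i‖ₑ ^ w) (j • t)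
    rw [Finset.sum_congr rfl this]
    simp
  · intro j _
    exact (Continuous.measurable (by fun_prop)).enorm.pow_const _

/-! ### Completely multiplicative and completely additive functions -/

/-- The set of prime divisors. -/
def primeSet (n : ℕ+) : Finset Nat.Primes := Finset.subtype Nat.Prime (n : ℕ).primeFactors

/-- The completely multiplicative function with value `c p` at the prime `p`. -/
def mon (c : Nat.Primes → ℂ) (n : ℕ+) : ℂ :=
  ∏ p ∈ primeSet n, c p ^ (n : ℕ).factorization (p : ℕ)

/-- The completely additive function with value `k p` at the prime `p`. -/
def wdeg (k : Nat.Primes → ℕ) (n : ℕ+) : ℕ :=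
  ∑ p ∈ primeSet n, k p * (n : ℕ).factorization (p : ℕ)

theorem pnat_induction {P : ℕ+ → Prop} (h1 : P 1) (hp : ∀ p : Nat.Primes, P (p : ℕ+))
    (hmul : ∀ a b, P a → P b → P (a * b)) (n : ℕ+) : P n := by
  obtain ⟨n, hn⟩ := n
  induction n using Nat.recOnMul with
  | zero => exact absurd hn (lt_irrefl 0)
  | one => exact h1
  | prime p hp' => exact hp ⟨p, hp'⟩
  | mul a b ha hb =>
    have ha0 : 0 < a := Nat.pos_of_mul_pos_right hn
    have hb0 : 0 < b := Nat.pos_of_mul_pos_left hn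
    exact hmul ⟨a, ha0⟩ ⟨b, hb0⟩ (ha ha0) (hb hb0)

theorem mem_primeSet {n : ℕ+} {p : Nat.Primes} :
    p ∈ primeSet n ↔ (p : ℕ) ∣ n := by
  refine Finset.mem_subtype.trans ?_
  rw [Nat.mem_primeFactors]
  exact ⟨fun h => h.2.1, fun h => ⟨p.2, h, n.ne_zero⟩⟩

theorem factorization_eq_zero_of_notMem {n : ℕ+} {p : Nat.Primes}
    (h : p ∉ primeSet n) : (n : ℕ).factorization (p : ℕ) = 0 :=
  Nat.factorization_eq_zero_of_not_dvd fun h' => h (mem_primeSet.2 h')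

theorem mon_eq_prod (c : Nat.Primes → ℂ) (n : ℕ+) {S : Finset Nat.Primes}
    (hS : primeSet n ⊆ S) :
    mon c n = ∏ p ∈ S, c p ^ (n : ℕ).factorization (p : ℕ) :=
  Finset.prod_subset hS fun p _ h => by rw [factorization_eq_zero_of_notMem h, pow_zero]

theorem wdeg_eq_sum (k : Nat.Primes → ℕ) (n : ℕ+) {S : Finset Nat.Primes}
    (hS : primeSet n ⊆ S) :
    wdeg k n = ∑ p ∈ S, k p * (n : ℕ).factorization (p : ℕ) :=
  Finset.sum_subset hS fun p _ h => by rw [factorization_eq_zero_of_notMem h, mul_zero]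

@[simp] theorem mon_one (c : Nat.Primes → ℂ) : mon c 1 = 1 := by
  exact Finset.prod_eq_one fun p _ => by simp

@[simp] theorem wdeg_one (k : Nat.Primes → ℕ) : wdeg k 1 = 0 := by
  exact Finset.sum_eq_zero fun p _ => by simp

theorem primeSet_subset_of_dvd {m n : ℕ+} (h : (m : ℕ) ∣ n) :
    primeSet m ⊆ primeSet n :=
  fun _ hp => mem_primeSet.2 ((mem_primeSet.1 hp).trans h)

theorem mon_mul (c : Nat.Primes → ℂ) (m n : ℕ+) : mon c (m * n) = mon c m * mon c n := by
  have hm : (m : ℕ) ∣ ((m * n : ℕ+) : ℕ) := by simp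
  have hn : (n : ℕ) ∣ ((m * n : ℕ+) : ℕ) := by simp
  rw [mon_eq_prod c m (primeSet_subset_of_dvd hm),
    mon_eq_prod c n (primeSet_subset_of_dvd hn), mon, ← Finset.prod_mul_distrib]
  refine Finset.prod_congr rfl fun p _ => ?_
  rw [PNat.mul_coe, Nat.factorization_mul m.ne_zero n.ne_zero, Finsupp.add_apply, pow_add]

theorem wdeg_mul (k : Nat.Primes → ℕ) (m n : ℕ+) : wdeg k (m * n) = wdeg k m + wdeg k n := by
  have hm : (m : ℕ) ∣ ((m * n : ℕ+) : ℕ) := by simp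
  have hn : (n : ℕ) ∣ ((m * n : ℕ+) : ℕ) := by simp
  rw [wdeg_eq_sum k m (primeSet_subset_of_dvd hm),
    wdeg_eq_sum k n (primeSet_subset_of_dvd hn), wdeg, ← Finset.sum_add_distrib]
  refine Finset.sum_congr rfl fun p _ => ?_
  rw [PNat.mul_coe, Nat.factorization_mul m.ne_zero n.ne_zero, Finsupp.add_apply, mul_add]

theorem primeSet_prime (p : Nat.Primes) :
    primeSet (p : ℕ+) = {p} := by
  ext q
  rw [mem_primeSet, Finset.mem_singleton]
  change (q : ℕ) ∣ (p : ℕ) ↔ _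
  rw [Nat.prime_dvd_prime_iff_eq q.2 p.2]
  exact ⟨fun h => Subtype.ext h, fun h => by rw [h]⟩

@[simp] theorem mon_prime (c : Nat.Primes → ℂ) (p : Nat.Primes) : mon c (p : ℕ+) = c p := by
  rw [mon, primeSet_prime, Finset.prod_singleton]
  change c p ^ (p : ℕ).factorization p = _
  rw [p.2.factorization_self, pow_one]

@[simp] theorem wdeg_prime (k : Nat.Primes → ℕ) (p : Nat.Primes) : wdeg k (p : ℕ+) = k p := by
  rw [wdeg, primeSet_prime, Finset.sum_singleton]
  change k p * (p : ℕ).factorization p = _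
  rw [p.2.factorization_self, mul_one]

theorem mon_mul_left (c d : Nat.Primes → ℂ) (n : ℕ+) :
    mon (fun p => c p * d p) n = mon c n * mon d n := by
  simp only [mon, mul_pow, Finset.prod_mul_distrib]

theorem mon_pow_wdeg (z : ℂ) (k : Nat.Primes → ℕ) (n : ℕ+) :
    mon (fun p => z ^ k p) n = z ^ wdeg k n := by
  simp only [mon, wdeg, ← pow_mul, Finset.prod_pow_eq_pow_sum]

theorem norm_mon_eq_one {c : Nat.Primes → ℂ} (hc : ∀ p, ‖c p‖ = 1) (n : ℕ+) : ‖mon c n‖ = 1 := by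
  simp [mon, norm_prod, hc]

theorem mon_eq_of_monoidHom (f : ℕ+ →* ℂ) (n : ℕ+) : f n = mon (fun p => f p) n := by
  induction n using pnat_induction with
  | h1 => simp
  | hp p => simp
  | hmul a b ha hb => rw [map_mul, mon_mul, ha, hb]

/-- Complete multiplicativity of `n ↦ n ^ s`; it turns a horizontal translation into a dilation of
the coordinates. -/
theorem mon_cpow (s : ℂ) (n : ℕ+) :
    mon (fun p => ((p : ℕ) : ℂ) ^ s) n = ((n : ℕ) : ℂ) ^ s := by
  refine (mon_eq_of_monoidHom ⟨⟨fun n : ℕ+ => ((n : ℕ) : ℂ) ^ s, by simp⟩, fun a b => ?_⟩ n).symm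
  simp only [PNat.mul_coe, Nat.cast_mul]
  exact natCast_mul_natCast_cpow _ _ _

/-! ### The torus -/

theorem torusCoord_add (θ δ : Torus) (p : Nat.Primes) :
    torusCoord (θ + δ) p = torusCoord θ p * torusCoord δ p := by
  simp [torusCoord, AddCircle.toCircle_add]

theorem norm_torusCoord (θ : Torus) (p : Nat.Primes) : ‖torusCoord θ p‖ = 1 :=
  Circle.norm_coe _

theorem continuous_torusCoord (p : Nat.Primes) : Continuous fun θ => torusCoord θ p := by
  unfold torusCoord; fun_prop

theorem bohrMonomial_eq_mon (n : ℕ+) (θ : Torus) : bohrMonomial n θ = mon (torusCoord θ) n := rfl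

theorem bohrMonomial_add (n : ℕ+) (θ δ : Torus) :
    bohrMonomial n (θ + δ) = bohrMonomial n θ * bohrMonomial n δ := by
  simp only [bohrMonomial_eq_mon, ← mon_mul_left]
  congr 1
  ext p
  exact torusCoord_add θ δ p

theorem norm_bohrMonomial (n : ℕ+) (θ : Torus) : ‖bohrMonomial n θ‖ = 1 :=
  norm_mon_eq_one (norm_torusCoord θ) n

theorem continuous_bohrMonomial (n : ℕ+) : Continuous fun θ => bohrMonomial n θ := by
  unfold bohrMonomial
  exact continuous_finsetProd _ fun p _ => (continuous_torusCoord p).pow _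

theorem bohrLift_eq_sum (P : DirichletPolynomial) (θ : Torus) :
    bohrLift P θ = ∑ n ∈ P.support, P n * bohrMonomial n θ := rfl

theorem continuous_bohrLift (P : DirichletPolynomial) : Continuous (bohrLift P) := by
  unfold bohrLift Finsupp.sum
  exact continuous_finsetSum _ fun n _ => continuous_const.mul (continuous_bohrMonomial n)

theorem measurable_bohrLift (P : DirichletPolynomial) : Measurable (bohrLift P) :=
  (continuous_bohrLift P).measurable

theorem bohrLift_add (P Q : DirichletPolynomial) (θ : Torus) :
    bohrLift (P + Q) θ = bohrLift P θ + bohrLift Q θ :=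
  Finsupp.sum_add_index' (by simp) (by intros; ring)

theorem bohrLift_smul (c : ℂ) (P : DirichletPolynomial) (θ : Torus) :
    bohrLift (c • P) θ = c * bohrLift P θ := by
  unfold bohrLift
  rw [Finsupp.sum_smul_index (by simp), Finsupp.mul_sum]
  simp only [mul_assoc]

theorem bohrLift_single (n : ℕ+) (a : ℂ) (θ : Torus) :
    bohrLift (Finsupp.single n a) θ = a * bohrMonomial n θ :=
  Finsupp.sum_single_index (by simp)

theorem bohrLift_sum {ι : Type*} (s : Finset ι) (f : ι → DirichletPolynomial) (θ : Torus) :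
    bohrLift (∑ i ∈ s, f i) θ = ∑ i ∈ s, bohrLift (f i) θ := by
  classical
  induction s using Finset.induction_on with
  | empty => simp [bohrLift]
  | insert a s ha ih => rw [Finset.sum_insert ha, Finset.sum_insert ha, bohrLift_add, ih]

instance : IsProbabilityMeasure torusMeasure := by
  unfold torusMeasure; infer_instance

/-- Each coordinate measure is translation invariant, and the image of a product measure under a
coordinatewise map is the product of the images. -/
theorem measurePreserving_add_right_torus (δ : Torus) :
    MeasurePreserving (fun θ => θ + δ) torusMeasure torusMeasure := by
  refine ⟨by fun_prop, ?_⟩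
  have h := Measure.infinitePi_map_pi (fun _ : Nat.Primes => (AddCircle.haarAddCircle :
    Measure UnitAddCircle)) (f := fun p x => x + δ p) fun p => by fun_prop
  have h2 : ∀ p : Nat.Primes, (AddCircle.haarAddCircle : Measure UnitAddCircle).map
      (fun x => x + δ p) = AddCircle.haarAddCircle := fun p =>
    (measurePreserving_add_right AddCircle.haarAddCircle (δ p)).map_eq
  simp only [h2] at h
  exact h

/-- Averaging over translations of the torus. -/
theorem lintegral_torus_average {δ : UnitAddCircle → Torus} (hδ : Measurable δ)
    {F : Torus → ℝ≥0∞} (hF : Measurable F) :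
    ∫⁻ θ, ∫⁻ x, F (θ + δ x) ∂AddCircle.haarAddCircle ∂torusMeasure = ∫⁻ θ, F θ ∂torusMeasure := by
  rw [lintegral_lintegral_swap]
  · simp_rw [fun x => (measurePreserving_add_right_torus (δ x)).lintegral_comp hF]
    simp
  · exact (hF.comp (measurable_fst.add (hδ.comp measurable_snd))).aemeasurable

/-! ### Means of Bohr lifts -/

/-- The integral `∫ |𝓑P|^w`. -/
def hardyInt (w : ℝ) (P : DirichletPolynomial) : ℝ≥0∞ := ∫⁻ θ, ‖bohrLift P θ‖ₑ ^ w ∂torusMeasure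

theorem hardyNorm_eq (w : ℝ) (P : DirichletPolynomial) :
    hardyNorm w P = hardyInt w P ^ (1 / w) := rfl

theorem measurable_enorm_bohrLift_rpow (P : DirichletPolynomial) (w : ℝ) :
    Measurable fun θ => ‖bohrLift P θ‖ₑ ^ w :=
  (measurable_bohrLift P).enorm.pow_const w

/-- The transference principle: a one-variable estimate along the translates `θ + δ x` integrates
over the torus by Tonelli and invariance. The family `δ` need only be measurable, which leaves room
for Möbius curves as well as rotations. -/
theorem hardyInt_le_of_average {P Q : DirichletPolynomial} {w : ℝ} {C : ℝ≥0∞}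
    {δ : UnitAddCircle → Torus} (hδ : Measurable δ)
    (h : ∀ θ, ‖bohrLift Q θ‖ₑ ^ w
      ≤ C * ∫⁻ x, ‖bohrLift P (θ + δ x)‖ₑ ^ w ∂AddCircle.haarAddCircle) :
    hardyInt w Q ≤ C * hardyInt w P := by
  have hm := measurable_enorm_bohrLift_rpow P w
  unfold hardyInt
  rw [← lintegral_torus_average hδ hm, ← lintegral_const_mul]
  · exact lintegral_mono h
  · exact Measurable.lintegral_prod_right
      (hm.comp (measurable_fst.add (hδ.comp measurable_snd)))

/-- Restriction to the indices of given weighted degree. -/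
theorem hardyInt_filter_wdeg_le (P : DirichletPolynomial) (k : Nat.Primes → ℕ) (m : ℕ) {w : ℝ}
    (hw : 0 < w) :
    hardyInt w (P.filter fun n => wdeg k n = m) ≤ (m + 1 : ℕ) * hardyInt w P := by
  -- Rotating the coordinate at `p` by `k p • x` multiplies the monomial of `n` by the power `wdeg k
  -- n` of the circle variable, so weighted degree becomes an ordinary exponent.
  refine hardyInt_le_of_average (δ := fun x p => k p • x)
    (measurable_pi_lambda _ fun p => by fun_prop) fun θ => ?_
  have h := enorm_coeff_rpow_le_lintegral_circle P.support (fun n => P n * bohrMonomial n θ)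
    (wdeg k) m hw
  have e1 : bohrLift (P.filter fun n => wdeg k n = m) θ
      = ∑ n ∈ P.support with wdeg k n = m, P n * bohrMonomial n θ := by
    rw [bohrLift_eq_sum, Finsupp.support_filter]
    refine Finset.sum_congr rfl fun n hn => ?_
    rw [Finsupp.filter_apply, if_pos (Finset.mem_filter.1 hn).2]
  rw [e1]
  refine h.trans_eq ?_
  congr 1
  refine lintegral_congr fun x => ?_
  rw [bohrLift_eq_sum]
  congr 2
  refine Finset.sum_congr rfl fun n _ => ?_
  rw [bohrMonomial_add, ← mul_assoc]
  congr 1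
  rw [bohrMonomial_eq_mon, ← mon_pow_wdeg]
  congr 1
  ext p
  simp [torusCoord, AddCircle.toCircle_nsmul]

/-! ### Dilations of the coordinates -/

/-- The polynomial with coefficients `aₙ r(n)`, for the completely multiplicative function `r`. -/
def dilate (r : Nat.Primes → ℂ) (P : DirichletPolynomial) : DirichletPolynomial :=
  Finsupp.onFinset P.support (fun n => P n * mon r n) fun n hn => by
    rw [Finsupp.mem_support_iff]
    exact left_ne_zero_of_mul hn

@[simp] theorem dilate_apply (r : Nat.Primes → ℂ) (P : DirichletPolynomial) (n : ℕ+) :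
    dilate r P n = P n * mon r n := rfl

theorem bohrLift_dilate (r : Nat.Primes → ℂ) (P : DirichletPolynomial) (θ : Torus) :
    bohrLift (dilate r P) θ = ∑ n ∈ P.support, P n * mon r n * bohrMonomial n θ := by
  unfold bohrLift dilate
  exact Finsupp.onFinset_sum _ (by simp)

theorem translate_eq_dilate (P : DirichletPolynomial) (σ : ℝ) :
    P.translate σ = dilate (fun p => ((p : ℕ) : ℂ) ^ (-(σ : ℂ))) P := by
  ext n
  rw [dilate_apply, mon_cpow]
  rfl

theorem dilate_dilate (r s : Nat.Primes → ℂ) (P : DirichletPolynomial) :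
    dilate r (dilate s P) = dilate (fun p => r p * s p) P := by
  ext n
  simp only [dilate_apply, mon_mul_left]
  ring

/-- The automorphism `z ↦ (z + r) / (1 + r z)` of the disc preserves the unit circle. -/
theorem norm_mobius_eq_one {r : ℝ} (h0 : 0 ≤ r) (h1 : r < 1) {z : ℂ} (hz : ‖z‖ = 1) :
    ‖(z + r) / (1 + r * z)‖ = 1 := by
  have hz' : z * (starRingEnd ℂ) z = 1 := by
    rw [Complex.mul_conj, Complex.normSq_eq_norm_sq, hz]; simp
  have e : z + r = z * (starRingEnd ℂ) (1 + r * z) := by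
    simp only [map_add, map_one, map_mul, Complex.conj_ofReal]
    linear_combination (-(r : ℂ)) * hz'
  have hne : (1 + r * z : ℂ) ≠ 0 := by
    intro h
    have : ‖(r * z : ℂ)‖ = 1 := by
      rw [eq_neg_of_add_eq_zero_right h]; simp
    rw [norm_mul, hz, Complex.norm_of_nonneg h0] at this
    linarith
  rw [norm_div, e, norm_mul, hz, one_mul, Complex.norm_conj, div_self (norm_ne_zero_iff.2 hne)]

theorem one_add_mul_ne_zero {r : ℝ} (h0 : 0 ≤ r) (h1 : r < 1) {z : ℂ} (hz : ‖z‖ ≤ 1) :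
    (1 + r * z : ℂ) ≠ 0 := by
  intro h
  have : ‖(r * z : ℂ)‖ = 1 := by
    rw [eq_neg_of_add_eq_zero_right h]; simp
  rw [norm_mul, Complex.norm_of_nonneg h0] at this
  nlinarith [norm_nonneg z]

/-- Dilations with factors in `[0, 1)` are contractions. -/
theorem hardyInt_dilate_le (P : DirichletPolynomial) {r : Nat.Primes → ℝ} (h0 : ∀ p, 0 ≤ r p)
    (h1 : ∀ p, r p < 1) {w : ℝ} (hw : 0 < w) :
    hardyInt w (dilate (fun p => (r p : ℂ)) P) ≤ hardyInt w P := by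
  -- Each `c p` preserves the unit circle and sends `0` to `r p`. Hence multiplying all coordinates
  -- by `c p z` is a translation of the torus when `|z| = 1` and the dilation when `z = 0`;
  -- subharmonicity in the single variable `z` compares the two.
  set c : Nat.Primes → ℂ → ℂ := fun p z => (z + r p) / (1 + r p * z) with hc
  have hcn : ∀ (p : Nat.Primes) (x : UnitAddCircle), ‖c p (AddCircle.toCircle x : ℂ)‖ = 1 :=
    fun p x => norm_mobius_eq_one (h0 p) (h1 p) (Circle.norm_coe _)
  have hcc : ∀ p, Continuous fun x : UnitAddCircle => c p (AddCircle.toCircle x : ℂ) := fun p =>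
    Continuous.div (by fun_prop) (by fun_prop) fun x =>
      one_add_mul_ne_zero (h0 p) (h1 p) (Circle.norm_coe _).le
  set δ : UnitAddCircle → Torus := fun x p => (AddCircle.homeomorphCircle one_ne_zero).symm
    ⟨c p (AddCircle.toCircle x : ℂ), mem_sphere_zero_iff_norm.2 (hcn p x)⟩ with hδdef
  have hδ : Measurable δ := measurable_pi_lambda _ fun p => by
    refine Continuous.measurable ?_
    exact (AddCircle.homeomorphCircle one_ne_zero).symm.continuous.comp
      (Continuous.subtype_mk (hcc p) _)
  have hδc : ∀ x p, torusCoord (δ x) p = c p (AddCircle.toCircle x : ℂ) := by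
    intro x p
    rw [torusCoord, hδdef]
    simp only
    rw [← AddCircle.homeomorphCircle_apply one_ne_zero]
    exact congrArg Subtype.val ((AddCircle.homeomorphCircle one_ne_zero).apply_symm_apply _)
  rw [← one_mul (hardyInt w P)]
  refine hardyInt_le_of_average hδ fun θ => ?_
  set g : ℂ → ℂ := fun z => ∑ n ∈ P.support, P n * bohrMonomial n θ * mon (fun p => c p z) n
  have hg : AnalyticOnNhd ℂ g (Metric.closedBall 0 1) := by
    intro z hz
    apply Finset.analyticAt_fun_sum
    intro n _
    refine analyticAt_const.mul ?_
    apply Finset.analyticAt_fun_prod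
    intro p _
    refine AnalyticAt.pow (AnalyticAt.div (by fun_prop) (by fun_prop) ?_) _
    exact one_add_mul_ne_zero (h0 p) (h1 p) (by simpa using hz)
  have h := enorm_rpow_le_lintegral_circle hw hg
  have e0 : g 0 = bohrLift (dilate (fun p => (r p : ℂ)) P) θ := by
    rw [bohrLift_dilate]
    refine Finset.sum_congr rfl fun n _ => ?_
    simp only [hc, zero_add, mul_zero, add_zero, div_one]
    ring
  rw [one_mul, ← e0]
  refine h.trans_eq (lintegral_congr fun x => ?_)
  rw [bohrLift_eq_sum]
  congr 2
  refine Finset.sum_congr rfl fun n _ => ?_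
  rw [bohrMonomial_add, mul_assoc, bohrMonomial_eq_mon n (δ x)]
  congr 3
  ext p
  exact (hδc x p).symm

/-! ### Monotonicity of the Hardy norms -/

theorem hardyNorm_le_of_hardyInt_le {w : ℝ} (hw : 0 < w) {P Q : DirichletPolynomial}
    (h : hardyInt w P ≤ hardyInt w Q) : hardyNorm w P ≤ hardyNorm w Q :=
  ENNReal.rpow_le_rpow h (by positivity)

theorem hardyNorm_dilate_le (P : DirichletPolynomial) {r : Nat.Primes → ℝ} (h0 : ∀ p, 0 ≤ r p)
    (h1 : ∀ p, r p < 1) {w : ℝ} (hw : 0 < w) :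
    hardyNorm w (dilate (fun p => (r p : ℂ)) P) ≤ hardyNorm w P :=
  hardyNorm_le_of_hardyInt_le hw (hardyInt_dilate_le P h0 h1 hw)

theorem natCast_cpow_neg_ofReal (n : ℕ) (σ : ℝ) :
    (n : ℂ) ^ (-(σ : ℂ)) = (((n : ℝ) ^ (-σ) : ℝ) : ℂ) := by
  rw [Complex.ofReal_cpow (Nat.cast_nonneg n)]
  push_cast
  rfl

/-- Moving from `σ` to a larger `τ` multiplies the coordinate at `p` by `p ^ (-(τ - σ)) < 1`, a
contraction. -/
theorem hardyNorm_translate_antitone (P : DirichletPolynomial) {w : ℝ} (hw : 0 < w) :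
    Antitone fun σ : ℝ => hardyNorm w (P.translate σ) := by
  intro σ τ h
  rcases h.eq_or_lt with rfl | h
  · exact le_rfl
  have e : P.translate τ
      = dilate (fun p => (((p : ℕ) : ℝ) ^ (-(τ - σ)) : ℝ)) (P.translate σ) := by
    rw [translate_eq_dilate, translate_eq_dilate, dilate_dilate]
    congr 1
    ext p
    have hp : ((p : ℕ) : ℂ) ≠ 0 := by exact_mod_cast p.2.ne_zero
    rw [← natCast_cpow_neg_ofReal, ← Complex.cpow_add _ _ hp]
    congr 1
    push_cast
    ring
  simp only
  rw [e]
  refine hardyNorm_dilate_le _ (fun p => by positivity) (fun p => ?_) hw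
  exact Real.rpow_lt_one_of_one_lt_of_neg (by exact_mod_cast p.2.one_lt) (by linarith)

theorem hardyNorm_mono_exponent {u p : ℝ} (hu : 0 < u) (hup : u ≤ p) (P : DirichletPolynomial) :
    hardyNorm u P ≤ hardyNorm p P := by
  have hp : 0 < p := hu.trans_le hup
  have h := eLpNorm_le_eLpNorm_of_exponent_le (μ := torusMeasure) (p := ENNReal.ofReal u)
    (q := ENNReal.ofReal p) (ENNReal.ofReal_le_ofReal hup)
    (measurable_bohrLift P).aestronglyMeasurable
  rw [eLpNorm_eq_lintegral_rpow_enorm_toReal (by simpa using hu) (by simp),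
    eLpNorm_eq_lintegral_rpow_enorm_toReal (by simpa using hp) (by simp),
    ENNReal.toReal_ofReal hu.le, ENNReal.toReal_ofReal hp.le] at h
  exact h

/-! ### The weights -/

/-- The density of `weightMeasure`. -/
def weightDensity (α σ : ℝ) : ℝ := 2 ^ (α + 1) / Real.Gamma (α + 1) * σ ^ α * Real.exp (-2 * σ)

/-- The normalizing constant of `weightMeasure`. -/
def weightConst (α : ℝ) : ℝ := 2 ^ (α + 1) / Real.Gamma (α + 1)

theorem weightConst_pos {α : ℝ} (hα : -1 < α) : 0 < weightConst α := by
  have := Real.Gamma_pos_of_pos (by linarith : 0 < α + 1)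
  unfold weightConst
  positivity

theorem weightDensity_eq (α σ : ℝ) :
    weightDensity α σ = weightConst α * (σ ^ α * Real.exp (-2 * σ)) := by
  unfold weightDensity weightConst; ring

theorem lintegral_weightMeasure (α : ℝ) (f : ℝ → ℝ≥0∞) :
    ∫⁻ σ, f σ ∂weightMeasure α
      = ∫⁻ σ in Set.Ioi 0, ENNReal.ofReal (weightDensity α σ) * f σ := by
  unfold weightMeasure
  rw [lintegral_withDensity_eq_lintegral_mul_non_measurable]
  · rfl
  · fun_prop
  · exact Filter.Eventually.of_forall fun _ => ENNReal.ofReal_lt_top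

theorem lintegral_weightMeasure_mono {α : ℝ} {f g : ℝ → ℝ≥0∞} (h : ∀ σ, 0 < σ → f σ ≤ g σ) :
    ∫⁻ σ, f σ ∂weightMeasure α ≤ ∫⁻ σ, g σ ∂weightMeasure α := by
  rw [lintegral_weightMeasure, lintegral_weightMeasure]
  exact setLIntegral_mono' measurableSet_Ioi fun σ hσ => by gcongr; exact h σ hσ

theorem lintegral_rpow_mul_exp {a b : ℝ} (ha : 0 < a) (hb : 0 < b) :
    ∫⁻ t in Set.Ioi 0, ENNReal.ofReal (t ^ (a - 1) * Real.exp (-(b * t)))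
      = ENNReal.ofReal ((1 / b) ^ a * Real.Gamma a) := by
  have h := Real.integral_rpow_mul_exp_neg_mul_Ioi ha hb
  have hpos : 0 < (1 / b) ^ a * Real.Gamma a := by
    have := Real.Gamma_pos_of_pos ha
    positivity
  rw [← h, ofReal_integral_eq_lintegral_ofReal]
  · by_contra hc
    rw [integral_undef hc] at h
    exact hpos.ne h
  · filter_upwards [self_mem_ae_restrict measurableSet_Ioi] with t ht
    have : 0 < t := ht
    positivity

theorem lintegral_weightMeasure_rpow_mul_exp {α a b : ℝ} (hα : -1 < α) (ha : 0 < α + a + 1)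
    (hb : 0 ≤ b) :
    ∫⁻ σ, ENNReal.ofReal (σ ^ a * Real.exp (-(b * σ))) ∂weightMeasure α
      = ENNReal.ofReal (weightConst α * ((1 / (b + 2)) ^ (α + a + 1) * Real.Gamma (α + a + 1))) := by
  rw [lintegral_weightMeasure, ENNReal.ofReal_mul (weightConst_pos hα).le,
    ← lintegral_rpow_mul_exp ha (by linarith : 0 < b + 2), ← lintegral_const_mul' _ _ (by simp)]
  refine setLIntegral_congr_fun measurableSet_Ioi fun σ hσ => ?_
  have hσ' : 0 < σ := hσ
  have := weightConst_pos hα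
  rw [weightDensity_eq, ← ENNReal.ofReal_mul (by positivity), ← ENNReal.ofReal_mul this.le]
  congr 1
  have e1 : σ ^ (α + a + 1 - 1) = σ ^ α * σ ^ a := by
    rw [← Real.rpow_add hσ']; congr 1; ring
  have e2 : Real.exp (-((b + 2) * σ)) = Real.exp (-2 * σ) * Real.exp (-(b * σ)) := by
    rw [← Real.exp_add]; congr 1; ring
  rw [e1, e2]
  ring

theorem isFiniteMeasure_weightMeasure {α : ℝ} (hα : -1 < α) :
    IsFiniteMeasure (weightMeasure α) := by
  constructor
  have h := lintegral_weightMeasure_rpow_mul_exp (a := 0) (b := 0) hα (by linarith) le_rfl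
  simp only [Real.rpow_zero, zero_mul, neg_zero, Real.exp_zero, mul_one, ENNReal.ofReal_one,
    lintegral_one] at h
  rw [h]
  exact ENNReal.ofReal_lt_top

/-- Near `0` the density is comparable to `σ ^ α`, so the dyadic interval ending at `τ` carries mass
of order `τ ^ (α + 1)`. Both the growth estimate and the lower bounds for test polynomials use this.
-/
theorem weightMeasure_Ioc_ge {α : ℝ} (hα : -1 < α) :
    ∃ c : ℝ, 0 < c ∧ ∀ τ : ℝ, 0 < τ → τ ≤ 1 →
      ENNReal.ofReal (c * τ ^ (α + 1)) ≤ weightMeasure α (Set.Ioc (τ / 2) τ) := by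
  have hc := weightConst_pos hα
  refine ⟨weightConst α * (1 / 2) ^ (α + 1) * Real.exp (-2) / 2, by positivity, fun τ hτ hτ1 => ?_⟩
  rw [← lintegral_indicator_one measurableSet_Ioc, lintegral_weightMeasure]
  have hsub : Set.Ioc (τ / 2) τ ⊆ Set.Ioi 0 := fun x hx => lt_trans (by positivity) hx.1
  calc _ = ∫⁻ σ in Set.Ioc (τ / 2) τ,
        ENNReal.ofReal (weightConst α * (1 / 2) ^ (α + 1) * Real.exp (-2) * τ ^ α) := by
        rw [setLIntegral_const, Real.volume_Ioc, ← ENNReal.ofReal_mul (by positivity)]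
        congr 1
        rw [Real.rpow_add_one hτ.ne']
        ring
    _ ≤ ∫⁻ σ in Set.Ioc (τ / 2) τ, ENNReal.ofReal (weightDensity α σ)
        * (Set.Ioc (τ / 2) τ).indicator 1 σ := by
        refine setLIntegral_mono' measurableSet_Ioc fun σ hσ => ?_
        have hσ0 : 0 < σ := hsub hσ
        rw [Set.indicator_of_mem hσ, Pi.one_apply, mul_one, weightDensity_eq]
        apply ENNReal.ofReal_le_ofReal
        have e1 : Real.exp (-2) ≤ Real.exp (-2 * σ) := Real.exp_le_exp.2 (by linarith [hσ.2])
        -- Writing `σ ^ α` as `σ ^ (α + 1) / σ` avoids a distinction by the sign of `α`.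
        have e2 : (1 / 2) ^ (α + 1) * τ ^ α ≤ σ ^ α := by
          have h3 : (τ / 2) ^ (α + 1) ≤ σ ^ (α + 1) :=
            Real.rpow_le_rpow (by positivity) hσ.1.le (by linarith)
          have h4 : (1 / 2) ^ (α + 1) * τ ^ α = (τ / 2) ^ (α + 1) / τ := by
            rw [div_eq_mul_one_div τ 2, Real.mul_rpow hτ.le (by norm_num),
              Real.rpow_add_one hτ.ne' α]
            field_simp
          rw [h4, div_le_iff₀ hτ]
          calc (τ / 2) ^ (α + 1) ≤ σ ^ (α + 1) := h3
            _ = σ ^ α * σ := Real.rpow_add_one hσ0.ne' α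
            _ ≤ σ ^ α * τ := by gcongr; exact hσ.2
        calc weightConst α * (1 / 2) ^ (α + 1) * Real.exp (-2) * τ ^ α
            = weightConst α * (((1 / 2) ^ (α + 1) * τ ^ α) * Real.exp (-2)) := by ring
          _ ≤ _ := by gcongr
    _ ≤ _ := lintegral_mono_set hsub

/-! ### The embedding -/

/-- An antitone function is at least `h τ` on `(τ/2, τ]`, whose mass is bounded below. -/
theorem rpow_le_of_antitoneOn {α q : ℝ} (hα : -1 < α) (hq : 0 < q) :
    ∃ c : ℝ, 0 < c ∧ ∀ h : ℝ → ℝ≥0∞, Antitone h → ∀ τ, 0 < τ → τ ≤ 1 →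
      h τ ^ q ≤ (∫⁻ σ, h σ ^ q ∂weightMeasure α) * ENNReal.ofReal (c * τ ^ (-(α + 1))) := by
  obtain ⟨c, hc, hμ⟩ := weightMeasure_Ioc_ge hα
  refine ⟨c⁻¹, by positivity, fun h hh τ hτ hτ1 => ?_⟩
  have e : ENNReal.ofReal (c⁻¹ * τ ^ (-(α + 1))) = (ENNReal.ofReal (c * τ ^ (α + 1)))⁻¹ := by
    rw [← ENNReal.ofReal_inv_of_pos (by positivity), mul_inv, Real.rpow_neg hτ.le]
  rw [e, ← div_eq_mul_inv, ENNReal.le_div_iff_mul_le (Or.inl (by simp; positivity))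
    (Or.inl ENNReal.ofReal_ne_top)]
  calc h τ ^ q * ENNReal.ofReal (c * τ ^ (α + 1))
      ≤ h τ ^ q * weightMeasure α (Set.Ioc (τ / 2) τ) := by gcongr; exact hμ τ hτ hτ1
    _ = ∫⁻ σ in Set.Ioc (τ / 2) τ, h τ ^ q ∂weightMeasure α := by rw [setLIntegral_const]
    _ ≤ ∫⁻ σ in Set.Ioc (τ / 2) τ, h σ ^ q ∂weightMeasure α :=
        setLIntegral_mono' measurableSet_Ioc fun σ hσ =>
          ENNReal.rpow_le_rpow (hh hσ.2) hq.le
    _ ≤ _ := setLIntegral_le_lintegral _ _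

/-- The analytic core of sufficiency, freed from Dirichlet polynomials. On `(0, 1]` the growth bound
controls `h`; beyond `1` the value `h 1` does, since the weight is finite. -/
theorem lintegral_rpow_le_of_antitone {α β q v : ℝ} (hα : -1 < α) (hβ : -1 < β) (hq : 0 < q)
    (hv : 0 < v) (hcond : (α + 1) / q < (β + 1) / v ∨ (α + 1) / q = (β + 1) / v ∧ q ≤ v) :
    ∃ C : ℝ≥0∞, C ≠ ∞ ∧ ∀ h : ℝ → ℝ≥0∞, Antitone h → ∫⁻ σ, h σ ^ q ∂weightMeasure α ≠ ∞ →
      ∫⁻ σ, h σ ^ v ∂weightMeasure β ≤ C * (∫⁻ σ, h σ ^ q ∂weightMeasure α) ^ (v / q) := by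
  obtain ⟨c, hc, hbd⟩ := rpow_le_of_antitoneOn hα hq
  have hbd' : ∀ x : ℝ, 0 ≤ x → ∀ h : ℝ → ℝ≥0∞, Antitone h → ∀ τ, 0 < τ → τ ≤ 1 →
      h τ ^ x ≤ (∫⁻ σ, h σ ^ q ∂weightMeasure α) ^ (x / q)
        * (ENNReal.ofReal (c ^ (x / q)) * ENNReal.ofReal (τ ^ (-((α + 1) / q * x)))) := by
    intro x hx h hh τ hτ hτ1
    have h1 := ENNReal.rpow_le_rpow (hbd h hh τ hτ hτ1) (div_nonneg hx hq.le)
    rw [← ENNReal.rpow_mul, mul_div_cancel₀ _ hq.ne', ENNReal.mul_rpow_of_nonneg _ _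
      (div_nonneg hx hq.le), ENNReal.ofReal_rpow_of_nonneg (by positivity) (div_nonneg hx hq.le),
      Real.mul_rpow hc.le (by positivity), ← Real.rpow_mul hτ.le,
      ENNReal.ofReal_mul (by positivity)] at h1
    convert h1 using 5
    ring
  have hfin := isFiniteMeasure_weightMeasure hβ
  have h1bd : ∀ h : ℝ → ℝ≥0∞, Antitone h → h 1 ^ v
      ≤ (∫⁻ σ, h σ ^ q ∂weightMeasure α) ^ (v / q) * ENNReal.ofReal (c ^ (v / q)) := by
    intro h hh
    simpa using hbd' v hv.le h hh 1 one_pos le_rfl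
  set M := weightMeasure β Set.univ with hM
  have hMfin : M ≠ ∞ := measure_ne_top _ _
  rcases hcond with hlt | ⟨heq, hqv⟩
  -- The strict inequality is exactly the integrability at `0` of the growth bound raised to the
  -- power `v`.
  · have ha : 0 < β + (-((α + 1) / q * v)) + 1 := by
      rw [lt_div_iff₀ hv] at hlt; linarith
    have hi := lintegral_weightMeasure_rpow_mul_exp (b := 0) hβ ha le_rfl
    simp only [zero_mul, neg_zero, Real.exp_zero, mul_one] at hi
    set K := ∫⁻ σ, ENNReal.ofReal (σ ^ (-((α + 1) / q * v))) ∂weightMeasure β with hK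
    have hKfin : K ≠ ∞ := by rw [hi]; exact ENNReal.ofReal_ne_top
    refine ⟨ENNReal.ofReal (c ^ (v / q)) * (K + M), by finiteness, fun h hh hI => ?_⟩
    set I := ∫⁻ σ, h σ ^ q ∂weightMeasure α
    have hIf : I ^ (v / q) ≠ ∞ := ENNReal.rpow_ne_top_of_nonneg (by positivity) hI
    calc ∫⁻ σ, h σ ^ v ∂weightMeasure β
        ≤ ∫⁻ σ, (I ^ (v / q) * ENNReal.ofReal (c ^ (v / q))
            * ENNReal.ofReal (σ ^ (-((α + 1) / q * v)))
            + I ^ (v / q) * ENNReal.ofReal (c ^ (v / q))) ∂weightMeasure β := by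
          refine lintegral_weightMeasure_mono fun σ hσ => ?_
          rcases le_or_gt σ 1 with h1 | h1
          · refine le_add_right ?_
            rw [mul_assoc]
            exact hbd' v hv.le h hh σ hσ h1
          · refine le_add_left ((ENNReal.rpow_le_rpow (hh h1.le) hv.le).trans (h1bd h hh))
      _ = ENNReal.ofReal (c ^ (v / q)) * (K + M) * I ^ (v / q) := by
          rw [lintegral_add_right _ measurable_const, lintegral_const,
            lintegral_const_mul' _ _ (by finiteness)]
          ring
  · have hcβ := weightConst_pos hβ
    have hcα := weightConst_pos hα
    refine ⟨ENNReal.ofReal (c ^ ((v - q) / q)) * ENNReal.ofReal (weightConst β / weightConst α)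
      + ENNReal.ofReal (c ^ (v / q)) * M, by finiteness, fun h hh hI => ?_⟩
    set I := ∫⁻ σ, h σ ^ q ∂weightMeasure α with hIdef
    have hIf : I ^ ((v - q) / q) ≠ ∞ :=
      ENNReal.rpow_ne_top_of_nonneg (div_nonneg (by linarith) hq.le) hI
    -- With equality of the indices, the power of `σ` coming from the growth bound for `h ^ (v - q)`
    -- converts `σ ^ β` into `σ ^ α` exactly.
    have hconv : ∫⁻ σ, ENNReal.ofReal (σ ^ (-((α + 1) / q * (v - q)))) * h σ ^ q ∂weightMeasure β
        = ENNReal.ofReal (weightConst β / weightConst α) * I := by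
      rw [hIdef, lintegral_weightMeasure, lintegral_weightMeasure,
        ← lintegral_const_mul' _ _ (by simp)]
      refine setLIntegral_congr_fun measurableSet_Ioi fun σ hσ => ?_
      have hσ' : 0 < σ := hσ
      rw [← mul_assoc, ← mul_assoc, weightDensity_eq, weightDensity_eq,
        ← ENNReal.ofReal_mul (by positivity), ← ENNReal.ofReal_mul (by positivity)]
      congr 2
      have e : σ ^ α = σ ^ β * σ ^ (-((α + 1) / q * (v - q))) := by
        rw [← Real.rpow_add hσ']
        congr 1
        have : (α + 1) / q * v = β + 1 := by rw [heq]; field_simp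
        have h2 : (α + 1) / q * q = α + 1 := by field_simp
        linear_combination this - h2
      rw [e]
      field_simp
    have hsplit : I ^ (v / q) = I ^ ((v - q) / q) * I := by
      rw [show v / q = (v - q) / q + 1 by field_simp; ring,
        ENNReal.rpow_add_of_nonneg _ _ (div_nonneg (by linarith) hq.le) zero_le_one,
        ENNReal.rpow_one]
    calc ∫⁻ σ, h σ ^ v ∂weightMeasure β
        ≤ ∫⁻ σ, (I ^ ((v - q) / q) * ENNReal.ofReal (c ^ ((v - q) / q))
            * (ENNReal.ofReal (σ ^ (-((α + 1) / q * (v - q)))) * h σ ^ q)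
            + I ^ (v / q) * ENNReal.ofReal (c ^ (v / q))) ∂weightMeasure β := by
          refine lintegral_weightMeasure_mono fun σ hσ => ?_
          rcases le_or_gt σ 1 with h1 | h1
          · refine le_add_right ?_
            calc h σ ^ v = h σ ^ (v - q) * h σ ^ q := by
                  rw [← ENNReal.rpow_add_of_nonneg _ _ (by linarith) hq.le]; congr 1; ring
              _ ≤ _ := by
                  refine (mul_le_mul_left (hbd' (v - q) (by linarith) h hh σ hσ h1) _).trans_eq ?_
                  ring
          · refine le_add_left ((ENNReal.rpow_le_rpow (hh h1.le) hv.le).trans (h1bd h hh))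
      _ = _ := by
          rw [lintegral_add_right _ measurable_const, lintegral_const,
            lintegral_const_mul' _ _ (by finiteness), hconv, ← hM, hsplit]
          ring

/-! ### Elementary properties of the quasi-norms -/

theorem ENNReal_add_rpow_le (x y : ℝ≥0∞) {r : ℝ} (hr : 0 ≤ r) :
    (x + y) ^ r ≤ 2 ^ r * (x ^ r + y ^ r) := by
  have h : ∀ a b : ℝ≥0∞, a ≤ b → (a + b) ^ r ≤ 2 ^ r * (a ^ r + b ^ r) := by
    intro a b hab
    calc (a + b) ^ r ≤ (2 * b) ^ r := by rw [two_mul]; gcongr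
      _ = 2 ^ r * b ^ r := ENNReal.mul_rpow_of_nonneg _ _ hr
      _ ≤ _ := by gcongr; exact le_add_self
  rcases le_total x y with hxy | hxy
  · exact h x y hxy
  · rw [add_comm x, add_comm (x ^ r)]; exact h y x hxy

theorem lintegral_add_rpow_le {Ω : Type*} [MeasurableSpace Ω] (μ : Measure Ω) {r : ℝ} (hr : 0 < r)
    {f g : Ω → ℝ≥0∞} (hf : Measurable f) :
    (∫⁻ x, (f x + g x) ^ r ∂μ) ^ (1 / r)
      ≤ 2 * 2 ^ (1 / r) * ((∫⁻ x, f x ^ r ∂μ) ^ (1 / r) + (∫⁻ x, g x ^ r ∂μ) ^ (1 / r)) := by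
  have hr' : 0 ≤ 1 / r := by positivity
  calc (∫⁻ x, (f x + g x) ^ r ∂μ) ^ (1 / r)
      ≤ (∫⁻ x, 2 ^ r * (f x ^ r + g x ^ r) ∂μ) ^ (1 / r) := by
        gcongr; exact ENNReal_add_rpow_le _ _ hr.le
    _ = 2 * (∫⁻ x, f x ^ r ∂μ + ∫⁻ x, g x ^ r ∂μ) ^ (1 / r) := by
        rw [lintegral_const_mul' _ _ (by finiteness), lintegral_add_left (hf.pow_const r),
          ENNReal.mul_rpow_of_nonneg _ _ hr', ← ENNReal.rpow_mul, mul_one_div_cancel hr.ne',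
          ENNReal.rpow_one]
    _ ≤ _ := by
        rw [mul_assoc]
        gcongr
        exact ENNReal_add_rpow_le _ _ hr'

theorem translate_apply (P : DirichletPolynomial) (σ : ℝ) (n : ℕ+) :
    P.translate σ n = P n * ((n : ℕ) : ℂ) ^ (-(σ : ℂ)) := rfl

theorem translate_add (P Q : DirichletPolynomial) (σ : ℝ) :
    (P + Q : DirichletPolynomial).translate σ = P.translate σ + Q.translate σ := by
  ext n
  simp only [translate_apply, Finsupp.add_apply, add_mul]

theorem translate_smul (c : ℂ) (P : DirichletPolynomial) (σ : ℝ) :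
    (c • P : DirichletPolynomial).translate σ = c • P.translate σ := by
  ext n
  simp only [translate_apply, Finsupp.smul_apply, smul_eq_mul, mul_assoc]

theorem translate_filter (P : DirichletPolynomial) (S : ℕ+ → Prop) [DecidablePred S] (σ : ℝ) :
    DirichletPolynomial.translate (P.filter S) σ = (P.translate σ).filter S := by
  ext n
  simp only [translate_apply, Finsupp.filter_apply]
  split_ifs <;> simp

theorem hardyNorm_add_le {w : ℝ} (hw : 0 < w) (P Q : DirichletPolynomial) :
    hardyNorm w (P + Q) ≤ 2 * 2 ^ (1 / w) * (hardyNorm w P + hardyNorm w Q) := by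
  refine le_trans ?_ (lintegral_add_rpow_le torusMeasure hw (measurable_bohrLift P).enorm)
  unfold hardyNorm
  gcongr with θ
  rw [bohrLift_add]
  exact enorm_add_le _ _

theorem hardyNorm_smul {w : ℝ} (hw : 0 < w) (c : ℂ) (P : DirichletPolynomial) :
    hardyNorm w (c • P) = ‖c‖ₑ * hardyNorm w P := by
  unfold hardyNorm
  simp_rw [bohrLift_smul, enorm_mul, ENNReal.mul_rpow_of_nonneg _ _ hw.le]
  rw [lintegral_const_mul' _ _ (by finiteness), ENNReal.mul_rpow_of_nonneg _ _ (by positivity),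
    ← ENNReal.rpow_mul, mul_one_div_cancel hw.ne', ENNReal.rpow_one]

theorem measurable_hardyNorm_translate {w : ℝ} (hw : 0 < w) (P : DirichletPolynomial) :
    Measurable fun σ : ℝ => hardyNorm w (P.translate σ) :=
  (hardyNorm_translate_antitone P hw).measurable

theorem mixedNorm_mono_of_hardyNorm_le {u v β : ℝ} {P : DirichletPolynomial} (hv : 0 < v)
    {F : ℝ → ℝ≥0∞} (h : ∀ σ, 0 < σ → hardyNorm u (P.translate σ) ≤ F σ) :
    mixedNorm u v β P ≤ (∫⁻ σ, F σ ^ v ∂weightMeasure β) ^ (1 / v) := by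
  unfold mixedNorm
  gcongr ?_ ^ _
  exact lintegral_weightMeasure_mono fun σ hσ => ENNReal.rpow_le_rpow (h σ hσ) hv.le

theorem lintegral_const_mul_rpow {Ω : Type*} [MeasurableSpace Ω] (μ : Measure Ω) {r : ℝ}
    (hr : 0 < r) {C : ℝ≥0∞} (hC : C ≠ ∞) (f : Ω → ℝ≥0∞) :
    (∫⁻ x, (C * f x) ^ r ∂μ) ^ (1 / r) = C * (∫⁻ x, f x ^ r ∂μ) ^ (1 / r) := by
  simp_rw [ENNReal.mul_rpow_of_nonneg _ _ hr.le]
  rw [lintegral_const_mul' _ _ (by finiteness), ENNReal.mul_rpow_of_nonneg _ _ (by positivity),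
    ← ENNReal.rpow_mul, mul_one_div_cancel hr.ne', ENNReal.rpow_one]

/-- A quasi-triangle inequality covering all exponents; the constant combines the losses of the
inner and outer integrals. Only `K ≥ 1` and finiteness matter later. -/
theorem mixedNorm_add_le {u v : ℝ} (hu : 0 < u) (hv : 0 < v) :
    ∃ K : ℝ, 1 ≤ K ∧ ∀ β (P Q : DirichletPolynomial),
      mixedNorm u v β (P + Q) ≤ ENNReal.ofReal K * (mixedNorm u v β P + mixedNorm u v β Q) := by
  refine ⟨2 * 2 ^ (1 / u) * (2 * 2 ^ (1 / v)), ?_, fun β P Q => ?_⟩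
  · have h1 : (1 : ℝ) ≤ 2 ^ (1 / u) := Real.one_le_rpow one_le_two (by positivity)
    have h2 : (1 : ℝ) ≤ 2 ^ (1 / v) := Real.one_le_rpow one_le_two (by positivity)
    nlinarith
  have e : ENNReal.ofReal (2 * 2 ^ (1 / u) * (2 * 2 ^ (1 / v)))
      = 2 * 2 ^ (1 / u) * (2 * 2 ^ (1 / v)) := by
    rw [ENNReal.ofReal_mul (by positivity), ENNReal.ofReal_mul (by positivity),
      ENNReal.ofReal_mul (by positivity), ← ENNReal.ofReal_rpow_of_pos two_pos,
      ← ENNReal.ofReal_rpow_of_pos two_pos, ENNReal.ofReal_ofNat]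
  rw [e]
  calc mixedNorm u v β (P + Q)
      ≤ (∫⁻ σ, (2 * 2 ^ (1 / u) * (hardyNorm u (P.translate σ) + hardyNorm u (Q.translate σ))) ^ v
          ∂weightMeasure β) ^ (1 / v) := by
        refine mixedNorm_mono_of_hardyNorm_le hv fun σ _ => ?_
        rw [translate_add]
        exact hardyNorm_add_le hu _ _
    _ = 2 * 2 ^ (1 / u) * (∫⁻ σ, (hardyNorm u (P.translate σ) + hardyNorm u (Q.translate σ)) ^ v
          ∂weightMeasure β) ^ (1 / v) := lintegral_const_mul_rpow _ hv (by finiteness) _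
    _ ≤ _ := by
        rw [mul_assoc (2 * 2 ^ (1 / u))]
        gcongr
        exact lintegral_add_rpow_le _ hv (measurable_hardyNorm_translate hu P)

theorem mixedNorm_smul {u v : ℝ} (hu : 0 < u) (hv : 0 < v) (β : ℝ) (c : ℂ)
    (P : DirichletPolynomial) : mixedNorm u v β (c • P) = ‖c‖ₑ * mixedNorm u v β P := by
  unfold mixedNorm
  simp_rw [translate_smul, hardyNorm_smul hu]
  exact lintegral_const_mul_rpow _ hv (by finiteness) _

theorem mixedNorm_neg {u v : ℝ} (hu : 0 < u) (hv : 0 < v) (β : ℝ) (P : DirichletPolynomial) :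
    mixedNorm u v β (-P) = mixedNorm u v β P := by
  rw [← neg_one_smul ℂ P, mixedNorm_smul hu hv]
  simp

theorem mixedNorm_zero {u v : ℝ} (hu : 0 < u) (hv : 0 < v) (β : ℝ) :
    mixedNorm u v β 0 = 0 := by
  rw [← zero_smul ℂ (0 : DirichletPolynomial), mixedNorm_smul hu hv]
  simp

theorem enorm_bohrLift_le (P : DirichletPolynomial) {T : Finset ℕ+} (hT : P.support ⊆ T)
    (θ : Torus) : ‖bohrLift P θ‖ₑ ≤ ∑ n ∈ T, ‖P n‖ₑ := by
  rw [bohrLift_eq_sum]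
  refine (enorm_sum_le _ _).trans ?_
  refine (Finset.sum_le_sum_of_subset hT).trans (Finset.sum_le_sum fun n _ => ?_)
  rw [enorm_mul, ← ofReal_norm (bohrMonomial n θ), norm_bohrMonomial]
  simp

theorem hardyNorm_le_of_enorm_le {w : ℝ} (hw : 0 < w) {P : DirichletPolynomial} {C : ℝ≥0∞}
    (h : ∀ θ, ‖bohrLift P θ‖ₑ ≤ C) : hardyNorm w P ≤ C := by
  calc hardyNorm w P ≤ (∫⁻ _, C ^ w ∂torusMeasure) ^ (1 / w) := by
        unfold hardyNorm
        gcongr with θ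
        exact h θ
    _ = C := by
        rw [lintegral_const, measure_univ, mul_one, ← ENNReal.rpow_mul, mul_one_div_cancel hw.ne',
          ENNReal.rpow_one]

theorem norm_natCast_cpow_le_one (n : ℕ+) {s : ℂ} (hs : s.re ≤ 0) : ‖((n : ℕ) : ℂ) ^ s‖ ≤ 1 := by
  rw [norm_natCast_cpow_of_pos n.pos]
  exact Real.rpow_le_one_of_one_le_of_nonpos (by exact_mod_cast n.pos) hs

theorem enorm_translate_le (P : DirichletPolynomial) {σ : ℝ} (hσ : 0 ≤ σ) (n : ℕ+) :
    ‖P.translate σ n‖ₑ ≤ ‖P n‖ₑ := by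
  rw [enorm_le_iff_norm_le, translate_apply, norm_mul]
  exact mul_le_of_le_one_right (norm_nonneg _) (norm_natCast_cpow_le_one n (by simpa using hσ))

theorem support_translate_subset (P : DirichletPolynomial) (σ : ℝ) :
    (P.translate σ).support ⊆ P.support :=
  Finsupp.support_onFinset_subset

/-- A crude bound by absolute coefficients. It shows finiteness of the norm, and that
coefficientwise convergence on a fixed finite set of indices implies norm convergence. -/
theorem mixedNorm_le_coeff {u v β : ℝ} (hu : 0 < u) (hv : 0 < v) (P : DirichletPolynomial)
    {T : Finset ℕ+} (hT : P.support ⊆ T) :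
    mixedNorm u v β P ≤ (∑ n ∈ T, ‖P n‖ₑ) * weightMeasure β Set.univ ^ (1 / v) := by
  have h : ∀ σ, 0 < σ → hardyNorm u (P.translate σ) ≤ ∑ n ∈ T, ‖P n‖ₑ := fun σ hσ =>
    hardyNorm_le_of_enorm_le hu fun θ =>
      (enorm_bohrLift_le _ ((support_translate_subset P σ).trans hT) θ).trans
        (Finset.sum_le_sum fun n _ => enorm_translate_le P hσ.le n)
  refine (mixedNorm_mono_of_hardyNorm_le hv h).trans_eq ?_
  rw [lintegral_const, ENNReal.mul_rpow_of_nonneg _ _ (by positivity), ← ENNReal.rpow_mul,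
    mul_one_div_cancel hv.ne', ENNReal.rpow_one]

theorem mixedNorm_ne_top {u v β : ℝ} (hu : 0 < u) (hv : 0 < v) (hβ : -1 < β)
    (P : DirichletPolynomial) : mixedNorm u v β P ≠ ∞ := by
  have := isFiniteMeasure_weightMeasure hβ
  refine ne_top_of_le_ne_top ?_ (mixedNorm_le_coeff hu hv P subset_rfl)
  exact ENNReal.mul_ne_top (ENNReal.sum_ne_top.2 fun _ _ => by finiteness)
    (ENNReal.rpow_ne_top_of_nonneg (by positivity) (measure_ne_top _ _))

/-! ### Sufficiency -/

theorem mixedNorm_rpow {u v β : ℝ} (hv : 0 < v) (P : DirichletPolynomial) :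
    mixedNorm u v β P ^ v = ∫⁻ σ, hardyNorm u (P.translate σ) ^ v ∂weightMeasure β := by
  rw [mixedNorm, ← ENNReal.rpow_mul, one_div_mul_cancel hv.ne', ENNReal.rpow_one]

theorem mixedNorm_le_mixedNorm {p q u v α β : ℝ} (hq : 0 < q) (hu : 0 < u) (hv : 0 < v)
    (hα : -1 < α) (hβ : -1 < β) (hup : u ≤ p)
    (hcond : (α + 1) / q < (β + 1) / v ∨ (α + 1) / q = (β + 1) / v ∧ q ≤ v) :
    ∃ C : ℝ≥0∞, C ≠ ∞ ∧ ∀ P, mixedNorm u v β P ≤ C * mixedNorm p q α P := by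
  have hp : 0 < p := hu.trans_le hup
  obtain ⟨C, hC, h⟩ := lintegral_rpow_le_of_antitone hα hβ hq hv hcond
  refine ⟨C ^ (1 / v), ENNReal.rpow_ne_top_of_nonneg (by positivity) hC, fun P => ?_⟩
  have hI : ∫⁻ σ, hardyNorm p (P.translate σ) ^ q ∂weightMeasure α ≠ ∞ := by
    rw [← mixedNorm_rpow hq]
    exact ENNReal.rpow_ne_top_of_nonneg hq.le (mixedNorm_ne_top hp hq hα P)
  have h2 := h _ (hardyNorm_translate_antitone P hp) hI
  calc mixedNorm u v β P
      ≤ (∫⁻ σ, hardyNorm p (P.translate σ) ^ v ∂weightMeasure β) ^ (1 / v) :=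
        mixedNorm_mono_of_hardyNorm_le hv fun σ _ => hardyNorm_mono_exponent hu hup _
    _ ≤ (C * (∫⁻ σ, hardyNorm p (P.translate σ) ^ q ∂weightMeasure α) ^ (v / q)) ^ (1 / v) := by
        gcongr
    _ = _ := by
        rw [ENNReal.mul_rpow_of_nonneg _ _ (by positivity), ← ENNReal.rpow_mul, mixedNorm]
        congr 2
        field_simp

theorem mixedSpace_subset_of_mixedNorm_le {p q u v α β : ℝ} {C : ℝ≥0∞} (hC : C ≠ ∞)
    (h : ∀ P, mixedNorm u v β P ≤ C * mixedNorm p q α P) :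
    mixedSpace p q α ⊆ mixedSpace u v β := by
  rintro f ⟨P, hP, hf⟩
  refine ⟨P, fun ε hε => ?_, hf⟩
  -- The added `1` keeps the divisor nonzero when `C = 0`.
  have hδ : 0 < ε / (C + 1) := ENNReal.div_pos hε.ne' (by finiteness)
  obtain ⟨N, hN⟩ := hP _ hδ
  refine ⟨N, fun i hi j hj => (h _).trans_lt ?_⟩
  calc C * mixedNorm p q α (P i - P j) ≤ (C + 1) * mixedNorm p q α (P i - P j) := by
        gcongr; exact le_self_add
    _ < (C + 1) * (ε / (C + 1)) :=
        ENNReal.mul_lt_mul_right (by simp) (by finiteness) (hN i hi j hj)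
    _ ≤ ε := ENNReal.mul_div_le

/-! ### Coefficients -/

theorem wdeg_single [DecidableEq Nat.Primes] (p : Nat.Primes) (n : ℕ+) :
    wdeg (Pi.single p 1) n = (n : ℕ).factorization (p : ℕ) := by
  rw [wdeg_eq_sum _ n (S := insert p (primeSet n)) (Finset.subset_insert _ _),
    Finset.sum_eq_single_of_mem p (Finset.mem_insert_self _ _)]
  · simp
  · intro q _ hq
    simp [hq]

theorem prod_primeSet_pow (n : ℕ+) :
    ∏ p ∈ primeSet n, (p : ℕ) ^ (n : ℕ).factorization (p : ℕ) = n := by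
  have h := mon_cpow 1 n
  simp only [Complex.cpow_one] at h
  have h' : ∏ p ∈ primeSet n, ((p : ℕ) : ℂ) ^ (n : ℕ).factorization (p : ℕ) = ((n : ℕ) : ℂ) := h
  exact_mod_cast h'

/-- One prime is fixed at a time: the weight supported at `p` has degree `ν_p`, and its projection
costs the factor `ν_p(n) + 1`. -/
theorem hardyInt_filter_factorization_le (P : DirichletPolynomial) (n : ℕ+) {w : ℝ} (hw : 0 < w)
    (S : Finset Nat.Primes) :
    hardyInt w (P.filter fun m : ℕ+ =>
        ∀ p ∈ S, (m : ℕ).factorization (p : ℕ) = (n : ℕ).factorization (p : ℕ))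
      ≤ (∏ p ∈ S, ((n : ℕ).factorization (p : ℕ) + 1) : ℕ) * hardyInt w P := by
  classical
  induction S using Finset.induction_on with
  | empty =>
    have : (P.filter fun m : ℕ+ => ∀ p ∈ (∅ : Finset Nat.Primes),
        (m : ℕ).factorization (p : ℕ) = (n : ℕ).factorization (p : ℕ)) = P := by
      ext m; simp
    rw [this]; simp
  | insert p S hp ih =>
    have h := hardyInt_filter_wdeg_le (P.filter fun m : ℕ+ =>
        ∀ p ∈ S, (m : ℕ).factorization (p : ℕ) = (n : ℕ).factorization (p : ℕ))
        (Pi.single p 1) ((n : ℕ).factorization (p : ℕ)) hw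
    have e : ((P.filter fun m : ℕ+ =>
        ∀ p ∈ S, (m : ℕ).factorization (p : ℕ) = (n : ℕ).factorization (p : ℕ)).filter
          fun m : ℕ+ => wdeg (Pi.single p 1) m = (n : ℕ).factorization (p : ℕ))
        = P.filter fun m : ℕ+ => ∀ r ∈ insert p S,
          (m : ℕ).factorization (r : ℕ) = (n : ℕ).factorization (r : ℕ) := by
      ext m
      simp only [Finsupp.filter_apply, wdeg_single, Finset.forall_mem_insert]
      split_ifs <;> first | rfl | tauto
    rw [e] at h
    refine h.trans ?_
    rw [Finset.prod_insert hp, Nat.cast_mul, mul_assoc]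
    gcongr

/-- The number of divisors of `n` is at most `n`, because `k + 1 ≤ p ^ k` for each prime power. -/
theorem prod_factorization_add_one_le (n : ℕ+) {S : Finset Nat.Primes} (hS : primeSet n ⊆ S) :
    ∏ p ∈ S, ((n : ℕ).factorization (p : ℕ) + 1) ≤ n := by
  rw [← Finset.prod_subset hS fun p _ h => by rw [factorization_eq_zero_of_notMem h, zero_add]]
  conv_rhs => rw [← prod_primeSet_pow n]
  exact Finset.prod_le_prod' fun p _ => Nat.lt_pow_self p.2.one_lt

theorem hardyInt_single {w : ℝ} (n : ℕ+) (a : ℂ) :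
    hardyInt w (Finsupp.single n a) = ‖a‖ₑ ^ w := by
  unfold hardyInt
  have : ∀ θ, ‖bohrLift (Finsupp.single n a) θ‖ₑ = ‖a‖ₑ := by
    intro θ
    rw [bohrLift_single, enorm_mul, ← ofReal_norm (bohrMonomial n θ), norm_bohrMonomial]
    simp
  simp [this]

/-- Coefficient estimate in the Hardy space. -/
theorem enorm_coeff_rpow_le (P : DirichletPolynomial) (n : ℕ+) {w : ℝ} (hw : 0 < w) :
    ‖P n‖ₑ ^ w ≤ (n : ℕ) * hardyInt w P := by
  classical
  -- These primes suffice to tell `n` apart from every index in the support, so the filter leaves a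
  -- single term.
  set S := primeSet n ∪ P.support.biUnion primeSet
  have h := hardyInt_filter_factorization_le P n hw S
  have e : (P.filter fun m : ℕ+ =>
      ∀ p ∈ S, (m : ℕ).factorization (p : ℕ) = (n : ℕ).factorization (p : ℕ))
      = Finsupp.single n (P n) := by
    ext m
    rw [Finsupp.filter_apply, Finsupp.single_apply]
    rcases eq_or_ne n m with rfl | hnm
    · simp
    rw [if_neg hnm]
    split_ifs with hm
    · by_contra hPm
      apply hnm
      apply PNat.eq
      refine (Nat.eq_of_factorization_eq m.ne_zero n.ne_zero fun q => ?_).symm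
      by_cases hq : q.Prime
      · by_cases hqS : (⟨q, hq⟩ : Nat.Primes) ∈ S
        · exact hm _ hqS
        · have h1 : (⟨q, hq⟩ : Nat.Primes) ∉ primeSet n := fun h => hqS (Finset.mem_union_left _ h)
          have h2 : (⟨q, hq⟩ : Nat.Primes) ∉ primeSet m := fun h =>
            hqS (Finset.mem_union_right _ (Finset.mem_biUnion.2
              ⟨m, Finsupp.mem_support_iff.2 hPm, h⟩))
          exact (factorization_eq_zero_of_notMem h2).trans (factorization_eq_zero_of_notMem h1).symm
      · rw [Nat.factorization_eq_zero_of_not_prime _ hq,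
          Nat.factorization_eq_zero_of_not_prime _ hq]
    · rfl
  rw [e, hardyInt_single] at h
  refine h.trans ?_
  gcongr
  exact prod_factorization_add_one_le n Finset.subset_union_left

theorem enorm_coeff_le (P : DirichletPolynomial) (n : ℕ+) {w : ℝ} (hw : 0 < w) :
    ‖P n‖ₑ ≤ ((n : ℕ) : ℝ≥0∞) ^ (1 / w) * hardyNorm w P := by
  have h := ENNReal.rpow_le_rpow (enorm_coeff_rpow_le P n hw) (by positivity : 0 ≤ 1 / w)
  rwa [ENNReal.mul_rpow_of_nonneg _ _ (by positivity), ← ENNReal.rpow_mul,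
    mul_one_div_cancel hw.ne', ENNReal.rpow_one] at h

/-- Coefficient estimate in the mixed norm space. -/
theorem enorm_coeff_le_mixedNorm {u v β : ℝ} (hu : 0 < u) (hv : 0 < v) (hβ : -1 < β) :
    ∃ C : ℝ≥0∞, C ≠ ∞ ∧ ∀ (P : DirichletPolynomial) (n : ℕ+),
      ‖P n‖ₑ ≤ ((n : ℕ) : ℝ≥0∞) ^ (1 + 1 / u) * (C * mixedNorm u v β P) := by
  obtain ⟨c, hc, hμ⟩ := weightMeasure_Ioc_ge hβ
  -- For `σ ≤ 1`, undoing the translation of the coefficient costs at most `n`; this is the extra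
  -- `1` in the exponent `1 + 1 / u`.
  set S := Set.Ioc ((1 : ℝ) / 2) 1 with hS
  have hμS : weightMeasure β S ≠ 0 := by
    have := hμ 1 one_pos le_rfl
    intro h0
    rw [← hS, h0] at this
    simp at this
    linarith
  have hfin := isFiniteMeasure_weightMeasure hβ
  refine ⟨(weightMeasure β S ^ (1 / v))⁻¹, ?_, fun P n => ?_⟩
  · exact ENNReal.inv_ne_top.2
      (ENNReal.rpow_pos (pos_iff_ne_zero.2 hμS) (measure_ne_top _ _)).ne'
  have hn0 : ((n : ℕ) : ℝ≥0∞) ≠ 0 := by exact_mod_cast n.ne_zero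
  have hnt : ((n : ℕ) : ℝ≥0∞) ≠ ∞ := ENNReal.natCast_ne_top _
  set B := ((n : ℕ) : ℝ≥0∞) ^ (1 + 1 / u) with hB
  have hB0 : B ≠ 0 := (ENNReal.rpow_pos (pos_iff_ne_zero.2 hn0) hnt).ne'
  have hBt : B ≠ ∞ := ENNReal.rpow_ne_top_of_nonneg (by positivity) hnt
  have h1 : ∀ σ ∈ S, B⁻¹ * ‖P n‖ₑ ≤ hardyNorm u (P.translate σ) := by
    intro σ hσ
    have h2 := enorm_coeff_le (P.translate σ) n hu
    have h3 : ‖P n‖ₑ ≤ (n : ℕ) * ‖P.translate σ n‖ₑ := by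
      rw [← ofReal_norm, ← ofReal_norm, ← ENNReal.ofReal_natCast,
        ← ENNReal.ofReal_mul (by positivity), translate_apply, norm_mul,
        norm_natCast_cpow_of_pos n.pos]
      apply ENNReal.ofReal_le_ofReal
      have h4 : (1 : ℝ) ≤ (n : ℕ) * ((n : ℕ) : ℝ) ^ (-(σ : ℂ)).re := by
        have hn1 : (1 : ℝ) ≤ (n : ℕ) := by exact_mod_cast n.pos
        have hnp : (0 : ℝ) < (n : ℕ) := by linarith
        calc (1 : ℝ) ≤ ((n : ℕ) : ℝ) ^ (1 + (-(σ : ℂ)).re) :=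
              Real.one_le_rpow hn1 (by simp; exact hσ.2)
          _ = _ := by rw [Real.rpow_add hnp, Real.rpow_one]
      nlinarith [norm_nonneg (P n)]
    rw [ENNReal.inv_mul_le_iff hB0 hBt, hB, ENNReal.rpow_add _ _ hn0 hnt, ENNReal.rpow_one,
      mul_assoc]
    exact h3.trans (by gcongr)
  have h5 : B⁻¹ * ‖P n‖ₑ * weightMeasure β S ^ (1 / v) ≤ mixedNorm u v β P := by
    calc B⁻¹ * ‖P n‖ₑ * weightMeasure β S ^ (1 / v)
        = (∫⁻ _ in S, (B⁻¹ * ‖P n‖ₑ) ^ v ∂weightMeasure β) ^ (1 / v) := by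
          rw [setLIntegral_const, ENNReal.mul_rpow_of_nonneg _ _ (by positivity),
            ← ENNReal.rpow_mul, mul_one_div_cancel hv.ne', ENNReal.rpow_one]
      _ ≤ (∫⁻ σ, hardyNorm u (P.translate σ) ^ v ∂weightMeasure β) ^ (1 / v) := by
          gcongr ?_ ^ _
          exact (setLIntegral_mono' measurableSet_Ioc fun σ hσ =>
            ENNReal.rpow_le_rpow (h1 σ hσ) hv.le).trans (setLIntegral_le_lintegral _ _)
  have hμ0 : weightMeasure β S ^ (1 / v) ≠ 0 :=
    (ENNReal.rpow_pos (pos_iff_ne_zero.2 hμS) (measure_ne_top _ _)).ne'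
  have hμt : weightMeasure β S ^ (1 / v) ≠ ∞ :=
    ENNReal.rpow_ne_top_of_nonneg (by positivity) (measure_ne_top _ _)
  rw [← ENNReal.inv_mul_le_iff hB0 hBt, mul_comm _⁻¹ (mixedNorm u v β P), ← div_eq_mul_inv,
    ENNReal.le_div_iff_mul_le (Or.inl hμ0) (Or.inl hμt)]
  exact h5

open Filter Topology

/-! ### The coefficients of a function in the mixed norm space -/

theorem eval_eq_sum (P : DirichletPolynomial) (s : ℂ) :
    P.eval s = ∑ n ∈ P.support, P n * ((n : ℕ) : ℂ) ^ (-s) := rfl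

theorem eval_sum_smul {ι : Type*} (S : Finset ι) (c : ι → ℂ) (P : ι → DirichletPolynomial) (s : ℂ) :
    DirichletPolynomial.eval (∑ i ∈ S, c i • P i) s = ∑ i ∈ S, c i * (P i).eval s := by
  have h : ∀ P : DirichletPolynomial,
      P.eval s = Finsupp.linearCombination ℂ (fun n : ℕ+ => ((n : ℕ) : ℂ) ^ (-s)) P := fun P => rfl
  simp only [h, map_sum, map_smul, smul_eq_mul]

/-- Extension by zero of a sequence indexed by the positive integers. -/
def extendZero (a : ℕ+ → ℂ) (n : ℕ) : ℂ := if h : 0 < n then a ⟨n, h⟩ else 0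

theorem extendZero_coe (a : ℕ+ → ℂ) (n : ℕ+) : extendZero a n = a n := by
  rw [extendZero, dif_pos n.pos]; rfl

theorem LSeries_extendZero (P : DirichletPolynomial) (s : ℂ) :
    LSeries (extendZero P) s = P.eval s := by
  have h0 : ∀ n ∉ P.support.map ⟨PNat.val, PNat.coe_injective⟩,
      LSeries.term (extendZero P) s n = 0 := by
    intro n hn
    rcases Nat.eq_zero_or_pos n with rfl | hpos
    · simp
    · have : P ⟨n, hpos⟩ = 0 := by
        by_contra hP
        exact hn (Finset.mem_map.2 ⟨⟨n, hpos⟩, Finsupp.mem_support_iff.2 hP, rfl⟩)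
      rw [LSeries.term_of_ne_zero hpos.ne', extendZero, dif_pos hpos, this, zero_div]
  rw [LSeries, tsum_eq_sum h0, Finset.sum_map, eval_eq_sum]
  refine Finset.sum_congr rfl fun n _ => ?_
  change LSeries.term (extendZero P) s (n : ℕ) = _
  rw [LSeries.term_of_ne_zero n.ne_zero, extendZero_coe, Complex.cpow_neg, div_eq_mul_inv]

theorem exists_bound_of_isMixedCauchy {u v β : ℝ} (hu : 0 < u) (hv : 0 < v) (hβ : -1 < β)
    {Q : ℕ → DirichletPolynomial} (hQ : IsMixedCauchy u v β Q) :
    ∃ R : ℝ≥0∞, R ≠ ∞ ∧ ∀ᶠ j in atTop, mixedNorm u v β (Q j) ≤ R := by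
  obtain ⟨K, _, hK⟩ := mixedNorm_add_le hu hv
  obtain ⟨N, hN⟩ := hQ 1 one_pos
  have hfin := mixedNorm_ne_top hu hv hβ (Q N)
  refine ⟨ENNReal.ofReal K * (1 + mixedNorm u v β (Q N)), by finiteness, ?_⟩
  filter_upwards [eventually_ge_atTop N] with j hj
  calc mixedNorm u v β (Q j) = mixedNorm u v β ((Q j - Q N) + Q N) := by rw [sub_add_cancel]
    _ ≤ _ := (hK β _ _).trans (by gcongr; exact (hN j hj N le_rfl).le)

/-- Coefficients are continuous for the norm, so they converge and are bounded by a fixed power of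
`n`, uniformly in `j`. Dominated convergence then represents `f` by its Dirichlet series far to the
right, which is enough to determine the coefficients. -/
theorem exists_coeff_of_isMixedCauchy {u v β : ℝ} (hu : 0 < u) (hv : 0 < v) (hβ : -1 < β)
    {Q : ℕ → DirichletPolynomial} (hQ : IsMixedCauchy u v β Q) {f : HalfPlane → ℂ}
    (hf : ∀ s : HalfPlane, Tendsto (fun j => (Q j).eval (s : ℂ)) atTop (𝓝 (f s))) :
    ∃ b : ℕ+ → ℂ, (∀ n, Tendsto (fun j => Q j n) atTop (𝓝 (b n))) ∧
      LSeries.abscissaOfAbsConv (extendZero b) < ⊤ ∧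
      ∃ A : ℝ, ∀ s : HalfPlane, A < (s : ℂ).re → f s = LSeries (extendZero b) s := by
  obtain ⟨C, hC, hcoef⟩ := enorm_coeff_le_mixedNorm hu hv hβ
  have hfin : ∀ n : ℕ+, ((n : ℕ) : ℝ≥0∞) ^ (1 + 1 / u) ≠ ∞ := fun n =>
    ENNReal.rpow_ne_top_of_nonneg (by positivity) (ENNReal.natCast_ne_top _)
  have hcau : ∀ n, CauchySeq fun j => Q j n := by
    intro n
    rw [EMetric.cauchySeq_iff]
    intro ε hε
    set D := ((n : ℕ) : ℝ≥0∞) ^ (1 + 1 / u) * C with hD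
    have hDfin : D ≠ ∞ := ENNReal.mul_ne_top (hfin n) hC
    obtain ⟨N, hN⟩ := hQ (ε / (D + 1)) (ENNReal.div_pos hε.ne' (by finiteness))
    refine ⟨N, fun i hi j hj => ?_⟩
    rw [edist_eq_enorm_sub]
    have h := hcoef (Q i - Q j) n
    rw [Finsupp.sub_apply, ← mul_assoc] at h
    refine h.trans_lt ?_
    calc D * mixedNorm u v β (Q i - Q j) ≤ (D + 1) * mixedNorm u v β (Q i - Q j) := by
          gcongr; exact le_self_add
      _ < (D + 1) * (ε / (D + 1)) :=
          ENNReal.mul_lt_mul_right (by simp) (by finiteness) (hN i hi j hj)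
      _ ≤ ε := ENNReal.mul_div_le
  choose b hb using fun n => cauchySeq_tendsto_of_complete (hcau n)
  obtain ⟨R, hR, hQR⟩ := exists_bound_of_isMixedCauchy hu hv hβ hQ
  set A : ℝ := 1 + 1 / u with hA
  have hbound : ∀ᶠ j in atTop, ∀ n : ℕ+, ‖Q j n‖ ≤ (C * R).toReal * ((n : ℕ) : ℝ) ^ A := by
    filter_upwards [hQR] with j hj n
    have h : ‖Q j n‖ₑ ≤ ((n : ℕ) : ℝ≥0∞) ^ A * (C * R) := (hcoef (Q j) n).trans (by gcongr)
    have h2 := ENNReal.toReal_mono (ENNReal.mul_ne_top (hfin n) (ENNReal.mul_ne_top hC hR)) h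
    rw [toReal_enorm, ENNReal.toReal_mul, ← ENNReal.toReal_rpow, ENNReal.toReal_natCast,
      mul_comm] at h2
    exact h2
  have hb_bound : ∀ n : ℕ+, ‖b n‖ ≤ (C * R).toReal * ((n : ℕ) : ℝ) ^ A := fun n =>
    le_of_tendsto (hb n).norm (hbound.mono fun j hj => hj n)
  have hterm : ∀ (a : ℕ+ → ℂ), (∀ n : ℕ+, ‖a n‖ ≤ (C * R).toReal * ((n : ℕ) : ℝ) ^ A) →
      ∀ (s : ℂ) (n : ℕ), ‖LSeries.term (extendZero a) s n‖
        ≤ (C * R).toReal * ((n : ℕ) : ℝ) ^ (A - s.re) := by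
    intro a ha s n
    rcases Nat.eq_zero_or_pos n with rfl | hpos
    · simp only [LSeries.term_zero, norm_zero]; positivity
    · rw [LSeries.term_of_ne_zero hpos.ne', extendZero, dif_pos hpos, norm_div,
        norm_natCast_cpow_of_pos hpos, Real.rpow_sub (by exact_mod_cast hpos), ← mul_div_assoc]
      gcongr
      exact ha ⟨n, hpos⟩
  have hsum : ∀ s : ℂ, A + 1 < s.re →
      Summable fun n : ℕ => (C * R).toReal * ((n : ℕ) : ℝ) ^ (A - s.re) := fun s hs =>
    (Real.summable_nat_rpow.2 (by linarith)).mul_left _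
  refine ⟨b, hb, ?_, A + 1, fun s hs => ?_⟩
  · have hs : LSeriesSummable (extendZero b) ((A + 2 : ℝ) : ℂ) :=
      Summable.of_norm_bounded (hsum _ (by rw [Complex.ofReal_re]; linarith)) (hterm b hb_bound _)
    exact (hs.abscissaOfAbsConv_le).trans_lt (EReal.coe_lt_top _)
  · refine tendsto_nhds_unique (hf s) ?_
    simp_rw [← LSeries_extendZero]
    refine tendsto_tsum_of_dominated_convergence (hsum s hs) (fun n => ?_) ?_
    · rcases Nat.eq_zero_or_pos n with rfl | hpos
      · simp
      · simp only [LSeries.term_of_ne_zero hpos.ne', extendZero, dif_pos hpos]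
        exact (hb ⟨n, hpos⟩).div_const _
    · filter_upwards [hbound] with j hj n
      exact hterm (Q j) hj _ n

/-- A function in two mixed norm spaces has the same coefficients in both. -/
theorem tendsto_coeff_of_tendsto_coeff {p q α u v β : ℝ} (hp : 0 < p) (hq : 0 < q) (hα : -1 < α)
    (hu : 0 < u) (hv : 0 < v) (hβ : -1 < β) {f : HalfPlane → ℂ} {S Q : ℕ → DirichletPolynomial}
    (hS : IsMixedCauchy p q α S)
    (hSf : ∀ s : HalfPlane, Tendsto (fun j => (S j).eval (s : ℂ)) atTop (𝓝 (f s)))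
    (hQ : IsMixedCauchy u v β Q)
    (hQf : ∀ s : HalfPlane, Tendsto (fun j => (Q j).eval (s : ℂ)) atTop (𝓝 (f s)))
    {n : ℕ+} {c : ℂ} (h : Tendsto (fun j => S j n) atTop (𝓝 c)) :
    Tendsto (fun j => Q j n) atTop (𝓝 c) := by
  obtain ⟨b, hb, hbabs, A, hA⟩ := exists_coeff_of_isMixedCauchy hp hq hα hS hSf
  obtain ⟨b', hb', hbabs', A', hA'⟩ := exists_coeff_of_isMixedCauchy hu hv hβ hQ hQf
  have heq : extendZero b n = extendZero b' n := by
    refine LSeries.eq_of_LSeries_eventually_eq hbabs hbabs' ?_ n.ne_zero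
    filter_upwards [eventually_gt_atTop A, eventually_gt_atTop A', eventually_gt_atTop (1 / 2)]
      with x h1 h2 h3
    exact (hA ⟨(x : ℂ), by simpa using h3⟩ (by simpa using h1)).symm.trans
      (hA' ⟨(x : ℂ), by simpa using h3⟩ (by simpa using h2))
  rw [extendZero_coe, extendZero_coe] at heq
  rw [tendsto_nhds_unique h (hb n), heq]
  exact hb' n

/-! ### Projections -/

theorem mixedNorm_filter_wdeg_le {u v : ℝ} (hu : 0 < u) (hv : 0 < v) (β : ℝ)
    (P : DirichletPolynomial) (k : Nat.Primes → ℕ) (m : ℕ) :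
    mixedNorm u v β (P.filter fun n => wdeg k n = m)
      ≤ ((m + 1 : ℕ) : ℝ≥0∞) ^ (1 / u) * mixedNorm u v β P := by
  have h : ∀ σ, 0 < σ → hardyNorm u
      (DirichletPolynomial.translate (P.filter fun n => wdeg k n = m) σ)
      ≤ ((m + 1 : ℕ) : ℝ≥0∞) ^ (1 / u) * hardyNorm u (P.translate σ) := by
    intro σ _
    rw [translate_filter, hardyNorm_eq, hardyNorm_eq,
      ← ENNReal.mul_rpow_of_nonneg _ _ (by positivity)]
    exact ENNReal.rpow_le_rpow (hardyInt_filter_wdeg_le _ k m hu) (by positivity)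
  refine (mixedNorm_mono_of_hardyNorm_le hv h).trans_eq ?_
  exact lintegral_const_mul_rpow _ hv
    (ENNReal.rpow_ne_top_of_nonneg (by positivity) (ENNReal.natCast_ne_top _)) _

/-- The indicator function of the primes outside `(y, Y]`. -/
def outside (y Y : ℕ) (p : Nat.Primes) : ℕ := if y < (p : ℕ) ∧ (p : ℕ) ≤ Y then 0 else 1

/-- The part of a Dirichlet polynomial that is homogeneous of degree `N` in the primes of
`(y, Y]`. -/
def blockPart (y Y N : ℕ) (P : DirichletPolynomial) : DirichletPolynomial :=
  (P.filter fun n => wdeg (outside y Y) n = 0).filter fun n => wdeg (fun _ => 1) n = N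

/-- Removing the primes outside the block is a degree-zero projection of norm at most `1`. The loss
therefore depends on the degree alone, not on the number of primes in the block. -/
theorem mixedNorm_blockPart_le {u v : ℝ} (hu : 0 < u) (hv : 0 < v) (β : ℝ) (y Y N : ℕ)
    (P : DirichletPolynomial) :
    mixedNorm u v β (blockPart y Y N P) ≤ ((N + 1 : ℕ) : ℝ≥0∞) ^ (1 / u) * mixedNorm u v β P := by
  refine (mixedNorm_filter_wdeg_le hu hv β _ _ N).trans ?_
  gcongr
  simpa using mixedNorm_filter_wdeg_le hu hv β P (outside y Y) 0

theorem wdeg_outside_eq_zero_iff {y Y : ℕ} {n : ℕ+} :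
    wdeg (outside y Y) n = 0 ↔ ∀ p : Nat.Primes, (p : ℕ) ∣ n → y < (p : ℕ) ∧ (p : ℕ) ≤ Y := by
  unfold wdeg
  rw [Finset.sum_eq_zero_iff]
  refine forall_congr' fun p => ?_
  rw [mem_primeSet]
  refine imp_congr_right fun hp => ?_
  have h : (n : ℕ).factorization (p : ℕ) ≠ 0 := by
    have := (p.2.dvd_iff_one_le_factorization n.ne_zero).1 hp
    omega
  rw [mul_eq_zero, or_iff_left h, outside]
  split_ifs with h' <;> simp [h']

theorem blockPart_apply (y Y N : ℕ) (P : DirichletPolynomial) (n : ℕ+) :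
    blockPart y Y N P n
      = if wdeg (outside y Y) n = 0 ∧ wdeg (fun _ => 1) n = N then P n else 0 := by
  rw [blockPart, Finsupp.filter_apply, Finsupp.filter_apply, ← ite_and]
  simp only [and_comm]

theorem le_pow_wdeg {Y : ℕ} {n : ℕ+} (h : ∀ p : Nat.Primes, (p : ℕ) ∣ n → (p : ℕ) ≤ Y) :
    (n : ℕ) ≤ Y ^ wdeg (fun _ => 1) n := by
  induction n using pnat_induction with
  | h1 => simp
  | hp p => rw [wdeg_prime, pow_one]; exact h p dvd_rfl
  | hmul a b ha hb =>
    rw [wdeg_mul, pow_add, PNat.mul_coe]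
    exact Nat.mul_le_mul (ha fun p hp => h p (hp.trans (by simp)))
      (hb fun p hp => h p (hp.trans (by simp)))

theorem exists_prime_dvd_of_wdeg_ne_zero {n : ℕ+} (h : wdeg (fun _ => 1) n ≠ 0) :
    ∃ p : Nat.Primes, (p : ℕ) ∣ n := by
  obtain ⟨p, hp, _⟩ := Finset.exists_ne_zero_of_sum_ne_zero h
  exact ⟨p, mem_primeSet.1 hp⟩

/-- A product of `N` primes up to `Y` is at most `Y ^ N`. The block projection thus has its range in
a finite-dimensional space that does not depend on `P`. -/
theorem support_blockPart_subset (y Y N : ℕ) (P : DirichletPolynomial) :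
    (blockPart y Y N P).support ⊆ Finset.Iic (Nat.toPNat' (Y ^ N)) := by
  intro n hn
  rw [Finsupp.mem_support_iff, blockPart_apply] at hn
  have h : wdeg (outside y Y) n = 0 ∧ wdeg (fun _ => 1) n = N := by
    by_contra hc
    exact hn (if_neg hc)
  rw [Finset.mem_Iic, ← PNat.coe_le_coe]
  have h2 := le_pow_wdeg fun p hp => (wdeg_outside_eq_zero_iff.1 h.1 p hp).2
  rw [h.2] at h2
  rw [Nat.toPNat'_coe, if_pos (n.pos.trans_le h2)]
  exact h2

/-! ### Gliding hump -/

/-- Summation of a geometrically decreasing series in a quasi-normed space. -/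
theorem mixedNorm_sum_geometric_le {p q α K : ℝ} (hp : 0 < p) (hq : 0 < q) (hK : 1 ≤ K)
    (htri : ∀ P Q : DirichletPolynomial, mixedNorm p q α (P + Q)
      ≤ ENNReal.ofReal K * (mixedNorm p q α P + mixedNorm p q α Q))
    {F : ℕ → DirichletPolynomial}
    (hF : ∀ m, mixedNorm p q α (F m) ≤ ENNReal.ofReal ((1 / (2 * K)) ^ m)) (d i : ℕ) :
    mixedNorm p q α (∑ m ∈ Finset.range d, F (i + m))
      ≤ ENNReal.ofReal (2 * K * (1 / (2 * K)) ^ i) := by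
  have hK0 : 0 < K := by linarith
  induction d generalizing i with
  | zero => simp [mixedNorm_zero hp hq]
  | succ d ih =>
    -- The first, largest term is split off, so that only the tail pays the next factor `K`. With
    -- ratio `1 / (2K)` the bound reproduces itself: `K (2K t^(i+1) + t^i) = 2K t^i`.
    rw [Finset.sum_range_succ']
    refine (htri _ _).trans ?_
    have h1 : mixedNorm p q α (∑ m ∈ Finset.range d, F (i + (m + 1)))
        ≤ ENNReal.ofReal (2 * K * (1 / (2 * K)) ^ (i + 1)) := by
      have := ih (i + 1)
      simpa only [add_assoc, add_comm 1] using this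
    refine (mul_le_mul_right (add_le_add h1 (hF (i + 0))) _).trans_eq ?_
    rw [← ENNReal.ofReal_add (by positivity) (by positivity), ← ENNReal.ofReal_mul hK0.le]
    congr 1
    rw [pow_succ, add_zero]
    field_simp
    ring

theorem isMixedCauchy_sum_range {p q α K : ℝ} (hp : 0 < p) (hq : 0 < q) (hK : 1 ≤ K)
    (htri : ∀ P Q : DirichletPolynomial, mixedNorm p q α (P + Q)
      ≤ ENNReal.ofReal K * (mixedNorm p q α P + mixedNorm p q α Q))
    {F : ℕ → DirichletPolynomial}
    (hF : ∀ m, mixedNorm p q α (F m) ≤ ENNReal.ofReal ((1 / (2 * K)) ^ m)) :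
    IsMixedCauchy p q α fun j => ∑ m ∈ Finset.range j, F m := by
  intro ε hε
  have hK0 : 0 < K := by linarith
  have hlim : Tendsto (fun i : ℕ => ENNReal.ofReal (2 * K * (1 / (2 * K)) ^ i)) atTop (𝓝 0) := by
    rw [← ENNReal.ofReal_zero]
    refine ENNReal.tendsto_ofReal ?_
    rw [← mul_zero (2 * K)]
    refine (tendsto_pow_atTop_nhds_zero_of_lt_one (by positivity) ?_).const_mul _
    rw [div_lt_one (by positivity)]
    linarith
  obtain ⟨N, hN⟩ := eventually_atTop.1 (hlim.eventually (gt_mem_nhds hε))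
  have key : ∀ i j, N ≤ i → i ≤ j →
      mixedNorm p q α (∑ m ∈ Finset.range j, F m - ∑ m ∈ Finset.range i, F m) < ε := by
    intro i j hi hij
    obtain ⟨d, rfl⟩ := Nat.exists_eq_add_of_le hij
    rw [Finset.sum_range_add, add_sub_cancel_left]
    exact (mixedNorm_sum_geometric_le hp hq hK htri hF d i).trans_lt (hN i hi)
  refine ⟨N, fun i hi j hj => ?_⟩
  rcases le_total i j with h | h
  · rw [← mixedNorm_neg hp hq, neg_sub]
    exact key i j hi h
  · exact key j i hj h

/-- Test polynomials of degree `N` in the primes beyond `y`, with bounded norm in `ℋ^{p,q}_α` and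
large norm in `ℋ^{u,v}_β`. -/
def HasTestPolynomials (p q α u v β : ℝ) : Prop :=
  ∀ (y : ℕ) (M : ℝ), ∃ N : ℕ, N ≠ 0 ∧ ∃ P : DirichletPolynomial,
    (∀ n ∈ P.support, (∀ r : Nat.Primes, (r : ℕ) ∣ n → y < (r : ℕ)) ∧ wdeg (fun _ => 1) n = N) ∧
    mixedNorm p q α P ≤ 1 ∧ (∀ s : ℂ, 1 / 2 < s.re → ‖P.eval s‖ ≤ 1) ∧
    ENNReal.ofReal M * ((N + 1 : ℕ) : ℝ≥0∞) ^ (1 / u) ≤ mixedNorm u v β P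

/-- Test polynomials in disjoint blocks of primes. -/
theorem exists_blocks {p q α u v β : ℝ} (H : HasTestPolynomials p q α u v β) (M : ℕ → ℝ) :
    ∃ (y : ℕ → ℕ) (N : ℕ → ℕ) (P : ℕ → DirichletPolynomial), Monotone y ∧ ∀ m, N m ≠ 0 ∧
      (∀ n ∈ (P m).support, wdeg (outside (y m) (y (m + 1))) n = 0 ∧
        wdeg (fun _ => 1) n = N m) ∧
      mixedNorm p q α (P m) ≤ 1 ∧ (∀ s : ℂ, 1 / 2 < s.re → ‖(P m).eval s‖ ≤ 1) ∧
      ENNReal.ofReal (M m) * ((N m + 1 : ℕ) : ℝ≥0∞) ^ (1 / u) ≤ mixedNorm u v β (P m) := by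
  choose N hN P hsupp hP hev hlow using H
  -- The next cutoff dominates every integer in the current support, hence every prime dividing one,
  -- and the blocks are disjoint.
  let next : ℕ → ℕ → ℕ := fun m y => max y ((P y (M m)).support.sup fun n => (n : ℕ))
  let y : ℕ → ℕ := fun m => Nat.rec 0 next m
  have hy : ∀ m, y (m + 1) = max (y m) ((P (y m) (M m)).support.sup fun n => (n : ℕ)) :=
    fun m => rfl
  refine ⟨y, fun m => N (y m) (M m), fun m => P (y m) (M m),
    monotone_nat_of_le_succ fun m => by rw [hy]; exact le_max_left _ _, fun m =>
      ⟨hN _ _, fun n hn => ⟨wdeg_outside_eq_zero_iff.2 fun r hr => ⟨(hsupp _ _ n hn).1 r hr, ?_⟩,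
        (hsupp _ _ n hn).2⟩, hP _ _, hev _ _, hlow _ _⟩⟩
  rw [hy]
  exact (Nat.le_of_dvd n.pos hr).trans
    ((Finset.le_sup (f := fun n : ℕ+ => (n : ℕ)) hn).trans (le_max_right _ _))

/-- The counterexample is `f = ∑ t^m P_m` with `t = 1 / (2K)` and lower bounds growing like
`(2/t)^m`. If `f` also came from a Cauchy sequence `Q_j` of the target, projecting `Q_j` onto the
`m`-th block would bound `t^m P_m` by a constant times `(N_m + 1)^(1/u)`, whereas its norm is at
least `2^m (N_m + 1)^(1/u)`. The evaluation bound on the `P_m` makes the series converge pointwise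
on the half-plane. -/
theorem not_subset_of_hasTestPolynomials {p q α u v β : ℝ} (hp : 0 < p) (hq : 0 < q)
    (hα : -1 < α) (hu : 0 < u) (hv : 0 < v) (hβ : -1 < β)
    (H : HasTestPolynomials p q α u v β) : ¬ mixedSpace p q α ⊆ mixedSpace u v β := by
  intro hincl
  obtain ⟨K, hK, htri⟩ := mixedNorm_add_le hp hq
  obtain ⟨K', hK', htri'⟩ := mixedNorm_add_le hu hv
  have hK0 : 0 < K := by linarith
  set t : ℝ := 1 / (2 * K) with ht
  have ht0 : 0 < t := by positivity
  have ht1 : t < 1 := by rw [ht, div_lt_one (by positivity)]; linarith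
  obtain ⟨y, N, P, hy, hP⟩ := exists_blocks H fun m => (2 / t) ^ m
  set F : ℕ → DirichletPolynomial := fun m => ((t ^ m : ℝ) : ℂ) • P m with hFdef
  have htn : ∀ m, ‖((t ^ m : ℝ) : ℂ)‖ₑ = ENNReal.ofReal (t ^ m) := fun m => by
    rw [← ofReal_norm, Complex.norm_of_nonneg (by positivity)]
  have hF : ∀ m, mixedNorm p q α (F m) ≤ ENNReal.ofReal (t ^ m) := by
    intro m
    rw [hFdef]
    simp only
    rw [mixedNorm_smul hp hq, htn]
    exact mul_le_of_le_one_right (zero_le) (hP m).2.2.1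
  have hcau := isMixedCauchy_sum_range hp hq hK (htri α) hF
  set S : ℕ → DirichletPolynomial := fun j => ∑ m ∈ Finset.range j, F m with hS
  have hsummable : ∀ s : HalfPlane, Summable fun m => ((t ^ m : ℝ) : ℂ) * (P m).eval (s : ℂ) := by
    intro s
    refine Summable.of_norm_bounded (summable_geometric_of_lt_one ht0.le ht1) fun m => ?_
    rw [norm_mul, Complex.norm_of_nonneg (by positivity)]
    exact mul_le_of_le_one_right (by positivity) ((hP m).2.2.2.1 _ s.2)
  set f : HalfPlane → ℂ := fun s => ∑' m, ((t ^ m : ℝ) : ℂ) * (P m).eval (s : ℂ) with hf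
  have hSf : ∀ s : HalfPlane, Tendsto (fun j => (S j).eval (s : ℂ)) atTop (𝓝 (f s)) := by
    intro s
    simp only [hS, hFdef, eval_sum_smul]
    exact (hsummable s).hasSum.tendsto_sum_nat
  obtain ⟨Q, hQ, hQf⟩ := hincl ⟨S, hcau, hSf⟩
  obtain ⟨R, hR, hQR⟩ := exists_bound_of_isMixedCauchy hu hv hβ hQ
  have hcoeff : ∀ m (n : ℕ+), wdeg (outside (y m) (y (m + 1))) n = 0 →
      wdeg (fun _ => 1) n = N m → Tendsto (fun j => Q j n) atTop (𝓝 (F m n)) := by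
    intro m n hn hNn
    refine tendsto_coeff_of_tendsto_coeff hp hq hα hu hv hβ hcau hSf hQ hQf ?_
    -- The degree is nonzero, so `n` has a prime factor, and that prime lies in the `m`-th block
    -- only. No other hump contributes to this coefficient.
    obtain ⟨r, hr⟩ := exists_prime_dvd_of_wdeg_ne_zero (hNn.trans_ne (hP m).1)
    have hr1 := wdeg_outside_eq_zero_iff.1 hn r hr
    have hzero : ∀ m', m' ≠ m → F m' n = 0 := by
      intro m' hm'
      simp only [hFdef, Finsupp.smul_apply, smul_eq_mul]
      by_contra hne
      have hPm' : n ∈ (P m').support := Finsupp.mem_support_iff.2 (right_ne_zero_of_mul hne)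
      have hr2 := wdeg_outside_eq_zero_iff.1 ((hP m').2.1 n hPm').1 r hr
      rcases lt_or_gt_of_ne hm' with h | h
      · have := hy (Nat.succ_le_of_lt h)
        simp only [Nat.succ_eq_add_one] at this
        omega
      · have := hy (Nat.succ_le_of_lt h)
        simp only [Nat.succ_eq_add_one] at this
        omega
    refine tendsto_const_nhds.congr' ?_
    filter_upwards [eventually_gt_atTop m] with j hj
    rw [hS]
    simp only [Finsupp.finsetSum_apply]
    rw [Finset.sum_eq_single_of_mem m (Finset.mem_range.2 hj) fun m' _ h => hzero m' h]
  -- All differences have support in one finite set, where convergence of coefficients gives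
  -- convergence in norm.
  have hlim : ∀ m, Tendsto (fun j => mixedNorm u v β
      (F m - blockPart (y m) (y (m + 1)) (N m) (Q j))) atTop (𝓝 0) := by
    intro m
    have hfin := isFiniteMeasure_weightMeasure hβ
    set T : Finset ℕ+ := Finset.Iic (Nat.toPNat' (y (m + 1) ^ N m)) with hT
    have hFb : blockPart (y m) (y (m + 1)) (N m) (F m) = F m := by
      ext n
      rw [blockPart_apply]
      split_ifs with h
      · rfl
      · by_contra hne
        apply h
        refine (hP m).2.1 n (Finsupp.mem_support_iff.2 fun h0 => hne ?_)
        simp only [hFdef, Finsupp.smul_apply, h0, smul_zero]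
    have hsub : ∀ j, (F m - blockPart (y m) (y (m + 1)) (N m) (Q j)).support ⊆ T := by
      intro j
      refine Finsupp.support_sub.trans (Finset.union_subset ?_ (support_blockPart_subset _ _ _ _))
      rw [← hFb]
      exact support_blockPart_subset _ _ _ _
    have hle := fun j => mixedNorm_le_coeff (β := β) hu hv _ (hsub j)
    refine tendsto_of_tendsto_of_tendsto_of_le_of_le tendsto_const_nhds ?_ (fun _ => zero_le) hle
    rw [← zero_mul (weightMeasure β Set.univ ^ (1 / v))]
    refine ENNReal.Tendsto.mul_const ?_ (Or.inr
      (ENNReal.rpow_ne_top_of_nonneg (by positivity) (measure_ne_top _ _)))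
    rw [← Finset.sum_const_zero (s := T)]
    refine tendsto_finsetSum _ fun n _ => ?_
    rw [← enorm_zero (E := ℂ)]
    refine Tendsto.enorm ?_
    simp only [Finsupp.sub_apply]
    rw [← hFb]
    simp only [blockPart_apply]
    split_ifs with h
    · rw [← sub_self (F m n)]
      exact (hcoeff m n h.1 h.2).const_sub _
    · simp
  have hbound : ∀ m : ℕ, (2 : ℝ≥0∞) ^ m ≤ ENNReal.ofReal K' * (1 + R) := by
    intro m
    set B : ℝ≥0∞ := ((N m + 1 : ℕ) : ℝ≥0∞) ^ (1 / u) with hB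
    have hB1 : 1 ≤ B := ENNReal.one_le_rpow (by simp) (by positivity)
    have hBt : B ≠ ∞ := ENNReal.rpow_ne_top_of_nonneg (by positivity) (ENNReal.natCast_ne_top _)
    obtain ⟨j, hj1, hj2⟩ := (((hlim m).eventually (gt_mem_nhds one_pos)).and hQR).exists
    have h1 : 2 ^ m * B ≤ mixedNorm u v β (F m) := by
      rw [hFdef]
      simp only
      rw [mixedNorm_smul hu hv, htn]
      calc 2 ^ m * B = ENNReal.ofReal (t ^ m) * (ENNReal.ofReal ((2 / t) ^ m) * B) := by
            rw [← mul_assoc, ← ENNReal.ofReal_mul (by positivity), ← mul_pow,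
              mul_div_cancel₀ _ ht0.ne', ENNReal.ofReal_pow zero_le_two, ENNReal.ofReal_ofNat]
        _ ≤ _ := by gcongr; exact (hP m).2.2.2.2
    have h2 : mixedNorm u v β (F m) ≤ ENNReal.ofReal K' * (1 + R) * B := by
      calc mixedNorm u v β (F m)
          = mixedNorm u v β ((F m - blockPart (y m) (y (m + 1)) (N m) (Q j))
            + blockPart (y m) (y (m + 1)) (N m) (Q j)) := by rw [sub_add_cancel]
        _ ≤ ENNReal.ofReal K' * (1 + B * R) := by
            refine (htri' β _ _).trans ?_
            gcongr
            exact (mixedNorm_blockPart_le hu hv β _ _ _ _).trans (by gcongr)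
        _ ≤ ENNReal.ofReal K' * (B + B * R) := by gcongr
        _ = _ := by ring
    exact (ENNReal.mul_le_mul_iff_left (by positivity) hBt).1 (h1.trans h2)
  have hfinal : ENNReal.ofReal K' * (1 + R) ≠ ∞ := by finiteness
  have htop : Tendsto (fun m : ℕ => (2 : ℝ≥0∞) ^ m) atTop (𝓝 ∞) :=
    ENNReal.tendsto_pow_atTop_nhds_top_iff.2 (by norm_num)
  obtain ⟨m, hm⟩ := (htop.eventually (lt_mem_nhds (lt_top_iff_ne_top.2 hfinal))).exists
  exact absurd (hbound m) (not_le.2 hm)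

/-! ### Lacunary test polynomials -/

theorem sum_setLIntegral_le {Ω : Type*} [MeasurableSpace Ω] {μ : Measure Ω} {S : ℕ → Set Ω}
    (hS : ∀ k, MeasurableSet (S k)) (hd : Pairwise (Function.onFun Disjoint S)) {T : Set Ω}
    (hT : ∀ k, S k ⊆ T) (f : Ω → ℝ≥0∞) (K : ℕ) :
    ∑ k ∈ Finset.range K, ∫⁻ x in S k, f x ∂μ ≤ ∫⁻ x in T, f x ∂μ := by
  rw [← lintegral_biUnion_finset (fun i _ j _ hij => hd hij) fun k _ => hS k]
  exact lintegral_mono_set (Set.iUnion₂_subset fun k _ => hT k)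

theorem pairwise_disjoint_dyadic {a : ℕ → ℝ} (h : ∀ k l, k < l → 2 * a k ≤ a l) :
    Pairwise (Function.onFun Disjoint fun k => Set.Ioc (a k / 2) (a k)) := by
  intro k l hkl
  have key : ∀ k l, k < l → Disjoint (Set.Ioc (a k / 2) (a k)) (Set.Ioc (a l / 2) (a l)) := by
    intro k l hkl
    rw [Set.disjoint_left]
    intro x hx hx'
    linarith [h k l hkl, hx.2, hx'.1]
  rcases lt_or_gt_of_ne hkl with h' | h'
  · exact key k l h'
  · exact (key l k h').symm

theorem two_mul_le_of_lt {L : ℕ → ℝ} (hpos : ∀ k, 0 < L k) (h : ∀ k, 2 * L k ≤ L (k + 1)) :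
    ∀ k l, k < l → 2 * L k ≤ L l := by
  intro k l hkl
  induction l, Nat.succ_le_of_lt hkl using Nat.le_induction with
  | base => exact h k
  | succ l hl ih =>
    have := ih (by omega)
    linarith [h l, hpos l]

/-- Each term is dominated by the part of the Gamma integral `∫ t^(γ-1) e^(-σt) dt` over `(L_k/2,
L_k]`, and lacunarity makes these intervals disjoint. The bound does not depend on the number of
terms. -/
theorem sum_lacunary_le {L : ℕ → ℝ} (hpos : ∀ k, 0 < L k) (hL : ∀ k, 2 * L k ≤ L (k + 1)) {γ : ℝ}
    (hγ : 0 < γ) {σ : ℝ} (hσ : 0 < σ) (K : ℕ) :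
    ∑ k ∈ Finset.range K, L k ^ γ * Real.exp (-(L k * σ))
      ≤ 2 ^ (γ + 1) * Real.Gamma γ * σ ^ (-γ) := by
  have hΓ := Real.Gamma_pos_of_pos hγ
  have h1 : ∀ k, ENNReal.ofReal (L k ^ γ * Real.exp (-(L k * σ)))
      ≤ ENNReal.ofReal (2 ^ (γ + 1)) * ∫⁻ t in Set.Ioc (L k / 2) (L k),
        ENNReal.ofReal (t ^ (γ - 1) * Real.exp (-(σ * t))) := by
    intro k
    have hk := hpos k
    calc ENNReal.ofReal (L k ^ γ * Real.exp (-(L k * σ)))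
        = ENNReal.ofReal (2 ^ (γ + 1)) * ∫⁻ t in Set.Ioc (L k / 2) (L k),
          ENNReal.ofReal ((L k / 2) ^ γ / L k * Real.exp (-(L k * σ))) := by
          rw [setLIntegral_const, Real.volume_Ioc, ← ENNReal.ofReal_mul (by positivity),
            ← ENNReal.ofReal_mul (by positivity)]
          congr 1
          rw [Real.div_rpow hk.le zero_le_two, Real.rpow_add_one two_ne_zero]
          field_simp
          ring
      _ ≤ _ := by
          refine mul_le_mul_right (setLIntegral_mono' measurableSet_Ioc fun t ht => ?_) _
          have ht0 : 0 < t := lt_trans (by positivity) ht.1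
          apply ENNReal.ofReal_le_ofReal
          -- Bounding numerator and denominator of `t ^ γ / t` separately works for either sign of
          -- `γ - 1`.
          have e1 : (L k / 2) ^ γ / L k ≤ t ^ (γ - 1) := by
            rw [Real.rpow_sub_one ht0.ne']
            exact div_le_div₀ (by positivity)
              (Real.rpow_le_rpow (by positivity) ht.1.le hγ.le) ht0 ht.2
          have e2 : Real.exp (-(L k * σ)) ≤ Real.exp (-(σ * t)) := by
            apply Real.exp_le_exp.2
            nlinarith [ht.2]
          gcongr
  have h2 : ENNReal.ofReal (∑ k ∈ Finset.range K, L k ^ γ * Real.exp (-(L k * σ)))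
      ≤ ENNReal.ofReal (2 ^ (γ + 1) * Real.Gamma γ * σ ^ (-γ)) := by
    rw [ENNReal.ofReal_sum_of_nonneg fun k _ => by have := hpos k; positivity]
    refine (Finset.sum_le_sum fun k _ => h1 k).trans ?_
    rw [← Finset.mul_sum]
    refine (mul_le_mul_right (sum_setLIntegral_le (μ := volume)
      (S := fun k => Set.Ioc (L k / 2) (L k)) (fun k => measurableSet_Ioc)
      (pairwise_disjoint_dyadic (two_mul_le_of_lt hpos hL)) (T := Set.Ioi 0)
      (fun k x hx => lt_trans (by have := hpos k; positivity) hx.1) _ K) _).trans_eq ?_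
    rw [lintegral_rpow_mul_exp hγ hσ, ← ENNReal.ofReal_mul (by positivity)]
    congr 1
    rw [Real.rpow_neg hσ.le, one_div, Real.inv_rpow hσ.le]
    ring
  exact (ENNReal.ofReal_le_ofReal_iff (by positivity)).1 h2

theorem sum_rpow_le_sum_rpow {ι : Type*} (s : Finset ι) (x : ι → ℝ≥0∞) {τ : ℝ} (h0 : 0 < τ)
    (h1 : τ ≤ 1) : (∑ i ∈ s, x i) ^ τ ≤ ∑ i ∈ s, x i ^ τ := by
  classical
  induction s using Finset.induction_on with
  | empty => simp [h0]
  | insert a s ha ih =>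
    rw [Finset.sum_insert ha, Finset.sum_insert ha]
    exact (ENNReal.rpow_add_le_add_rpow _ _ h0.le h1).trans (by gcongr)

/-- Write the `q`-th power as a `τ`-th power times a `(q - τ)`-th power. The first is subadditive
over the terms and the second is bounded by the uniform estimate `sum_lacunary_le`. Each term then
contributes `O(1)` at its own scale, giving growth linear in `K`. -/
theorem lintegral_lacunary_rpow_le {α q : ℝ} (hα : -1 < α) (hq : 0 < q) :
    ∃ C : ℝ, 0 < C ∧ ∀ L : ℕ → ℝ, (∀ k, 0 < L k) → (∀ k, 2 * L k ≤ L (k + 1)) → ∀ K : ℕ,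
      ∫⁻ σ, ENNReal.ofReal (∑ k ∈ Finset.range K, L k ^ ((α + 1) / q)
        * Real.exp (-(L k * σ))) ^ q ∂weightMeasure α ≤ ENNReal.ofReal (C * K) := by
  set γ := (α + 1) / q with hγdef
  have hγ : 0 < γ := div_pos (by linarith) hq
  set τ := min 1 q with hτdef
  have hτ0 : 0 < τ := lt_min one_pos hq
  have hτ1 : τ ≤ 1 := min_le_left _ _
  have hτq : τ ≤ q := min_le_right _ _
  have hΓ := Real.Gamma_pos_of_pos hγ
  have hΓ' := Real.Gamma_pos_of_pos (mul_pos hγ hτ0)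
  set D : ℝ := (2 ^ (γ + 1) * Real.Gamma γ) ^ (q - τ) with hD
  have hw := weightConst_pos hα
  refine ⟨D * (weightConst α * ((1 / τ) ^ (γ * τ) * Real.Gamma (γ * τ))), by positivity,
    fun L hpos hL K => ?_⟩
  -- This identity makes the integral of each term scale invariant: the power `L_k ^ (γ τ)` is
  -- cancelled. It is what dictates `γ = (α + 1) / q`.
  have hexp : α + (-γ * (q - τ)) + 1 = γ * τ := by
    have : γ * q = α + 1 := by rw [hγdef]; field_simp
    linear_combination -this
  have h1 : ∀ σ, 0 < σ → ENNReal.ofReal (∑ k ∈ Finset.range K, L k ^ γ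
      * Real.exp (-(L k * σ))) ^ q ≤ ∑ k ∈ Finset.range K, ENNReal.ofReal (D * L k ^ (γ * τ))
        * ENNReal.ofReal (σ ^ (-γ * (q - τ)) * Real.exp (-(τ * L k * σ))) := by
    intro σ hσ
    have hnn : ∀ k, 0 ≤ L k ^ γ * Real.exp (-(L k * σ)) := fun k => by
      have := hpos k; positivity
    have e1 : ENNReal.ofReal (∑ k ∈ Finset.range K, L k ^ γ * Real.exp (-(L k * σ))) ^ (q - τ)
        ≤ ENNReal.ofReal (D * σ ^ (-γ * (q - τ))) := by
      rw [ENNReal.ofReal_rpow_of_nonneg (Finset.sum_nonneg fun k _ => hnn k) (by linarith)]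
      apply ENNReal.ofReal_le_ofReal
      refine (Real.rpow_le_rpow (Finset.sum_nonneg fun k _ => hnn k)
        (sum_lacunary_le hpos hL hγ hσ K) (by linarith)).trans_eq ?_
      rw [Real.mul_rpow (by positivity) (by positivity), ← Real.rpow_mul hσ.le]
    have e2 : ENNReal.ofReal (∑ k ∈ Finset.range K, L k ^ γ * Real.exp (-(L k * σ))) ^ τ
        ≤ ∑ k ∈ Finset.range K, ENNReal.ofReal (L k ^ (γ * τ) * Real.exp (-(τ * L k * σ))) := by
      rw [ENNReal.ofReal_sum_of_nonneg fun k _ => hnn k]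
      refine (sum_rpow_le_sum_rpow _ _ hτ0 hτ1).trans_eq (Finset.sum_congr rfl fun k _ => ?_)
      rw [ENNReal.ofReal_rpow_of_nonneg (hnn k) hτ0.le,
        Real.mul_rpow (by have := hpos k; positivity) (Real.exp_pos _).le,
        ← Real.rpow_mul (hpos k).le, ← Real.exp_mul]
      congr 3
      ring
    calc _ = ENNReal.ofReal (∑ k ∈ Finset.range K, L k ^ γ * Real.exp (-(L k * σ))) ^ τ
          * ENNReal.ofReal (∑ k ∈ Finset.range K, L k ^ γ * Real.exp (-(L k * σ))) ^ (q - τ) := by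
          rw [← ENNReal.rpow_add_of_nonneg _ _ hτ0.le (by linarith)]
          congr 1
          ring
      _ ≤ _ := mul_le_mul' e2 e1
      _ = _ := by
          rw [Finset.sum_mul]
          refine Finset.sum_congr rfl fun k _ => ?_
          have := hpos k
          rw [← ENNReal.ofReal_mul (by positivity), ← ENNReal.ofReal_mul (by positivity)]
          congr 1
          ring
  refine (lintegral_weightMeasure_mono h1).trans ?_
  rw [lintegral_finsetSum _ fun k _ => by fun_prop]
  have h2 : ∀ k, ∫⁻ σ, ENNReal.ofReal (D * L k ^ (γ * τ))
      * ENNReal.ofReal (σ ^ (-γ * (q - τ)) * Real.exp (-(τ * L k * σ))) ∂weightMeasure α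
      ≤ ENNReal.ofReal (D * (weightConst α * ((1 / τ) ^ (γ * τ) * Real.Gamma (γ * τ)))) := by
    intro k
    have hk := hpos k
    rw [lintegral_const_mul' _ _ (by simp), lintegral_weightMeasure_rpow_mul_exp hα
      (by rw [hexp]; positivity) (by positivity), hexp, ← ENNReal.ofReal_mul (by positivity)]
    apply ENNReal.ofReal_le_ofReal
    have h3 : L k ^ (γ * τ) * (1 / (τ * L k + 2)) ^ (γ * τ) ≤ (1 / τ) ^ (γ * τ) := by
      rw [← Real.mul_rpow hk.le (by positivity)]
      refine Real.rpow_le_rpow (by positivity) ?_ (by positivity)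
      rw [mul_one_div, div_le_div_iff₀ (by positivity) hτ0]
      linarith
    calc _ = D * (weightConst α * ((L k ^ (γ * τ) * (1 / (τ * L k + 2)) ^ (γ * τ))
          * Real.Gamma (γ * τ))) := by ring
      _ ≤ _ := by gcongr
  refine (Finset.sum_le_sum fun k _ => h2 k).trans_eq ?_
  rw [Finset.sum_const, Finset.card_range, nsmul_eq_mul, ← ENNReal.ofReal_natCast,
    ← ENNReal.ofReal_mul (by positivity)]
  congr 1
  ring

/-! ### Coefficients at primes and bounds for lacunary prime sums -/

theorem hardyInt_blockPart_le {w : ℝ} (hw : 0 < w) (y Y N : ℕ) (P : DirichletPolynomial) :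
    hardyInt w (blockPart y Y N P) ≤ (N + 1 : ℕ) * hardyInt w P := by
  refine (hardyInt_filter_wdeg_le _ _ N hw).trans ?_
  gcongr
  simpa using hardyInt_filter_wdeg_le P (outside y Y) 0 hw

/-- The block `(r - 1, r]` contains the single prime `r`, so degree one isolates one coefficient.
Its bound then has a constant independent of `r`, unlike the general coefficient estimate. -/
theorem blockPart_prime (P : DirichletPolynomial) (r : Nat.Primes) :
    blockPart ((r : ℕ) - 1) r 1 P = Finsupp.single (r : ℕ+) (P r) := by
  have hr := r.2.pos
  ext n
  rw [blockPart_apply, Finsupp.single_apply]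
  rcases eq_or_ne (r : ℕ+) n with rfl | hn
  · rw [if_pos rfl, if_pos]
    refine ⟨?_, by simp⟩
    rw [wdeg_prime, outside, if_pos (by omega)]
  · rw [if_neg hn, if_neg]
    rintro ⟨h0, h1⟩
    have hle := le_pow_wdeg fun p hp => (wdeg_outside_eq_zero_iff.1 h0 p hp).2
    rw [h1, pow_one] at hle
    obtain ⟨p, hp⟩ := exists_prime_dvd_of_wdeg_ne_zero (n := n) (by rw [h1]; exact one_ne_zero)
    have h2 := wdeg_outside_eq_zero_iff.1 h0 p hp
    have h3 : (r : ℕ) ∣ n := by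
      have : (p : ℕ) = r := by omega
      rwa [this] at hp
    have h4 := Nat.le_of_dvd n.pos h3
    exact hn (PNat.eq (le_antisymm h4 hle))

/-- Coefficients at primes. -/
theorem enorm_coeff_prime_le {w : ℝ} (hw : 0 < w) (P : DirichletPolynomial) (r : Nat.Primes) :
    ‖P r‖ₑ ≤ 2 ^ (1 / w) * hardyNorm w P := by
  have h := hardyInt_blockPart_le hw ((r : ℕ) - 1) r 1 P
  rw [blockPart_prime, hardyInt_single] at h
  have h2 := ENNReal.rpow_le_rpow h (by positivity : 0 ≤ 1 / w)
  rw [ENNReal.mul_rpow_of_nonneg _ _ (by positivity), ← ENNReal.rpow_mul,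
    mul_one_div_cancel hw.ne', ENNReal.rpow_one] at h2
  exact_mod_cast h2

/-- The polynomial `∑ (log π_k)^γ π_k^{-s}`. -/
def lacunary (γ : ℝ) (π : ℕ → Nat.Primes) (K : ℕ) : DirichletPolynomial :=
  ∑ k ∈ Finset.range K, ((Real.log (π k) ^ γ : ℝ) : ℂ) • Finsupp.single (π k : ℕ+) 1

theorem natCast_cpow_neg_eq_exp (r : Nat.Primes) (σ : ℝ) :
    ‖((r : ℕ) : ℂ) ^ (-(σ : ℂ))‖ = Real.exp (-(Real.log r * σ)) := by
  rw [norm_natCast_cpow_of_pos r.2.pos, Real.rpow_def_of_pos (by exact_mod_cast r.2.pos)]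
  congr 1
  simp

theorem lacunary_apply {γ : ℝ} {π : ℕ → Nat.Primes} (hπ : Function.Injective π) {K k : ℕ}
    (hk : k < K) : lacunary γ π K (π k : ℕ+) = ((Real.log (π k) ^ γ : ℝ) : ℂ) := by
  rw [lacunary, Finsupp.finsetSum_apply, Finset.sum_eq_single_of_mem k (Finset.mem_range.2 hk)]
  · simp
  · intro l _ hl
    have : (π l : ℕ+) ≠ (π k : ℕ+) := fun h =>
      hl (hπ (Subtype.ext (congrArg (fun n : ℕ+ => (n : ℕ)) h)))
    rw [Finsupp.smul_apply, Finsupp.single_eq_of_ne' this, smul_zero]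

theorem support_lacunary {γ : ℝ} {π : ℕ → Nat.Primes} {K : ℕ} {n : ℕ+}
    (hn : n ∈ (lacunary γ π K).support) : ∃ k, n = (π k : ℕ+) := by
  by_contra! h
  rw [Finsupp.mem_support_iff, lacunary, Finsupp.finsetSum_apply] at hn
  refine hn (Finset.sum_eq_zero fun k _ => ?_)
  rw [Finsupp.smul_apply, Finsupp.single_eq_of_ne (h k), smul_zero]

/-- A supremum bound over the torus, hence an upper bound for every Hardy norm at once. -/
theorem enorm_bohrLift_lacunary_le (γ : ℝ) (π : ℕ → Nat.Primes) (K : ℕ) (σ : ℝ) (θ : Torus) :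
    ‖bohrLift ((lacunary γ π K).translate σ) θ‖ₑ ≤ ENNReal.ofReal
      (∑ k ∈ Finset.range K, Real.log (π k) ^ γ * Real.exp (-(Real.log (π k) * σ))) := by
  have e : (lacunary γ π K).translate σ = ∑ k ∈ Finset.range K,
      Finsupp.single (π k : ℕ+) (((Real.log (π k) ^ γ : ℝ) : ℂ) * ((π k : ℕ) : ℂ) ^ (-(σ : ℂ))) := by
    ext n
    rw [translate_apply, lacunary, Finsupp.finsetSum_apply, Finsupp.finsetSum_apply,
      Finset.sum_mul]
    refine Finset.sum_congr rfl fun k _ => ?_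
    rw [Finsupp.smul_apply, Finsupp.single_apply, Finsupp.single_apply]
    split_ifs with h
    · rw [← h, smul_eq_mul, mul_one]; rfl
    · simp
  rw [e, bohrLift_sum, ← ofReal_norm]
  apply ENNReal.ofReal_le_ofReal
  refine (norm_sum_le _ _).trans_eq (Finset.sum_congr rfl fun k _ => ?_)
  have : 0 ≤ Real.log (π k) := Real.log_natCast_nonneg _
  rw [bohrLift_single, norm_mul, norm_mul, norm_bohrMonomial, mul_one,
    Complex.norm_of_nonneg (by positivity), natCast_cpow_neg_eq_exp]

theorem norm_eval_lacunary_le (γ : ℝ) (π : ℕ → Nat.Primes) (K : ℕ) {s : ℂ} (hs : 1 / 2 < s.re) :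
    ‖(lacunary γ π K).eval s‖
      ≤ ∑ k ∈ Finset.range K, Real.log (π k) ^ γ * Real.exp (-(Real.log (π k) * (1 / 2))) := by
  rw [lacunary, eval_sum_smul]
  refine (norm_sum_le _ _).trans (Finset.sum_le_sum fun k _ => ?_)
  have h0 : 0 ≤ Real.log (π k) := Real.log_natCast_nonneg _
  have h1 : DirichletPolynomial.eval (Finsupp.single (π k : ℕ+) 1) s = ((π k : ℕ) : ℂ) ^ (-s) := by
    rw [DirichletPolynomial.eval, Finsupp.sum_single_index (by simp), one_mul]; rfl
  have h2 : ((π k : ℕ) : ℝ) ^ (-s).re = Real.exp (Real.log (π k) * (-s).re) :=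
    Real.rpow_def_of_pos (by exact_mod_cast (π k).2.pos) _
  rw [norm_mul, Complex.norm_of_nonneg (by positivity), h1, norm_natCast_cpow_of_pos (π k).2.pos,
    h2]
  gcongr
  simp only [Complex.neg_re]
  nlinarith

/-- For `σ` in `(1/(2L_k), 1/L_k]` with `L_k = log π_k`, the single coefficient at `π_k` already
gives size `L_k^γ`. These intervals are disjoint and have mass at least of order `L_k^(-(β+1))`. -/
theorem mixedNorm_lacunary_ge {u v β : ℝ} (hu : 0 < u) (hv : 0 < v) (hβ : -1 < β) (γ : ℝ) :
    ∃ c : ℝ, 0 < c ∧ ∀ π : ℕ → Nat.Primes, Function.Injective π → (∀ k, 1 ≤ Real.log (π k)) →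
      (∀ k, 2 * Real.log (π k) ≤ Real.log (π (k + 1))) → ∀ K : ℕ,
      ENNReal.ofReal (c * ∑ k ∈ Finset.range K, Real.log (π k) ^ (γ * v - (β + 1)))
        ≤ mixedNorm u v β (lacunary γ π K) ^ v := by
  obtain ⟨c, hc, hμ⟩ := weightMeasure_Ioc_ge hβ
  set d : ℝ := (2 ^ (1 / u))⁻¹ * Real.exp (-1) with hd
  have hd0 : 0 < d := by positivity
  refine ⟨d ^ v * c, by positivity, fun π hπ h1 h2 K => ?_⟩
  set L : ℕ → ℝ := fun k => Real.log (π k) with hL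
  have hpos : ∀ k, 0 < L k := fun k => zero_lt_one.trans_le (h1 k)
  set a : ℕ → ℝ := fun k => 1 / L k with ha
  have hdisj : Pairwise (Function.onFun Disjoint fun k => Set.Ioc (a k / 2) (a k)) := by
    intro k l hkl
    have key : ∀ k l, k < l → Disjoint (Set.Ioc (a k / 2) (a k)) (Set.Ioc (a l / 2) (a l)) := by
      intro k l hkl
      rw [Set.disjoint_left]
      intro x hx hx'
      have h3 := two_mul_le_of_lt hpos h2 k l hkl
      have h4 : a l ≤ a k / 2 := by
        rw [ha]
        simp only
        rw [div_div, mul_comm (L k)]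
        exact one_div_le_one_div_of_le (by have := hpos k; positivity) h3
      linarith [hx.1, hx'.2]
    rcases lt_or_gt_of_ne hkl with h' | h'
    · exact key k l h'
    · exact (key l k h').symm
  rw [mixedNorm_rpow hv, ← setLIntegral_univ]
  refine le_trans ?_ (sum_setLIntegral_le (fun k => measurableSet_Ioc) hdisj
    (fun k => Set.subset_univ _) _ K)
  rw [Finset.mul_sum, ENNReal.ofReal_sum_of_nonneg fun k _ => by have := hpos k; positivity]
  refine Finset.sum_le_sum fun k hk => ?_
  have hk0 := hpos k
  have ha1 : a k ≤ 1 := by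
    rw [ha]; simp only; rw [div_le_one hk0]; exact h1 k
  have ha0 : 0 < a k := by rw [ha]; simp only; positivity
  have hpt : ∀ σ ∈ Set.Ioc (a k / 2) (a k), ENNReal.ofReal (d * L k ^ γ)
      ≤ hardyNorm u ((lacunary γ π K).translate σ) := by
    intro σ hσ
    have h3 := enorm_coeff_prime_le hu ((lacunary γ π K).translate σ) (π k)
    rw [translate_apply, lacunary_apply hπ (Finset.mem_range.1 hk), ← ofReal_norm, norm_mul,
      Complex.norm_of_nonneg (by positivity)] at h3
    have h4 : ‖((((π k : ℕ+)) : ℕ) : ℂ) ^ (-(σ : ℂ))‖ = Real.exp (-(L k * σ)) :=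
      natCast_cpow_neg_eq_exp (π k) σ
    rw [h4] at h3
    have h5 : Real.exp (-1) ≤ Real.exp (-(L k * σ)) := by
      apply Real.exp_le_exp.2
      have : L k * σ ≤ L k * (1 / L k) := by gcongr; exact hσ.2
      rw [mul_one_div_cancel hk0.ne'] at this
      linarith
    have h6 : (2 : ℝ≥0∞) ^ (1 / u) = ENNReal.ofReal (2 ^ (1 / u)) := by
      rw [← ENNReal.ofReal_rpow_of_pos two_pos, ENNReal.ofReal_ofNat]
    rw [h6] at h3
    calc ENNReal.ofReal (d * L k ^ γ)
        ≤ (ENNReal.ofReal (2 ^ (1 / u)))⁻¹ * ENNReal.ofReal (L k ^ γ * Real.exp (-(L k * σ))) := by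
          rw [← ENNReal.ofReal_inv_of_pos (by positivity), ← ENNReal.ofReal_mul (by positivity)]
          apply ENNReal.ofReal_le_ofReal
          rw [hd, mul_assoc, mul_comm (Real.exp (-1))]
          gcongr
      _ ≤ _ := by
          rw [ENNReal.inv_mul_le_iff (by simp; positivity) ENNReal.ofReal_ne_top]
          exact h3
  calc ENNReal.ofReal (d ^ v * c * L k ^ (γ * v - (β + 1)))
      = ENNReal.ofReal (d * L k ^ γ) ^ v * ENNReal.ofReal (c * a k ^ (β + 1)) := by
        rw [ENNReal.ofReal_rpow_of_pos (by positivity), ← ENNReal.ofReal_mul (by positivity)]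
        congr 1
        rw [Real.mul_rpow hd0.le (by positivity), ← Real.rpow_mul hk0.le, ha]
        simp only
        rw [one_div, Real.inv_rpow hk0.le, Real.rpow_sub hk0]
        field_simp
    _ ≤ ENNReal.ofReal (d * L k ^ γ) ^ v * weightMeasure β (Set.Ioc (a k / 2) (a k)) := by
        gcongr
        exact hμ _ ha0 ha1
    _ = ∫⁻ _ in Set.Ioc (a k / 2) (a k), ENNReal.ofReal (d * L k ^ γ) ^ v ∂weightMeasure β := by
        rw [setLIntegral_const]
    _ ≤ _ := setLIntegral_mono' measurableSet_Ioc fun σ hσ =>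
        ENNReal.rpow_le_rpow (hpt σ hσ) hv.le

/-- Each prime is taken beyond the square of its predecessor, which doubles the logarithm. -/
theorem exists_lacunary_primes (B : ℕ) :
    ∃ π : ℕ → Nat.Primes, (StrictMono fun k => (π k : ℕ)) ∧ (∀ k, B < (π k : ℕ)) ∧
      ∀ k, 2 * Real.log (π k) ≤ Real.log (π (k + 1)) := by
  have hex : ∀ n : ℕ, ∃ r : Nat.Primes, n < (r : ℕ) := fun n => by
    obtain ⟨r, hr, hr'⟩ := Nat.exists_infinite_primes (n + 1)
    exact ⟨⟨r, hr'⟩, hr⟩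
  choose next hnext using hex
  obtain ⟨π, hπ0, hπ⟩ : ∃ π : ℕ → Nat.Primes, π 0 = next B ∧ ∀ k, π (k + 1) = next ((π k : ℕ) ^ 2) :=
    ⟨fun k => Nat.rec (next B) (fun _ r => next ((r : ℕ) ^ 2)) k, rfl, fun k => by rfl⟩
  have hstep : ∀ k, (π k : ℕ) ^ 2 < (π (k + 1) : ℕ) := fun k => by rw [hπ]; exact hnext _
  have hmono : StrictMono fun k => (π k : ℕ) := strictMono_nat_of_lt_succ fun k => by
    have h1 := hstep k
    have h2 := (π k).2.one_lt
    change (π k : ℕ) < (π (k + 1) : ℕ)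
    nlinarith
  refine ⟨π, hmono, fun k => ?_, fun k => ?_⟩
  · have h0 : B < (π 0 : ℕ) := by rw [hπ0]; exact hnext B
    have h1 : (π 0 : ℕ) ≤ (π k : ℕ) := hmono.monotone (Nat.zero_le k)
    exact h0.trans_le h1
  · have h0 : (0 : ℝ) < (π k : ℕ) := by exact_mod_cast (π k).2.pos
    rw [← Nat.cast_ofNat, ← Real.log_pow]
    refine Real.log_le_log (by positivity) ?_
    exact_mod_cast (hstep k).le

theorem wdeg_one_lacunary {γ : ℝ} {π : ℕ → Nat.Primes} {K : ℕ} {n : ℕ+}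
    (hn : n ∈ (lacunary γ π K).support) : wdeg (fun _ => 1) n = 1 := by
  obtain ⟨k, rfl⟩ := support_lacunary hn
  rw [wdeg_prime]

theorem exists_natCast_rpow_ge {b : ℝ} (hb : 0 < b) (M : ℝ) : ∃ K : ℕ, 1 ≤ K ∧ M ≤ (K : ℝ) ^ b := by
  have h := (tendsto_rpow_atTop hb).comp tendsto_natCast_atTop_atTop
  obtain ⟨K, h1, h2⟩ := ((h.eventually_ge_atTop M).and (eventually_ge_atTop 1)).exists
  exact ⟨K, h2, h1⟩

/-- Test polynomials of degree one. The source norm is at most of order `K^(1/q)`, and the target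
norm at least of order `(∑ L_k^(γv-(β+1)))^(1/v)`, with `L_k = log π_k`. -/
theorem hasTestPolynomials_of_lacunary {p q α u v β : ℝ} (hp : 0 < p) (hq : 0 < q) (hα : -1 < α)
    (hu : 0 < u) (hv : 0 < v) (hβ : -1 < β)
    (hcond : (β + 1) / v < (α + 1) / q ∨ (α + 1) / q = (β + 1) / v ∧ v < q) :
    HasTestPolynomials p q α u v β := by
  intro y M
  set γ := (α + 1) / q with hγdef
  have hγ : 0 < γ := div_pos (by linarith) hq
  have hΓ := Real.Gamma_pos_of_pos hγ
  obtain ⟨C, hC, hupper⟩ := lintegral_lacunary_rpow_le hα hq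
  obtain ⟨c, hc, hlower⟩ := mixedNorm_lacunary_ge hu hv hβ γ
  set E : ℝ := 2 ^ (γ + 1) * Real.Gamma γ * (1 / 2) ^ (-γ) with hE
  have hE0 : 0 < E := by positivity
  -- One normalization takes care of both the source norm, through `C`, and the values on the
  -- half-plane, through `E`.
  set D : ℝ := C ^ (1 / q) + E with hD
  have hD0 : 0 < D := by positivity
  set M' : ℝ := max M 0 * 2 ^ (1 / u) * D / c ^ (1 / v) with hM'
  have hM'0 : 0 ≤ M' := by positivity
  obtain ⟨π, hmono, hB, hlac, K, hK1, hKM⟩ : ∃ π : ℕ → Nat.Primes,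
      (StrictMono fun k => (π k : ℕ)) ∧ (∀ k, max y 3 ≤ (π k : ℕ) ∧ y < (π k : ℕ)) ∧
      (∀ k, 2 * Real.log (π k) ≤ Real.log (π (k + 1))) ∧ ∃ K : ℕ, 1 ≤ K ∧
      M' * (K : ℝ) ^ (1 / q)
        ≤ (∑ k ∈ Finset.range K, Real.log (π k) ^ (γ * v - (β + 1))) ^ (1 / v) := by
    rcases hcond with hlt | ⟨heq, hvq⟩
    -- The exponent is positive: a single sufficiently large prime is enough.
    · have he : 0 < γ * v - (β + 1) := by
        rw [div_lt_iff₀ hv] at hlt; linarith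
      obtain ⟨K₀, -, hK₀⟩ := exists_natCast_rpow_ge
        (b := (γ * v - (β + 1)) * (1 / v)) (by positivity) M'
      obtain ⟨π, h1, h2, h3⟩ := exists_lacunary_primes (max (max y 3) ⌈Real.exp K₀⌉₊)
      refine ⟨π, h1, fun k => ?_, h3, 1, le_rfl, ?_⟩
      · have := h2 k
        constructor <;> omega
      · have hlog : (K₀ : ℝ) ≤ Real.log (π 0) := by
          have h4 : Real.exp K₀ ≤ (π 0 : ℕ) :=
            (Nat.le_ceil _).trans (by exact_mod_cast ((le_max_right _ _).trans (h2 0).le))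
          exact (Real.le_log_iff_exp_le (by exact_mod_cast (π 0).2.pos)).2 h4
        simp only [Nat.cast_one, Real.one_rpow, mul_one, Finset.sum_range_one]
        rw [← Real.rpow_mul ((Nat.cast_nonneg _).trans hlog)]
        exact hK₀.trans (Real.rpow_le_rpow (Nat.cast_nonneg _) hlog (by positivity))
    -- The exponent vanishes, so the sum equals `K`, and `K^(1/v)` outgrows `K^(1/q)` because `v <
    -- q`.
    · have he : γ * v - (β + 1) = 0 := by
        rw [heq]; field_simp; ring
      obtain ⟨K, hK1, hK⟩ := exists_natCast_rpow_ge (b := 1 / v - 1 / q)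
        (sub_pos.2 (one_div_lt_one_div_of_lt hv hvq)) M'
      obtain ⟨π, h1, h2, h3⟩ := exists_lacunary_primes (max y 3)
      refine ⟨π, h1, fun k => ?_, h3, K, hK1, ?_⟩
      · have := h2 k
        constructor <;> omega
      · have hK0 : (0 : ℝ) < K := by exact_mod_cast hK1
        simp only [he, Real.rpow_zero, Finset.sum_const, Finset.card_range, nsmul_eq_mul, mul_one]
        calc M' * (K : ℝ) ^ (1 / q) ≤ (K : ℝ) ^ (1 / v - 1 / q) * (K : ℝ) ^ (1 / q) := by gcongr
          _ = (K : ℝ) ^ (1 / v) := by rw [← Real.rpow_add hK0]; congr 1; ring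
  have hlog1 : ∀ k, 1 ≤ Real.log (π k) := fun k => by
    rw [Real.le_log_iff_exp_le (by exact_mod_cast (π k).2.pos)]
    have h3 : (3 : ℝ) ≤ (π k : ℕ) := by exact_mod_cast (le_max_right _ _).trans (hB k).1
    exact (Real.exp_one_lt_d9.le.trans (by norm_num)).trans h3
  have hpos : ∀ k, 0 < Real.log (π k) := fun k => zero_lt_one.trans_le (hlog1 k)
  have hinj : Function.Injective π := fun a b hab =>
    hmono.injective (congrArg (fun r : Nat.Primes => (r : ℕ)) hab)
  have hK0 : (0 : ℝ) < K := by exact_mod_cast hK1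
  have hKq : (1 : ℝ) ≤ (K : ℝ) ^ (1 / q) :=
    Real.one_le_rpow (by exact_mod_cast hK1) (by positivity)
  set A : ℝ := (D * (K : ℝ) ^ (1 / q))⁻¹ with hA
  have hA0 : 0 < A := by positivity
  have hAn : ‖(A : ℂ)‖ₑ = ENNReal.ofReal A := by
    rw [← ofReal_norm, Complex.norm_of_nonneg hA0.le]
  refine ⟨1, one_ne_zero, (A : ℂ) • lacunary γ π K, fun n hn => ?_, ?_, fun s hs => ?_, ?_⟩
  · have hn' := Finsupp.support_smul hn
    refine ⟨fun r hr => ?_, wdeg_one_lacunary hn'⟩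
    obtain ⟨k, rfl⟩ := support_lacunary hn'
    have h5 : (r : ℕ) ∣ (π k : ℕ) := hr
    rw [Nat.prime_dvd_prime_iff_eq r.2 (π k).2] at h5
    rw [h5]
    exact (hB k).2
  · have h6 : mixedNorm p q α (lacunary γ π K) ≤ ENNReal.ofReal (D * (K : ℝ) ^ (1 / q)) := by
      refine (mixedNorm_mono_of_hardyNorm_le hq fun σ _ => hardyNorm_le_of_enorm_le hp
        (enorm_bohrLift_lacunary_le γ π K σ)).trans ?_
      refine (ENNReal.rpow_le_rpow (hupper (fun k => Real.log (π k)) hpos hlac K)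
        (by positivity)).trans ?_
      rw [ENNReal.ofReal_rpow_of_pos (by positivity)]
      apply ENNReal.ofReal_le_ofReal
      rw [Real.mul_rpow hC.le hK0.le]
      gcongr
      rw [hD]; linarith
    rw [mixedNorm_smul hp hq, hAn]
    refine (mul_le_mul_right h6 _).trans ?_
    rw [← ENNReal.ofReal_mul hA0.le, hA, inv_mul_cancel₀ (by positivity), ENNReal.ofReal_one]
  · have h7 : DirichletPolynomial.eval ((A : ℂ) • lacunary γ π K) s
        = (A : ℂ) * (lacunary γ π K).eval s := by
      simpa using eval_sum_smul (Finset.range 1) (fun _ => (A : ℂ)) (fun _ => lacunary γ π K) s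
    have h8 := (norm_eval_lacunary_le γ π K hs).trans
      (sum_lacunary_le hpos hlac hγ (by norm_num : (0 : ℝ) < 1 / 2) K)
    rw [h7, norm_mul, Complex.norm_of_nonneg hA0.le, hA, inv_mul_le_iff₀ (by positivity), mul_one]
    refine h8.trans ?_
    have h9 : 0 < C ^ (1 / q) := by positivity
    calc E ≤ D * 1 := by rw [hD]; linarith
      _ ≤ _ := by gcongr
  · have h10 := ENNReal.rpow_le_rpow (hlower π hinj hlog1 hlac K) (by positivity : 0 ≤ 1 / v)
    rw [← ENNReal.rpow_mul, mul_one_div_cancel hv.ne', ENNReal.rpow_one,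
      ENNReal.ofReal_rpow_of_nonneg
        (mul_nonneg hc.le (Finset.sum_nonneg fun k _ => by have := hpos k; positivity))
        (by positivity),
      Real.mul_rpow hc.le (Finset.sum_nonneg fun k _ => by have := hpos k; positivity)] at h10
    rw [mixedNorm_smul hu hv, hAn]
    refine le_trans ?_ (mul_le_mul_right h10 _)
    have h11 : ((1 + 1 : ℕ) : ℝ≥0∞) ^ (1 / u) = ENNReal.ofReal (2 ^ (1 / u)) := by
      rw [← ENNReal.ofReal_rpow_of_pos two_pos, ENNReal.ofReal_ofNat]; norm_num
    rw [h11, ← ENNReal.ofReal_mul' (by positivity), ← ENNReal.ofReal_mul hA0.le]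
    apply ENNReal.ofReal_le_ofReal
    calc M * 2 ^ (1 / u) ≤ max M 0 * 2 ^ (1 / u) := by gcongr; exact le_max_left _ _
      _ = A * (c ^ (1 / v) * (M' * (K : ℝ) ^ (1 / q))) := by
          rw [hA, hM']; field_simp
      _ ≤ _ := by gcongr

/-! ### Products of independent factors -/

/-- The mean `∫ |1 + z|^w` over the unit circle. -/
def circleMean (w : ℝ) : ℝ :=
  ∫ x : UnitAddCircle, ‖(AddCircle.toCircle x : ℂ) + 1‖ ^ w ∂AddCircle.haarAddCircle

theorem integrable_norm_toCircle_add_one_rpow {w : ℝ} (hw : 0 < w) :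
    Integrable (fun x : UnitAddCircle => ‖(AddCircle.toCircle x : ℂ) + 1‖ ^ w)
      AddCircle.haarAddCircle :=
  (Continuous.rpow_const (by fun_prop) fun _ => Or.inr hw.le).integrable_of_hasCompactSupport
    (HasCompactSupport.of_compactSpace _)

theorem lintegral_enorm_toCircle_add_one {w : ℝ} (hw : 0 < w) :
    ∫⁻ x : UnitAddCircle, ‖(AddCircle.toCircle x : ℂ) + 1‖ₑ ^ w ∂AddCircle.haarAddCircle
      = ENNReal.ofReal (circleMean w) := by
  simp_rw [enorm_rpow_eq_ofReal _ hw.le]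
  rw [circleMean, ofReal_integral_eq_lintegral_ofReal (integrable_norm_toCircle_add_one_rpow hw)
    (Filter.Eventually.of_forall fun x => by positivity)]

theorem one_le_circleMean {w : ℝ} (hw : 0 < w) : 1 ≤ circleMean w := by
  have h := rpow_norm_le_circleAverage (g := fun z => z + 1) hw
    (analyticOnNhd_id.add analyticOnNhd_const)
  rw [circleAverage_eq_integral_haarAddCircle] at h
  simpa [circleMean] using h

/-- Strict Jensen inequality for `t ↦ t ^ (u/p)`: equality would force `|1 + z|` to be constant on
the circle, but it is `2` at `1` and `0` at `-1`. -/
theorem circleMean_rpow_lt {p u : ℝ} (hp : 0 < p) (hpu : p < u) :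
    circleMean p ^ (1 / p) < circleMean u ^ (1 / u) := by
  have hu : 0 < u := hp.trans hpu
  have hpow : ∀ x : UnitAddCircle, (‖(AddCircle.toCircle x : ℂ) + 1‖ ^ p) ^ (u / p)
      = ‖(AddCircle.toCircle x : ℂ) + 1‖ ^ u := by
    intro x
    rw [← Real.rpow_mul (norm_nonneg _), mul_div_cancel₀ _ hp.ne']
  have h := (strictConvexOn_rpow ((one_lt_div hp).2 hpu)).ae_eq_const_or_map_average_lt
    (μ := AddCircle.haarAddCircle)
    (f := fun x : UnitAddCircle => ‖(AddCircle.toCircle x : ℂ) + 1‖ ^ p)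
    (continuousOn_id.rpow_const fun _ _ => Or.inr (by positivity)) isClosed_Ici
    (Filter.Eventually.of_forall fun x => Set.mem_Ici.2 (by positivity))
    (integrable_norm_toCircle_add_one_rpow hp)
    ((integrable_norm_toCircle_add_one_rpow hu).congr
      (Filter.Eventually.of_forall fun x => (hpow x).symm))
  rw [average_eq_integral] at h
  simp only [average_eq_integral, hpow] at h
  rcases h with h | h
  · exfalso
    have hcont : Continuous fun x : UnitAddCircle => ‖(AddCircle.toCircle x : ℂ) + 1‖ ^ p :=
      Continuous.rpow_const (by fun_prop) fun _ => Or.inr hp.le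
    have heq := (Continuous.ae_eq_iff_eq AddCircle.haarAddCircle hcont continuous_const).1 h
    have e0 := congrFun heq 0
    have e1 := congrFun heq ((1 / 2 : ℝ) : UnitAddCircle)
    rw [← e0] at e1
    have h1 : (AddCircle.toCircle ((1 / 2 : ℝ) : UnitAddCircle) : ℂ) = -1 := by
      rw [AddCircle.toCircle_apply_mk, Circle.coe_exp, ← Complex.exp_pi_mul_I]
      congr 1
      push_cast
      ring
    simp only [h1, AddCircle.toCircle_zero, Circle.coe_one, neg_add_cancel, norm_zero,
      Real.zero_rpow hp.ne'] at e1
    have : (0 : ℝ) < ‖(1 : ℂ) + 1‖ ^ p := Real.rpow_pos_of_pos (by norm_num) _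
    exact this.ne e1
  · have hA : 0 < circleMean p := zero_lt_one.trans_le (one_le_circleMean hp)
    have h2 : circleMean p ^ (u / p) < circleMean u := h
    calc circleMean p ^ (1 / p) = (circleMean p ^ (u / p)) ^ (1 / u) := by
          rw [← Real.rpow_mul hA.le]; congr 1; field_simp
      _ < _ := Real.rpow_lt_rpow (by positivity) h2 (by positivity)

/-- Multiplication by `n^{-s}`. -/
def shift (n : ℕ+) (P : DirichletPolynomial) : DirichletPolynomial := P.mapDomain fun m => n * m

theorem bohrMonomial_mul (m n : ℕ+) (θ : Torus) :
    bohrMonomial (m * n) θ = bohrMonomial m θ * bohrMonomial n θ := mon_mul _ m n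

theorem bohrMonomial_prime (r : Nat.Primes) (θ : Torus) :
    bohrMonomial (r : ℕ+) θ = torusCoord θ r := mon_prime _ r

theorem bohrLift_shift (n : ℕ+) (P : DirichletPolynomial) (θ : Torus) :
    bohrLift (shift n P) θ = bohrMonomial n θ * bohrLift P θ := by
  unfold bohrLift shift
  rw [Finsupp.sum_mapDomain_index (by simp) (by intros; ring), Finsupp.mul_sum]
  refine Finsupp.sum_congr fun m _ => ?_
  rw [bohrMonomial_mul]
  ring

theorem eval_add (P Q : DirichletPolynomial) (s : ℂ) :
    DirichletPolynomial.eval (P + Q) s = P.eval s + Q.eval s :=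
  Finsupp.sum_add_index' (by simp) (by intros; ring)

theorem eval_shift (n : ℕ+) (P : DirichletPolynomial) (s : ℂ) :
    (shift n P).eval s = ((n : ℕ) : ℂ) ^ (-s) * P.eval s := by
  unfold DirichletPolynomial.eval shift
  rw [Finsupp.sum_mapDomain_index (by simp) (by intros; ring), Finsupp.mul_sum]
  refine Finsupp.sum_congr fun m _ => ?_
  rw [PNat.mul_coe, Nat.cast_mul, natCast_mul_natCast_cpow]
  ring

/-- The polynomial `∏ (π_0^{-s} + π_j^{-s})`, the product over `1 ≤ j ≤ N`. -/
def pairProduct (π : ℕ → Nat.Primes) : ℕ → DirichletPolynomial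
  | 0 => Finsupp.single 1 1
  | N + 1 => shift (π 0) (pairProduct π N) + shift (π (N + 1)) (pairProduct π N)

theorem bohrLift_pairProduct (π : ℕ → Nat.Primes) (N : ℕ) (θ : Torus) :
    bohrLift (pairProduct π N) θ
      = ∏ j ∈ Finset.range N, (torusCoord θ (π 0) + torusCoord θ (π (j + 1))) := by
  induction N with
  | zero => simp [pairProduct, bohrLift_single, bohrMonomial_eq_mon]
  | succ N ih =>
    rw [pairProduct, bohrLift_add, bohrLift_shift, bohrLift_shift, bohrMonomial_prime,
      bohrMonomial_prime, ih, Finset.prod_range_succ]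
    ring

/-- For `π_k ≥ 4` and `Re s > 1/2` each summand has modulus at most `1/2`, so each factor has
modulus at most `1`. -/
theorem norm_eval_pairProduct_le (π : ℕ → Nat.Primes) (N : ℕ) (hπ : ∀ k, 4 ≤ (π k : ℕ)) {s : ℂ}
    (hs : 1 / 2 < s.re) : ‖(pairProduct π N).eval s‖ ≤ 1 := by
  have hr : ∀ k, ‖((π k : ℕ) : ℂ) ^ (-s)‖ ≤ 1 / 2 := by
    intro k
    have h4 : (4 : ℝ) ≤ (π k : ℕ) := by exact_mod_cast hπ k
    rw [norm_natCast_cpow_of_pos (π k).2.pos, Complex.neg_re]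
    calc ((π k : ℕ) : ℝ) ^ (-s.re) ≤ ((π k : ℕ) : ℝ) ^ (-(1 / 2) : ℝ) :=
          Real.rpow_le_rpow_of_exponent_le (by linarith) (by linarith)
      _ ≤ (4 : ℝ) ^ (-(1 / 2) : ℝ) :=
          Real.rpow_le_rpow_of_nonpos (by norm_num) h4 (by norm_num)
      _ = 1 / 2 := by
          rw [show (4 : ℝ) = 2 ^ (2 : ℝ) by norm_num, ← Real.rpow_mul zero_le_two]
          norm_num
  induction N with
  | zero =>
    have : (pairProduct π 0).eval s = 1 := by
      rw [pairProduct, DirichletPolynomial.eval, Finsupp.sum_single_index (by simp)]; simp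
    rw [this, norm_one]
  | succ N ih =>
    rw [pairProduct, eval_add, eval_shift, eval_shift, ← add_mul, norm_mul]
    have h : ‖((π 0 : ℕ) : ℂ) ^ (-s) + ((π (N + 1) : ℕ) : ℂ) ^ (-s)‖ ≤ 1 :=
      (norm_add_le _ _).trans (by linarith [hr 0, hr (N + 1)])
    exact mul_le_one₀ h (norm_nonneg _) ih

theorem support_pairProduct {π : ℕ → Nat.Primes} {N : ℕ} {n : ℕ+}
    (hn : n ∈ (pairProduct π N).support) :
    wdeg (fun _ => 1) n = N ∧ ∀ r : Nat.Primes, (r : ℕ) ∣ n → ∃ j ≤ N, r = π j := by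
  classical
  induction N generalizing n with
  | zero =>
    have : n = 1 := by
      have := Finsupp.support_single_subset hn
      simpa using this
    subst this
    refine ⟨by simp, fun r hr => ?_⟩
    exact absurd (Nat.dvd_one.1 (by simpa using hr)) r.2.ne_one
  | succ N ih =>
    have key : ∀ j ≤ N + 1, n ∈ (shift (π j) (pairProduct π N)).support →
        wdeg (fun _ => 1) n = N + 1 ∧ ∀ r : Nat.Primes, (r : ℕ) ∣ n → ∃ j ≤ N + 1, r = π j := by
      intro j hj h
      obtain ⟨m, hm, rfl⟩ := Finset.mem_image.1 (Finsupp.mapDomain_support h)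
      obtain ⟨h1, h2⟩ := ih hm
      refine ⟨by rw [wdeg_mul, wdeg_prime, h1, add_comm], fun r hr => ?_⟩
      rw [PNat.mul_coe] at hr
      rcases r.2.dvd_mul.1 hr with hr | hr
      · have hr' : (r : ℕ) ∣ (π j : ℕ) := hr
        rw [Nat.prime_dvd_prime_iff_eq r.2 (π j).2] at hr'
        exact ⟨j, hj, Subtype.ext hr'⟩
      · obtain ⟨i, hi, hi'⟩ := h2 r hr
        exact ⟨i, hi.trans (Nat.le_succ _), hi'⟩
    rw [pairProduct] at hn
    rcases Finset.mem_union.1 (Finsupp.support_add hn) with h | h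
    · exact key 0 (Nat.zero_le _) h
    · exact key (N + 1) le_rfl h

/-- The coordinate at `π_{N+1}` occurs in the last factor only. Integrating it out gives the mean of
`|1 + z|^w` whatever the coordinate at `π_0`, by rotation invariance. Sharing `π_0` thus keeps the
factors independent in modulus while making the product homogeneous. -/
theorem hardyInt_pairProduct {π : ℕ → Nat.Primes} (hπ : Function.Injective π) {w : ℝ} (hw : 0 < w)
    (N : ℕ) : hardyInt w (pairProduct π N) = ENNReal.ofReal (circleMean w) ^ N := by
  classical
  induction N with
  | zero => rw [pairProduct, hardyInt_single]; simp
  | succ N ih =>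
    set r := π (N + 1) with hr
    set δ : UnitAddCircle → Torus := fun x => Pi.single r x with hδ
    have hδm : Measurable δ := by
      refine measurable_pi_lambda _ fun p => ?_
      rcases eq_or_ne p r with rfl | hp
      · simpa [hδ] using measurable_id'
      · simp [hδ, hp]
    have hδr : ∀ x θ, torusCoord (θ + δ x) r = torusCoord θ r * AddCircle.toCircle x := by
      intro x θ
      rw [torusCoord_add]
      simp [torusCoord, hδ]
    have hδp : ∀ x θ (p : Nat.Primes), p ≠ r → torusCoord (θ + δ x) p = torusCoord θ p := by
      intro x θ p hp
      rw [torusCoord_add]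
      simp [torusCoord, hδ, hp]
    have h0 : π 0 ≠ r := fun h => by simpa using hπ h
    have hshift : ∀ x θ, bohrLift (pairProduct π (N + 1)) (θ + δ x)
        = (torusCoord θ (π 0) + torusCoord θ r * AddCircle.toCircle x)
          * bohrLift (pairProduct π N) θ := by
      intro x θ
      rw [bohrLift_pairProduct, bohrLift_pairProduct, Finset.prod_range_succ, ← hr, hδr,
        hδp x θ _ h0, mul_comm]
      congr 1
      refine Finset.prod_congr rfl fun j hj => ?_
      have hj' := Finset.mem_range.1 hj
      rw [hδp x θ _ fun h => by have := hπ h; omega]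
    have hinner : ∀ θ : Torus, ∫⁻ x : UnitAddCircle, ‖torusCoord θ (π 0)
        + torusCoord θ r * AddCircle.toCircle x‖ₑ ^ w ∂AddCircle.haarAddCircle
        = ENNReal.ofReal (circleMean w) := by
      intro θ
      rw [← lintegral_enorm_toCircle_add_one hw,
        ← lintegral_add_left_eq_self (fun x : UnitAddCircle =>
          ‖(AddCircle.toCircle x : ℂ) + 1‖ₑ ^ w) (θ r - θ (π 0))]
      refine lintegral_congr fun x => ?_
      congr 1
      have e : torusCoord θ (π 0) + torusCoord θ r * AddCircle.toCircle x
          = torusCoord θ (π 0) * ((AddCircle.toCircle (θ r - θ (π 0) + x) : ℂ) + 1) := by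
        have h1 : torusCoord θ (π 0) * (AddCircle.toCircle (θ r - θ (π 0) + x) : ℂ)
            = torusCoord θ r * AddCircle.toCircle x := by
          unfold torusCoord
          rw [← Circle.coe_mul, ← AddCircle.toCircle_add, ← Circle.coe_mul,
            ← AddCircle.toCircle_add]
          congr 2
          abel
        rw [mul_add, h1]
        ring
      rw [e, enorm_mul, ← ofReal_norm (torusCoord θ (π 0)), norm_torusCoord]
      simp
    rw [hardyInt, ← lintegral_torus_average hδm (measurable_enorm_bohrLift_rpow _ w)]
    calc _ = ∫⁻ θ, ENNReal.ofReal (circleMean w) * ‖bohrLift (pairProduct π N) θ‖ₑ ^ w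
          ∂torusMeasure := by
          refine lintegral_congr fun θ => ?_
          rw [← hinner θ, ← lintegral_mul_const']
          · refine lintegral_congr fun x => ?_
            rw [hshift, enorm_mul, ENNReal.mul_rpow_of_nonneg _ _ hw.le]
          · finiteness
      _ = _ := by
          rw [lintegral_const_mul' _ _ (by simp), pow_succ']
          congr 1

theorem hardyNorm_pairProduct {π : ℕ → Nat.Primes} (hπ : Function.Injective π) {w : ℝ} (hw : 0 < w)
    (N : ℕ) :
    hardyNorm w (pairProduct π N) = ENNReal.ofReal ((circleMean w ^ (1 / w)) ^ N) := by
  have h := zero_lt_one.trans_le (one_le_circleMean hw)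
  rw [hardyNorm_eq, hardyInt_pairProduct hπ hw, ← ENNReal.ofReal_pow h.le,
    ENNReal.ofReal_rpow_of_pos (by positivity), ← Real.rpow_natCast, ← Real.rpow_natCast,
    ← Real.rpow_mul h.le, ← Real.rpow_mul h.le, mul_comm]

/-! ### Translates of homogeneous products and the case `p < u` -/

theorem mon_congr {c d : Nat.Primes → ℂ} {n : ℕ+} (h : ∀ r : Nat.Primes, (r : ℕ) ∣ n → c r = d r) :
    mon c n = mon d n :=
  Finset.prod_congr rfl fun r hr => by rw [h r (mem_primeSet.1 hr)]

/-- Homogeneous polynomials lose at most the factor `Y^{-Nσ}` under translation. -/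
theorem hardyNorm_translate_ge {P : DirichletPolynomial} {N Y : ℕ} {w : ℝ} (hw : 0 < w)
    (hP : ∀ n ∈ P.support, wdeg (fun _ => 1) n = N ∧ ∀ r : Nat.Primes, (r : ℕ) ∣ n → (r : ℕ) < Y)
    {σ : ℝ} (hσ : 0 < σ) :
    ENNReal.ofReal ((((Y : ℝ) ^ (-σ)) ^ N)) * hardyNorm w P ≤ hardyNorm w (P.translate σ) := by
  -- Dilating `P_σ` further by `(r/Y)^σ` makes all coordinate factors equal to `Y^(-σ)`, so
  -- homogeneity gives `Y^(-Nσ) P`, and dilations contract. The value `0` at absent primes keeps all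
  -- factors in `[0, 1)`.
  set ρ : Nat.Primes → ℝ := fun r => if (r : ℕ) < Y then ((r : ℕ) / Y : ℝ) ^ σ else 0 with hρ
  have h0 : ∀ r, 0 ≤ ρ r := fun r => by rw [hρ]; positivity
  have h1 : ∀ r, ρ r < 1 := fun r => by
    rw [hρ]
    simp only
    split_ifs with h
    · have hY : (0 : ℝ) < Y := by exact_mod_cast (Nat.zero_le _).trans_lt h
      refine Real.rpow_lt_one (by positivity) ?_ hσ
      rw [div_lt_one hY]
      exact_mod_cast h
    · exact one_pos
  have e : dilate (fun r => (ρ r : ℂ)) (P.translate σ)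
      = ((((Y : ℝ) ^ (-σ)) ^ N : ℝ) : ℂ) • P := by
    ext n
    rw [translate_eq_dilate, dilate_dilate, dilate_apply, Finsupp.smul_apply, smul_eq_mul, mul_comm]
    rcases eq_or_ne (P n) 0 with hn | hn
    · simp [hn]
    congr 1
    obtain ⟨hN, hr⟩ := hP n (Finsupp.mem_support_iff.2 hn)
    rw [Complex.ofReal_pow, ← hN, ← mon_pow_wdeg]
    refine mon_congr fun r hrn => ?_
    have hrY := hr r hrn
    have hY : (0 : ℝ) < Y := by exact_mod_cast (Nat.zero_le _).trans_lt hrY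
    have hr0 : (0 : ℝ) < (r : ℕ) := by exact_mod_cast r.2.pos
    rw [natCast_cpow_neg_ofReal, ← Complex.ofReal_mul, pow_one]
    congr 1
    simp only [hρ, if_pos hrY]
    rw [Real.div_rpow hr0.le hY.le, Real.rpow_neg hr0.le, Real.rpow_neg hY.le]
    field_simp
  have h := hardyNorm_dilate_le (P.translate σ) h0 h1 hw
  rw [e, hardyNorm_smul hw, ← ofReal_norm, Complex.norm_of_nonneg (by positivity)] at h
  exact h

/-- Bertrand's postulate at each step. Geometric growth keeps the logarithm of the largest of `N +
1` primes linear in `N`, with constants depending on `π_0`. -/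
theorem exists_primes_growth (B : ℕ) :
    ∃ π : ℕ → Nat.Primes, (StrictMono fun k => (π k : ℕ)) ∧ (∀ k, B < (π k : ℕ)) ∧
      ∀ k, (π k : ℕ) ≤ (π 0 : ℕ) * 2 ^ k := by
  have hex : ∀ r : Nat.Primes, ∃ s : Nat.Primes, (r : ℕ) < s ∧ (s : ℕ) ≤ 2 * r := fun r => by
    obtain ⟨s, hs, h1, h2⟩ := Nat.exists_prime_lt_and_le_two_mul r r.2.ne_zero
    exact ⟨⟨s, hs⟩, h1, h2⟩
  choose next h1 h2 using hex
  obtain ⟨r, hr, hr'⟩ := Nat.exists_infinite_primes (B + 1)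
  obtain ⟨π, hπ0, hπ⟩ : ∃ π : ℕ → Nat.Primes, π 0 = ⟨r, hr'⟩ ∧ ∀ k, π (k + 1) = next (π k) :=
    ⟨fun k => Nat.rec ⟨r, hr'⟩ (fun _ s => next s) k, rfl, fun k => by rfl⟩
  have hmono : StrictMono fun k => (π k : ℕ) := strictMono_nat_of_lt_succ fun k => by
    rw [hπ]; exact h1 _
  refine ⟨π, hmono, fun k => ?_, fun k => ?_⟩
  · have h3 : (π 0 : ℕ) ≤ π k := hmono.monotone (Nat.zero_le k)
    have h4 : (π 0 : ℕ) = r := by rw [hπ0]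
    omega
  · induction k with
    | zero => simp
    | succ k ih =>
      rw [hπ, pow_succ]
      calc (next (π k) : ℕ) ≤ 2 * π k := h2 _
        _ ≤ 2 * (π 0 * 2 ^ k) := Nat.mul_le_mul_left _ ih
        _ = π 0 * (2 ^ k * 2) := by ring

theorem translate_zero (P : DirichletPolynomial) : P.translate 0 = P := by
  ext n
  rw [translate_apply]
  simp

theorem exists_pow_ge_rpow {ρ : ℝ} (hρ : 1 < ρ) (M e : ℝ) (hM : 0 ≤ M) :
    ∃ N : ℕ, N ≠ 0 ∧ M * ((N + 1 : ℕ) : ℝ) ^ e ≤ ρ ^ N := by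
  set k := ⌈e⌉₊
  have h := (tendsto_pow_const_div_const_pow_of_one_lt k hρ).comp (tendsto_add_atTop_nat 1)
  have h2 : Tendsto (fun n : ℕ => M * ρ * (((n + 1 : ℕ) : ℝ) ^ k / ρ ^ (n + 1))) atTop (𝓝 0) := by
    rw [← mul_zero (M * ρ)]
    exact h.const_mul _
  obtain ⟨N, hN1, hN2⟩ := ((h2.eventually (gt_mem_nhds one_pos)).and (eventually_ne_atTop 0)).exists
  refine ⟨N, hN2, ?_⟩
  have hρ0 : 0 < ρ := by linarith
  have hle : ((N + 1 : ℕ) : ℝ) ^ e ≤ ((N + 1 : ℕ) : ℝ) ^ k := by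
    rw [← Real.rpow_natCast]
    exact Real.rpow_le_rpow_of_exponent_le (by push_cast; linarith [(Nat.cast_nonneg N : (0 : ℝ) ≤ N)])
      (Nat.le_ceil e)
  refine (mul_le_mul_of_nonneg_left hle hM).trans ?_
  rw [pow_succ, ← div_div, mul_div_assoc'] at hN1
  have h3 : M * ((N + 1 : ℕ) : ℝ) ^ k / ρ ^ N < 1 := by
    calc _ = M * ρ * (((N + 1 : ℕ) : ℝ) ^ k / ρ ^ N) / ρ := by field_simp
      _ < 1 := hN1
  exact ((div_lt_one (by positivity)).1 h3).le

/-- The source norm is at most of order `a^N`, since translation only decreases Hardy norms. The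
target norm is at least of order `b^N` up to a power of `N`, with `a < b`. -/
theorem hasTestPolynomials_of_lt {p q α u v β : ℝ} (hp : 0 < p) (hq : 0 < q) (hα : -1 < α)
    (hu : 0 < u) (hv : 0 < v) (hβ : -1 < β) (hpu : p < u) :
    HasTestPolynomials p q α u v β := by
  intro y M
  obtain ⟨π, hmono, hB, hgrow⟩ := exists_primes_growth (max y 3)
  have hinj : Function.Injective π := fun a b hab =>
    hmono.injective (congrArg (fun r : Nat.Primes => (r : ℕ)) hab)
  obtain ⟨c, hc, hμ⟩ := weightMeasure_Ioc_ge hβ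
  have hfin := isFiniteMeasure_weightMeasure hα
  set a := circleMean p ^ (1 / p) with ha
  set b := circleMean u ^ (1 / u) with hb
  have ha1 : 1 ≤ a := Real.one_le_rpow (one_le_circleMean hp) (by positivity)
  have hb1 : 1 ≤ b := Real.one_le_rpow (one_le_circleMean hu) (by positivity)
  have hab : a < b := circleMean_rpow_lt hp hpu
  set m : ℝ := (weightMeasure α Set.univ ^ (1 / q)).toReal + 1 with hm
  have hm1 : 1 ≤ m := by rw [hm]; linarith [ENNReal.toReal_nonneg (a := weightMeasure α Set.univ ^ (1 / q))]
  have hmle : weightMeasure α Set.univ ^ (1 / q) ≤ ENNReal.ofReal m := by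
    rw [ENNReal.le_ofReal_iff_toReal_le
      (ENNReal.rpow_ne_top_of_nonneg (by positivity) (measure_ne_top _ _)) (by linarith), hm]
    linarith
  have hπ0 : (1 : ℝ) < (π 0 : ℕ) := by exact_mod_cast (π 0).2.one_lt
  set ℓ : ℝ := Real.log (π 0) + 1 with hℓ
  have hℓ1 : 1 ≤ ℓ := by rw [hℓ]; linarith [Real.log_pos hπ0]
  set G : ℝ := m * ℓ ^ ((β + 1) / v) / (Real.exp (-1) * c ^ (1 / v)) with hG
  -- The exponent collects the polynomial losses: `1/u` from the block projection and `2(β+1)/v`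
  -- from the mass at scale `1 / (N log Y)`, where `N log Y = O(N²)`.
  obtain ⟨N, hN0, hN⟩ := exists_pow_ge_rpow ((one_lt_div (by linarith)).2 hab) (max M 0 * G)
    (1 / u + 2 * ((β + 1) / v)) (by positivity)
  set P := pairProduct π N with hP
  set Y : ℕ := (π 0 : ℕ) * 2 ^ (N + 1) with hY
  have hsupp : ∀ n ∈ P.support, wdeg (fun _ => 1) n = N ∧
      ∀ r : Nat.Primes, (r : ℕ) ∣ n → (r : ℕ) < Y := by
    intro n hn
    obtain ⟨h1, h2⟩ := support_pairProduct hn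
    refine ⟨h1, fun r hr => ?_⟩
    obtain ⟨j, hj, rfl⟩ := h2 r hr
    calc (π j : ℕ) ≤ (π 0 : ℕ) * 2 ^ j := hgrow j
      _ < Y := by
        rw [hY]
        exact Nat.mul_lt_mul_of_pos_left (Nat.pow_lt_pow_right one_lt_two (by omega)) (π 0).2.pos
  have hY3 : (3 : ℝ) ≤ Y := by
    have h1 : 3 < (π 0 : ℕ) := (le_max_right _ _).trans_lt (hB 0)
    have h2 : (π 0 : ℕ) ≤ Y := Nat.le_mul_of_pos_right _ (by positivity)
    exact_mod_cast h1.le.trans h2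
  have hlogY1 : 1 ≤ Real.log Y := by
    rw [Real.le_log_iff_exp_le (by linarith)]
    exact (Real.exp_one_lt_d9.le.trans (by norm_num)).trans hY3
  have hNpos : (1 : ℝ) ≤ N := by exact_mod_cast Nat.one_le_iff_ne_zero.2 hN0
  have hNlog : N * Real.log Y ≤ ((N + 1 : ℕ) : ℝ) ^ (2 : ℝ) * ℓ := by
    have h1 : Real.log Y ≤ (N + 1) * ℓ := by
      rw [hY, Nat.cast_mul, Real.log_mul (by positivity) (by positivity), Nat.cast_pow,
        Real.log_pow, hℓ]
      have h2 : Real.log (2 : ℕ) ≤ 1 := by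
        have := Real.log_two_lt_d9
        push_cast
        linarith
      have h3 := Real.log_pos hπ0
      push_cast
      push_cast at h2
      nlinarith
    rw [Real.rpow_two]
    push_cast
    nlinarith
  -- At this scale `Y^(-Nσ) ≥ e^(-1)` for `σ ≤ τ`, so translation costs only a constant factor.
  set τ : ℝ := 1 / (N * Real.log Y) with hτ
  have hNl1 : 1 ≤ N * Real.log Y := by nlinarith
  have hτ0 : 0 < τ := by positivity
  have hτ1 : τ ≤ 1 := by rw [hτ, div_le_one (by linarith)]; exact hNl1
  have hlow : ENNReal.ofReal (Real.exp (-1) * b ^ N * (c * τ ^ (β + 1)) ^ (1 / v))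
      ≤ mixedNorm u v β P := by
    have h1 : ∀ σ ∈ Set.Ioc (τ / 2) τ, ENNReal.ofReal (Real.exp (-1) * b ^ N)
        ≤ hardyNorm u (P.translate σ) := by
      intro σ hσ
      have hσ0 : 0 < σ := lt_trans (by positivity) hσ.1
      refine le_trans ?_ (hardyNorm_translate_ge hu hsupp hσ0)
      rw [hP, hardyNorm_pairProduct hinj hu, ← ENNReal.ofReal_mul (by positivity)]
      apply ENNReal.ofReal_le_ofReal
      gcongr
      rw [Real.rpow_def_of_pos (by linarith), ← Real.exp_nat_mul]
      apply Real.exp_le_exp.2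
      have : N * Real.log Y * σ ≤ N * Real.log Y * τ := by gcongr; exact hσ.2
      rw [hτ, mul_one_div_cancel (by linarith)] at this
      linarith
    calc ENNReal.ofReal (Real.exp (-1) * b ^ N * (c * τ ^ (β + 1)) ^ (1 / v))
        = ENNReal.ofReal (Real.exp (-1) * b ^ N) * ENNReal.ofReal (c * τ ^ (β + 1)) ^ (1 / v) := by
          rw [ENNReal.ofReal_mul (by positivity), ENNReal.ofReal_rpow_of_pos (by positivity)]
      _ ≤ ENNReal.ofReal (Real.exp (-1) * b ^ N)
          * weightMeasure β (Set.Ioc (τ / 2) τ) ^ (1 / v) := by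
          gcongr
          exact hμ τ hτ0 hτ1
      _ = (∫⁻ _ in Set.Ioc (τ / 2) τ, ENNReal.ofReal (Real.exp (-1) * b ^ N) ^ v
          ∂weightMeasure β) ^ (1 / v) := by
          rw [setLIntegral_const, ENNReal.mul_rpow_of_nonneg _ _ (by positivity),
            ← ENNReal.rpow_mul, mul_one_div_cancel hv.ne', ENNReal.rpow_one]
      _ ≤ _ := by
          unfold mixedNorm
          gcongr ?_ ^ _
          exact (setLIntegral_mono' measurableSet_Ioc fun σ hσ =>
            ENNReal.rpow_le_rpow (h1 σ hσ) hv.le).trans (setLIntegral_le_lintegral _ _)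
  set A : ℝ := (a ^ N * m)⁻¹ with hA
  have hA0 : 0 < A := by positivity
  have hA1 : A ≤ 1 := inv_le_one_of_one_le₀ (one_le_mul_of_one_le_of_one_le (one_le_pow₀ ha1) hm1)
  have hAn : ‖(A : ℂ)‖ₑ = ENNReal.ofReal A := by
    rw [← ofReal_norm, Complex.norm_of_nonneg hA0.le]
  refine ⟨N, hN0, (A : ℂ) • P, fun n hn => ?_, ?_, fun s hs => ?_, ?_⟩
  · obtain ⟨h1, h2⟩ := support_pairProduct (Finsupp.support_smul hn)
    refine ⟨fun r hr => ?_, h1⟩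
    obtain ⟨j, -, rfl⟩ := h2 r hr
    exact (le_max_left _ _).trans_lt (hB j)
  · have h1 : mixedNorm p q α P ≤ ENNReal.ofReal (a ^ N * m) := by
      have h2 : ∀ σ, 0 < σ → hardyNorm p (P.translate σ) ≤ ENNReal.ofReal (a ^ N) := by
        intro σ hσ
        have := hardyNorm_translate_antitone P hp hσ.le
        simp only [translate_zero] at this
        rwa [hP, hardyNorm_pairProduct hinj hp] at this
      refine (mixedNorm_mono_of_hardyNorm_le hq h2).trans ?_
      rw [lintegral_const, ENNReal.mul_rpow_of_nonneg _ _ (by positivity), ← ENNReal.rpow_mul,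
        mul_one_div_cancel hq.ne', ENNReal.rpow_one, ENNReal.ofReal_mul (by positivity)]
      gcongr
    rw [mixedNorm_smul hp hq, hAn]
    refine (mul_le_mul_right h1 _).trans ?_
    rw [← ENNReal.ofReal_mul hA0.le, hA, inv_mul_cancel₀ (by positivity), ENNReal.ofReal_one]
  · have h1 : DirichletPolynomial.eval ((A : ℂ) • P) s = (A : ℂ) * P.eval s := by
      simpa using eval_sum_smul (Finset.range 1) (fun _ => (A : ℂ)) (fun _ => P) s
    rw [h1, norm_mul, Complex.norm_of_nonneg hA0.le]
    refine mul_le_one₀ hA1 (norm_nonneg _) (norm_eval_pairProduct_le π N (fun k => ?_) hs)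
    exact (le_max_right y 3).trans_lt (hB k)
  · rw [mixedNorm_smul hu hv, hAn]
    refine le_trans ?_ (mul_le_mul_right hlow _)
    rw [← ENNReal.ofReal_natCast, ENNReal.ofReal_rpow_of_pos (by positivity),
      ← ENNReal.ofReal_mul' (by positivity), ← ENNReal.ofReal_mul hA0.le]
    apply ENNReal.ofReal_le_ofReal
    have hβv : 0 < (β + 1) / v := div_pos (by linarith) hv
    set X : ℝ := ((N + 1 : ℕ) : ℝ) with hX
    have hX0 : 0 < X := by positivity
    have hτlow : (X ^ (2 * ((β + 1) / v)) * ℓ ^ ((β + 1) / v))⁻¹ * c ^ (1 / v)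
        ≤ (c * τ ^ (β + 1)) ^ (1 / v) := by
      rw [Real.mul_rpow hc.le (by positivity), ← Real.rpow_mul hτ0.le, mul_one_div, mul_comm,
        hτ, one_div (N * Real.log Y), Real.inv_rpow (by linarith)]
      have h1 : (N * Real.log Y) ^ ((β + 1) / v)
          ≤ X ^ (2 * ((β + 1) / v)) * ℓ ^ ((β + 1) / v) := by
        rw [Real.rpow_mul hX0.le, ← Real.mul_rpow (by positivity) (by linarith)]
        exact Real.rpow_le_rpow (by linarith) hNlog hβv.le
      gcongr
    calc M * X ^ (1 / u) ≤ max M 0 * X ^ (1 / u) := by gcongr; exact le_max_left _ _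
      _ = (max M 0 * G * X ^ (1 / u + 2 * ((β + 1) / v))) * (m⁻¹ * (Real.exp (-1)
          * ((X ^ (2 * ((β + 1) / v)) * ℓ ^ ((β + 1) / v))⁻¹ * c ^ (1 / v)))) := by
          rw [Real.rpow_add hX0, hG]
          field_simp
      _ ≤ (b / a) ^ N * (m⁻¹ * (Real.exp (-1) * (c * τ ^ (β + 1)) ^ (1 / v))) := by gcongr
      _ = _ := by
          rw [hA, div_pow]
          field_simp

end

end DirichletMixed

/-! ### The characterization of inclusions -/

theorem theorem1p5 (p q u v α β : ℝ) (hp : 0 < p) (hq : 0 < q) (hu : 0 < u) (hv : 0 < v)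
    (hα : -1 < α) (hβ : -1 < β) :
    DirichletMixed.mixedSpace p q α ⊆ DirichletMixed.mixedSpace u v β ↔
      (u ≤ p ∧ (α + 1) / q < (β + 1) / v) ∨
        (u ≤ p ∧ (α + 1) / q = (β + 1) / v ∧ q ≤ v) := by
  constructor
  · intro h
    have hno := fun H => DirichletMixed.not_subset_of_hasTestPolynomials hp hq hα hu hv hβ H h
    have h1 : u ≤ p := le_of_not_gt fun hlt =>
      hno (DirichletMixed.hasTestPolynomials_of_lt hp hq hα hu hv hβ hlt)
    rcases lt_trichotomy ((α + 1) / q) ((β + 1) / v) with hlt | heq | hgt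
    · exact Or.inl ⟨h1, hlt⟩
    · exact Or.inr ⟨h1, heq, le_of_not_gt fun hlt =>
        hno (DirichletMixed.hasTestPolynomials_of_lacunary hp hq hα hu hv hβ (Or.inr ⟨heq, hlt⟩))⟩
    · exact absurd
        (DirichletMixed.hasTestPolynomials_of_lacunary hp hq hα hu hv hβ (Or.inl hgt)) hno
  · intro h
    have hup : u ≤ p := h.elim And.left And.left
    obtain ⟨C, hC, hle⟩ :=
      DirichletMixed.mixedNorm_le_mixedNorm hq hu hv hα hβ hup (h.imp And.right And.right)
    exact DirichletMixed.mixedSpace_subset_of_mixedNorm_le hC hle
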